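/- Let $n,q,r\ge 1$ and $p\ge 0$ be integers, $X\in\mathbb R^{n\times p}$, $Y^{(1)},\dots,Y^{(r)}\in\mathbb R^{n\times q}$, $\lambda>0$ and $\underline\sigma>0$. For $B\in\mathbb R^{p\times q}$ with rows $B_{1:},\dots,B_{p:}$ put $\|B\|_{2,1}=\sum_{j=1}^p\|B_{j:}\|$ (Euclidean norms of the rows). Let $$\mathcal F=\{(B,S)\in\mathbb R^{p\times q}\times\mathbb R^{n\times n}: S \text{ symmetric},\ S-\underline\sigma\,\mathrm{Id}_n \text{ positive semidefinite}\},$$ $$f(B,S)=\sum_{l=1}^r\frac{\operatorname{Tr}\big((Y^{(l)}-XB)^\top S^{-1}(Y^{(l)}-XB)\big)}{2nqr}+\frac{\operatorname{Tr}(S)}{2n},\qquad F(B,S)=f(B,S)+\lambda\|B\|_{2,1}.$$ The CLaR problem is to minimize $F$ over $\mathcal F$. 1. $\mathcal F$ is convex and $F$ is jointly convex in $(B,S)$ on $\mathcal F$. 2. $f$ is convex on $\mathcal F$ and smooth there: regarded as a function of all the entries of $(B,S)$, it is $C^\infty$ near every point of $\mathcal F$, and its gradient is Lipschitz on every bounded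 subset of $\mathcal F$. 3. $\|\cdot\|_{2,1}$ is convex on $\mathbb R^{p\times q}$ and separable in the rows: it is a sum $\sum_j g_j(B_{j:})$ with convex functions $g_j$ on $\mathbb R^q$. 4. Alternate minimization converges to a global minimum. Fix an integer $\nu\ge1$. Starting from an arbitrary pair $(B^0,S^0)$, epoch $t=0,1,2,\dots$ produces $(B^{t+1},S^{t+1})$ from $(B^t,S^t)$ as follows: if $\nu$ divides $t$, then $S^{t+1}$ is a minimizer of $F(B^t,\cdot)$ over $\{S: S-\underline\sigma\,\mathrm{Id}_n \text{ positive semidefinite}\}$, otherwise $S^{t+1}=S^t$; then, for $j=1,\dots,p$ in turn, the $j$-th row of the current matrix $B$ is replaced by a minimizer of $F(\cdot,S^{t+1})$ in this row, all other rows being kept fixed, and $B^{t+1}$ is the matrix obtained after row $p$. Then such a sequence exists for every $(B^0,S^0)$, and for every such sequence there is a global minimizer $(\hat B,\hat S)\in\mathcal F$ of $F$ over $\mathcal F$ such that $B^t\to\hat B$, $S^t\to\hat S$ and $F(B^t,S^t)\to F(\hat B,\hat S)=\min_{\mathcal F}F$. -/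

import Mathlib

open Filter Topology
open scoped ContDiff NNReal Matrix

namespace Clar

noncomputable section

/-- Squared Mahalanobis norm of `A` induced by `M`: `Tr (Aᵀ M A)`. -/
def mahalanobisSq {n q : ℕ} (M : Matrix (Fin n) (Fin n) ℝ) (A : Matrix (Fin n) (Fin q) ℝ) : ℝ :=
  (Aᵀ * M * A).trace

/-- The mixed norm `‖B‖_{2,1}`: the sum of the Euclidean norms of the rows of `B`. -/
def norm21 {p q : ℕ} (B : Matrix (Fin p) (Fin q) ℝ) : ℝ :=
  ∑ j, ‖WithLp.toLp 2 (B j)‖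

/-- The constraint `S ⪰ σ Id` (in particular `S` is symmetric). -/
def constraint (n : ℕ) (σ : ℝ) : Set (Matrix (Fin n) (Fin n) ℝ) :=
  {S | (S - σ • (1 : Matrix (Fin n) (Fin n) ℝ)).PosSemidef}

/-- The set of all pairs `(B, S)` with `S ⪰ σ Id`. -/
def feasible (n p q : ℕ) (σ : ℝ) :
    Set (Matrix (Fin p) (Fin q) ℝ × Matrix (Fin n) (Fin n) ℝ) :=
  {z | z.2 ∈ constraint n σ}

/-- The data term `f(B, S) = ∑ₗ ‖Y⁽ˡ⁾ - X B‖²_{S⁻¹} / (2nqr) + Tr S / (2n)`. -/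
def dataFit {n p q r : ℕ} (X : Matrix (Fin n) (Fin p) ℝ) (Y : Fin r → Matrix (Fin n) (Fin q) ℝ)
    (B : Matrix (Fin p) (Fin q) ℝ) (S : Matrix (Fin n) (Fin n) ℝ) : ℝ :=
  (∑ l, mahalanobisSq S⁻¹ (Y l - X * B) / (2 * (n : ℝ) * q * r)) + S.trace / (2 * (n : ℝ))

/-- The Euclidean space of all entries of a pair `(B, S)`. -/
abbrev PairSpace (n p q : ℕ) : Type :=
  EuclideanSpace ℝ ((Fin p × Fin q) ⊕ (Fin n × Fin n))

/-- The pair of matrices with the given entries. -/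
def toPair {n p q : ℕ} (x : PairSpace n p q) :
    Matrix (Fin p) (Fin q) ℝ × Matrix (Fin n) (Fin n) ℝ :=
  (Matrix.of fun j k => x (Sum.inl (j, k)), Matrix.of fun i k => x (Sum.inr (i, k)))

/-- The data term as a function on the Euclidean space of pairs. -/
def dataFitPair {n p q r : ℕ} (X : Matrix (Fin n) (Fin p) ℝ)
    (Y : Fin r → Matrix (Fin n) (Fin q) ℝ) (x : PairSpace n p q) : ℝ :=
  dataFit X Y (toPair x).1 (toPair x).2

/-- The objective `f(B, S) + lam ‖B‖_{2,1}`. -/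
def objective {n p q r : ℕ} (X : Matrix (Fin n) (Fin p) ℝ) (Y : Fin r → Matrix (Fin n) (Fin q) ℝ)
    (lam : ℝ) (B : Matrix (Fin p) (Fin q) ℝ) (S : Matrix (Fin n) (Fin n) ℝ) : ℝ :=
  dataFit X Y B S + lam * norm21 B

/-- `S` minimizes the objective over the constraint set, for fixed `B`. -/
def IsNoiseUpdate {n p q r : ℕ} (X : Matrix (Fin n) (Fin p) ℝ)
    (Y : Fin r → Matrix (Fin n) (Fin q) ℝ) (lam σ : ℝ)
    (B : Matrix (Fin p) (Fin q) ℝ) (S : Matrix (Fin n) (Fin n) ℝ) : Prop :=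
  S ∈ constraint n σ ∧ ∀ S' ∈ constraint n σ, objective X Y lam B S ≤ objective X Y lam B S'

/-- `B'` arises from `B` by replacing row `j` with a minimizer of the objective in that row,
all other rows and `S` being kept fixed. -/
def IsRowUpdate {n p q r : ℕ} (X : Matrix (Fin n) (Fin p) ℝ)
    (Y : Fin r → Matrix (Fin n) (Fin q) ℝ) (lam : ℝ) (S : Matrix (Fin n) (Fin n) ℝ) (j : Fin p)
    (B B' : Matrix (Fin p) (Fin q) ℝ) : Prop :=
  ∃ v : Fin q → ℝ, B' = B.updateRow j v ∧
    ∀ w : Fin q → ℝ, objective X Y lam (B.updateRow j v) S ≤ objective X Y lam (B.updateRow j w) S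

/-- `B'` arises from `B` by one pass of row updates, over the rows in their order. -/
def IsSweep {n p q r : ℕ} (X : Matrix (Fin n) (Fin p) ℝ)
    (Y : Fin r → Matrix (Fin n) (Fin q) ℝ) (lam : ℝ) (S : Matrix (Fin n) (Fin n) ℝ)
    (B B' : Matrix (Fin p) (Fin q) ℝ) : Prop :=
  ∃ C : Fin (p + 1) → Matrix (Fin p) (Fin q) ℝ, C 0 = B ∧ C (Fin.last p) = B' ∧
    ∀ j : Fin p, IsRowUpdate X Y lam S j (C j.castSucc) (C j.succ)

/-- Alternate minimization. `(B t, S t)` is the pair after `t` epochs. Every epoch consists of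
a noise update (only once every `freq` epochs, starting with the first epoch) and of one pass
over the rows of `B`. -/
def IsAlternateMinimization {n p q r : ℕ} (X : Matrix (Fin n) (Fin p) ℝ)
    (Y : Fin r → Matrix (Fin n) (Fin q) ℝ) (lam σ : ℝ) (freq : ℕ)
    (B : ℕ → Matrix (Fin p) (Fin q) ℝ) (S : ℕ → Matrix (Fin n) (Fin n) ℝ) : Prop :=
  ∀ t, (freq ∣ t → IsNoiseUpdate X Y lam σ (B t) (S (t + 1))) ∧
    (¬ freq ∣ t → S (t + 1) = S t) ∧
    IsSweep X Y lam (S (t + 1)) (B t) (B (t + 1))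

end

end Clar

namespace Clar

noncomputable section

/-! ### Error bounds for the positive semidefinite cone cut by an affine subspace. -/

section ErrorBound

open scoped Matrix.Norms.Elementwise

/-! Completing the square gives Tr(RᵀS⁻¹R) = Tr((R−SW)ᵀS⁻¹(R−SW)) + 2Tr(WᵀR) − Tr(WᵀSW). For W =
S₀⁻¹R₀ the last two terms are linear in (R, S) and give the tangent of the data term at (R₀, S₀);
the first is a nonnegative, exact remainder (`dataFit_eq_add_slope`). Convexity and all first order
conditions come from this identity. Smoothness is Cramer's rule.

Convergence is harder: F need not be strictly convex, minimizers may form a continuum, and mere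
descent does not single out a limit. The B-iterates are shown to have finite length by a Łojasiewicz
argument (`bounded_sum_of_descent`), which has two ingredients.

The first is Hölder growth (`exists_growth`): on sublevel sets a power of the distance to the
minimizers is bounded by the suboptimality. With the dual variable W of one fixed minimizer, the
suboptimality of any feasible pair is a sum of nonnegative terms (`objective_eq_of_isMin`). They
vanish together exactly when S − σ Id and the row norms of B solve a linear system inside a cone of
positive semidefinite matrices, since equality in Cauchy–Schwarz forces each row of B to be its norm
times a fixed vector. Sturm's bound `psd_errorBound` then applies. It is proved by facial reduction:
if a positive definite solution exists, the bound is linear; otherwise all solutions lie on a proper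
face, which is a smaller cone, and the exponent doubles.

The second is an estimate per block of ν epochs. A sweep decreases F by at least the square of its
movement, up to a constant, and violates optimality in B by at most a multiple of it
(`exists_sweep_estimate`); the row conditions can be added up because the penalty is separable.
Hence suboptimality ≤ const · movement · distance (`suboptimality_le`), and growth eliminates the
distance (`lojasiewicz_of_growth`).

So B converges. The noise minimizer for a given B is unique (`IsNoiseUpdate.unique`), hence depends
continuously on B, and S converges too. The values tend to the minimum, so the limit is a global
minimizer. -/

theorem posSemidef_real_iff {m : Type*} [Fintype m] {M : Matrix m m ℝ} :
    M.PosSemidef ↔ Mᵀ = M ∧ ∀ v, 0 ≤ v ⬝ᵥ (M *ᵥ v) := by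
  rw [Matrix.posSemidef_iff_dotProduct_mulVec]
  simp [Matrix.IsHermitian, Matrix.conjTranspose_eq_transpose_of_trivial]

theorem _root_.Matrix.PosSemidef.transpose_eq {m : Type*} [Fintype m] {M : Matrix m m ℝ}
    (hM : M.PosSemidef) : Mᵀ = M := (posSemidef_real_iff.1 hM).1

/-- The principal 2×2 minor on the indices `i`, `j` is nonnegative. -/
theorem _root_.Matrix.PosSemidef.sq_apply_le {m : Type*} [Fintype m] {M : Matrix m m ℝ}
    (hM : M.PosSemidef) (i j : m) : M i j ^ 2 ≤ M i i * M j j := by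
  have h := (hM.submatrix ![i, j]).det_nonneg
  have hs : M j i = M i j := congrFun (congrFun hM.transpose_eq i) j
  rw [Matrix.det_fin_two] at h
  simp [hs] at h
  nlinarith

/-- Cauchy–Schwarz for the sum of the |v i|; the norm is the largest absolute value of an entry,
hence the factor `card m`. -/
theorem dotProduct_mulVec_abs_le {m : Type*} [Fintype m] (M : Matrix m m ℝ) (v : m → ℝ) :
    |v ⬝ᵥ (M *ᵥ v)| ≤ Fintype.card m * ‖M‖ * (v ⬝ᵥ v) := by
  have h1 : |v ⬝ᵥ (M *ᵥ v)| ≤ ‖M‖ * (∑ i, |v i|) ^ 2 := by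
    simp only [dotProduct, Matrix.mulVec, Finset.mul_sum, sq, Finset.sum_mul]
    refine (Finset.abs_sum_le_sum_abs _ _).trans (Finset.sum_le_sum fun i _ => ?_)
    refine (Finset.abs_sum_le_sum_abs _ _).trans (Finset.sum_le_sum fun j _ => ?_)
    rw [abs_mul, abs_mul]
    have := M.norm_entry_le_entrywise_sup_norm (i := i) (j := j)
    rw [Real.norm_eq_abs] at this
    calc |v i| * (|M i j| * |v j|) = |M i j| * (|v i| * |v j|) := by ring
      _ ≤ ‖M‖ * (|v i| * |v j|) := by gcongr
      _ = ‖M‖ * (|v j| * |v i|) := by ring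
  have h2 : (∑ i, |v i|) ^ 2 ≤ Fintype.card m * (v ⬝ᵥ v) := by
    have := sq_sum_le_card_mul_sum_sq (s := Finset.univ) (f := fun i => |v i|)
    simpa [dotProduct, sq] using this
  calc |v ⬝ᵥ (M *ᵥ v)| ≤ ‖M‖ * (∑ i, |v i|) ^ 2 := h1
    _ ≤ ‖M‖ * (Fintype.card m * (v ⬝ᵥ v)) := by gcongr
    _ = _ := by ring

/-- Error bound for linear equations. -/
theorem exists_solution_norm_sub_le {V E : Type*} [NormedAddCommGroup V] [NormedSpace ℝ V]
    [FiniteDimensional ℝ V] [NormedAddCommGroup E] [NormedSpace ℝ E] (A : V →ₗ[ℝ] E) {b : E}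
    {x₀ : V} (hx₀ : A x₀ = b) :
    ∃ C, 0 ≤ C ∧ ∀ x, ∃ y, A y = b ∧ ‖x - y‖ ≤ C * ‖A x - b‖ := by
  obtain ⟨g, hg⟩ := A.rangeRestrict.exists_rightInverse_of_surjective A.range_rangeRestrict
  refine ⟨‖LinearMap.toContinuousLinearMap g‖, norm_nonneg (LinearMap.toContinuousLinearMap g), fun x => ?_⟩
  have key : A (g (A.rangeRestrict (x - x₀))) = A (x - x₀) := by
    have := congrArg Subtype.val (LinearMap.congr_fun hg (A.rangeRestrict (x - x₀)))
    simpa using this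
  refine ⟨x - g (A.rangeRestrict (x - x₀)), ?_, ?_⟩
  · rw [map_sub, key, map_sub, hx₀]; abel
  · have := (LinearMap.toContinuousLinearMap g).le_opNorm (A.rangeRestrict (x - x₀))
    simpa [hx₀] using this

/-- The strictly positive matrices, not necessarily symmetric. -/
def strictlyPositive (k : ℕ) : Set (Matrix (Fin k) (Fin k) ℝ) :=
  {M | ∃ κ > 0, ∀ v, κ * (v ⬝ᵥ v) ≤ v ⬝ᵥ (M *ᵥ v)}

theorem convex_strictlyPositive (k : ℕ) : Convex ℝ (strictlyPositive k) := by
  rintro M ⟨κ, hκ, hM⟩ M' ⟨κ', hκ', hM'⟩ a b ha hb hab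
  refine ⟨a * κ + b * κ', ?_, fun v => ?_⟩
  · rcases ha.eq_or_lt with rfl | ha
    · have : b = 1 := by linarith
      subst this; simpa using hκ'
    · positivity
  · simp only [Matrix.add_mulVec, Matrix.smul_mulVec, dotProduct_add, dotProduct_smul, smul_eq_mul]
    nlinarith [mul_le_mul_of_nonneg_left (hM v) ha, mul_le_mul_of_nonneg_left (hM' v) hb]

theorem isOpen_strictlyPositive (k : ℕ) : IsOpen (strictlyPositive k) := by
  refine Metric.isOpen_iff.2 ?_
  rintro M ⟨κ, hκ, hM⟩
  -- Chosen so that the quadratic form changes by at most half of κ; `k + 1` instead of `k` covers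
  -- size zero.
  refine ⟨κ / (2 * (k + 1)), by positivity, fun M' hM' => ⟨κ / 2, by positivity, fun v => ?_⟩⟩
  rw [Metric.mem_ball, dist_eq_norm] at hM'
  have h1 := dotProduct_mulVec_abs_le (M' - M) v
  have hv : 0 ≤ v ⬝ᵥ v := by simpa using dotProduct_self_star_nonneg v
  have h2 : (k : ℝ) * ‖M' - M‖ ≤ κ / 2 := by
    have : (k : ℝ) * ‖M' - M‖ ≤ (k + 1) * (κ / (2 * (k + 1))) := by gcongr; linarith
    refine this.trans (le_of_eq ?_)
    field_simp
  simp only [Fintype.card_fin, Matrix.sub_mulVec, dotProduct_sub] at h1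
  have h3 := (abs_le.1 h1).1
  nlinarith [hM v, mul_le_mul_of_nonneg_right h2 hv]

theorem add_smul_one_mem_strictlyPositive {k : ℕ} {M : Matrix (Fin k) (Fin k) ℝ}
    (hM : ∀ v, 0 ≤ v ⬝ᵥ (M *ᵥ v)) {ε : ℝ} (hε : 0 < ε) : M + ε • 1 ∈ strictlyPositive k := by
  refine ⟨ε, hε, fun v => ?_⟩
  simp only [Matrix.add_mulVec, Matrix.smul_mulVec, Matrix.one_mulVec, dotProduct_add,
    dotProduct_smul, smul_eq_mul]
  linarith [hM v]

/-- If no symmetric solution is positive definite, then all of them are orthogonal to a nonzero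
positive semidefinite matrix. -/
theorem exists_posSemidef_orthogonal {k : ℕ} {E : Type*} [AddCommGroup E] [Module ℝ E]
    (A : Matrix (Fin k) (Fin k) ℝ →ₗ[ℝ] E) {b : E} {S₀ : Matrix (Fin k) (Fin k) ℝ}
    (hS₀ : S₀.PosSemidef) (hA : A S₀ = b)
    (hno : ∀ Y, Yᵀ = Y → A Y = b → Y ∉ strictlyPositive k) :
    ∃ N : Matrix (Fin k) (Fin k) ℝ, N.PosSemidef ∧ N ≠ 0 ∧
      ∀ Y, Yᵀ = Y → A Y = b → (N * Y).trace = 0 := by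
  -- Symmetry is required in the affine set and not in the cone, so that the cone is open in the
  -- space of all matrices and can be separated from `V`.
  set V : Set (Matrix (Fin k) (Fin k) ℝ) := {Y | Yᵀ = Y ∧ A Y = b} with hV
  have hVc : Convex ℝ V := by
    rintro Y ⟨h1, h2⟩ Y' ⟨h1', h2'⟩ a c ha hc hac
    refine ⟨by simp [h1, h1'], ?_⟩
    rw [map_add, map_smul, map_smul, h2, h2', ← add_smul, hac, one_smul]
  have hdisj : Disjoint (strictlyPositive k) V :=
    Set.disjoint_right.2 fun Y hY => hno Y hY.1 hY.2
  obtain ⟨g, u, hg1, hg2⟩ := geometric_hahn_banach_open (convex_strictlyPositive k)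
    (isOpen_strictlyPositive k) hVc hdisj
  have hsmul : ∀ M ∈ strictlyPositive k, ∀ s : ℝ, 0 < s → s • M ∈ strictlyPositive k := by
    rintro M ⟨κ, hκ, hM⟩ s hs
    refine ⟨s * κ, by positivity, fun v => ?_⟩
    simp only [Matrix.smul_mulVec, dotProduct_smul, smul_eq_mul]
    nlinarith [mul_le_mul_of_nonneg_left (hM v) hs.le]
  have hone : (1 : Matrix (Fin k) (Fin k) ℝ) ∈ strictlyPositive k := by
    simpa using add_smul_one_mem_strictlyPositive (k := k) (M := 0) (by simp) one_pos
  -- A functional bounded above on a cone is nonpositive there: otherwise scaling would exceed `u`.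
  have hle : ∀ M ∈ strictlyPositive k, g M ≤ 0 := by
    intro M hM
    by_contra! h
    have hs : 0 < (|u| + 1) / g M := by positivity
    have := hg1 _ (hsmul M hM _ hs)
    rw [map_smul, smul_eq_mul, div_mul_cancel₀ _ h.ne'] at this
    linarith [le_abs_self u]
  have hpsd : ∀ M : Matrix (Fin k) (Fin k) ℝ, (∀ v, 0 ≤ v ⬝ᵥ (M *ᵥ v)) → g M ≤ 0 := by
    intro M hM
    refine le_of_forall_pos_le_add fun ε hε => ?_
    have hs : 0 < ε / (|g 1| + 1) := by positivity
    have := hle _ (add_smul_one_mem_strictlyPositive hM hs)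
    rw [map_add, map_smul, smul_eq_mul] at this
    have h2 : ε / (|g 1| + 1) * |g 1| ≤ ε := by
      rw [div_mul_eq_mul_div, div_le_iff₀ (by positivity)]
      nlinarith [abs_nonneg (g 1)]
    nlinarith [neg_abs_le (g 1), mul_le_mul_of_nonneg_left (neg_abs_le (g 1)) hs.le]
  have hu0 : 0 ≤ u := by
    by_contra! h
    have hs : 0 < -u / (|g 1| + 1) := by have : 0 < -u := by linarith
                                         positivity
    have := hg1 _ (hsmul 1 hone _ hs)
    rw [map_smul, smul_eq_mul] at this
    have h2 : -u / (|g 1| + 1) * |g 1| ≤ -u := by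
      rw [div_mul_eq_mul_div, div_le_iff₀ (by positivity)]
      nlinarith [abs_nonneg (g 1)]
    nlinarith [mul_le_mul_of_nonneg_left (neg_abs_le (g 1)) hs.le]
  have hS₀V : S₀ ∈ V := ⟨hS₀.transpose_eq, hA⟩
  have hgS : g S₀ = 0 :=
    le_antisymm (hpsd _ (posSemidef_real_iff.1 hS₀).2) (hu0.trans (hg2 _ hS₀V))
  -- `g` is nonnegative at `Y` and at its reflection in `S₀`, and these two values add up to 2 g(S₀)
  -- = 0.
  have hVz : ∀ Y ∈ V, g Y = 0 := by
    intro Y hY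
    have h1 := hu0.trans (hg2 _ hY)
    have h2 := hu0.trans (hg2 ((2 : ℝ) • S₀ - Y) ⟨by simp [hY.1, hS₀V.1], by
      rw [map_sub, map_smul, hA, hY.2, two_smul]; abel⟩)
    rw [map_sub, map_smul, hgS] at h2
    simp at h2
    linarith
  have hg1neg : g 1 < 0 := by
    have h1 := hg1 1 hone
    have := hg2 _ hS₀V
    linarith
  -- `N` represents −g on symmetric matrices. The symmetrization is harmless there, and N ≠ 0
  -- because g(1) < 0.
  let N : Matrix (Fin k) (Fin k) ℝ :=
    Matrix.of fun i j => -(g (Matrix.single i j 1) + g (Matrix.single j i 1)) / 2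
  have hg : ∀ Y : Matrix (Fin k) (Fin k) ℝ, g Y = ∑ i, ∑ j, Y i j * g (Matrix.single i j 1) := by
    intro Y
    conv_lhs => rw [Matrix.matrix_eq_sum_single Y]
    simp only [map_sum]
    refine Finset.sum_congr rfl fun i _ => Finset.sum_congr rfl fun j _ => ?_
    rw [← smul_eq_mul, ← map_smul, Matrix.smul_single, smul_eq_mul, mul_one]
  have hN : ∀ Y : Matrix (Fin k) (Fin k) ℝ, Yᵀ = Y → (N * Y).trace = -g Y := by
    intro Y hY
    have hs : ∀ i j, Y j i = Y i j := fun i j => congrFun (congrFun hY i) j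
    have h1 : (N * Y).trace =
        (∑ i, ∑ j, -(Y i j * g (Matrix.single i j 1)) / 2) +
        ∑ i, ∑ j, -(Y j i * g (Matrix.single j i 1)) / 2 := by
      simp only [Matrix.trace, Matrix.diag, Matrix.mul_apply, N, Matrix.of_apply,
        ← Finset.sum_add_distrib]
      refine Finset.sum_congr rfl fun i _ => Finset.sum_congr rfl fun j _ => ?_
      rw [hs i j]; ring
    rw [h1, Finset.sum_comm (f := fun i j => -(Y j i * g (Matrix.single j i 1)) / 2), hg Y]
    rw [← Finset.sum_add_distrib, ← Finset.sum_neg_distrib]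
    refine Finset.sum_congr rfl fun i _ => ?_
    rw [← Finset.sum_add_distrib, ← Finset.sum_neg_distrib]
    exact Finset.sum_congr rfl fun j _ => by ring
  refine ⟨N, posSemidef_real_iff.2 ⟨?_, fun v => ?_⟩, ?_, fun Y h1 h2 => ?_⟩
  · ext i j; simp [N, add_comm]
  · have h := hN (Matrix.vecMulVec v v) (Matrix.transpose_vecMulVec v v)
    have h2 := hpsd (Matrix.vecMulVec v v) fun w => by
      rw [Matrix.vecMulVec_mulVec]
      simp only [op_smul_eq_smul, dotProduct_smul, smul_eq_mul]
      rw [dotProduct_comm w v]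
      exact mul_self_nonneg _
    rw [Matrix.mul_vecMulVec, Matrix.trace_vecMulVec, dotProduct_comm] at h
    linarith
  · intro h
    have := hN 1 Matrix.transpose_one
    rw [h] at this
    simp at this
    linarith
  · rw [hN Y h1, hVz Y ⟨h1, h2⟩, neg_zero]
theorem norm_mul_le_card {l m o : Type*} [Fintype l] [Fintype m] [Fintype o]
    (A : Matrix l m ℝ) (B : Matrix m o ℝ) : ‖A * B‖ ≤ Fintype.card m * ‖A‖ * ‖B‖ := by
  refine (Matrix.norm_le_iff (by positivity)).2 fun i j => ?_
  rw [Matrix.mul_apply]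
  calc ‖∑ x, A i x * B x j‖ ≤ ∑ x : m, ‖A‖ * ‖B‖ := by
        refine norm_sum_le_of_le _ fun x _ => ?_
        rw [norm_mul]
        gcongr
        · exact A.norm_entry_le_entrywise_sup_norm
        · exact B.norm_entry_le_entrywise_sup_norm
    _ = _ := by simp; ring

theorem norm_conj_le {l m : Type*} [Fintype l] [Fintype m]
    (Q : Matrix l m ℝ) (B : Matrix m m ℝ) :
    ‖Q * B * Qᵀ‖ ≤ Fintype.card m ^ 2 * ‖Q‖ ^ 2 * ‖B‖ := by
  calc ‖Q * B * Qᵀ‖ ≤ Fintype.card m * ‖Q * B‖ * ‖Qᵀ‖ := norm_mul_le_card _ _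
    _ ≤ Fintype.card m * (Fintype.card m * ‖Q‖ * ‖B‖) * ‖Q‖ := by
        rw [Matrix.norm_transpose]
        gcongr
        exact norm_mul_le_card _ _
    _ = _ := by ring

theorem abs_trace_le {m : Type*} [Fintype m] (A : Matrix m m ℝ) :
    |A.trace| ≤ Fintype.card m * ‖A‖ := by
  calc |A.trace| ≤ ∑ _i : m, ‖A‖ :=
        (Finset.abs_sum_le_sum_abs _ _).trans
          (Finset.sum_le_sum fun i _ => A.norm_entry_le_entrywise_sup_norm (i := i) (j := i))
    _ = _ := by simp

theorem exists_norm_map_le {V E : Type*} [NormedAddCommGroup V] [NormedSpace ℝ V]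
    [FiniteDimensional ℝ V] [NormedAddCommGroup E] [NormedSpace ℝ E] (A : V →ₗ[ℝ] E) :
    ∃ α, 0 ≤ α ∧ ∀ x, ‖A x‖ ≤ α * ‖x‖ :=
  ⟨‖LinearMap.toContinuousLinearMap A‖, norm_nonneg (LinearMap.toContinuousLinearMap A),
    (LinearMap.toContinuousLinearMap A).le_opNorm⟩

/-- The linear error bound is applied to `A` paired with X ↦ Xᵀ − X; for symmetric `X` the second
residual is zero. -/
theorem exists_symm_solution {k : ℕ} {E : Type*} [NormedAddCommGroup E] [NormedSpace ℝ E]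
    (A : Matrix (Fin k) (Fin k) ℝ →ₗ[ℝ] E) {b : E} {S₀ : Matrix (Fin k) (Fin k) ℝ}
    (hS₀ : S₀ᵀ = S₀) (hA : A S₀ = b) :
    ∃ C, 0 ≤ C ∧ ∀ X : Matrix (Fin k) (Fin k) ℝ, Xᵀ = X →
      ∃ Y, Yᵀ = Y ∧ A Y = b ∧ ‖X - Y‖ ≤ C * ‖A X - b‖ := by
  let T : Matrix (Fin k) (Fin k) ℝ →ₗ[ℝ] Matrix (Fin k) (Fin k) ℝ :=
    (Matrix.transposeLinearEquiv (Fin k) (Fin k) ℝ ℝ).toLinearMap - LinearMap.id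
  have hT : ∀ X, T X = Xᵀ - X := fun X => rfl
  obtain ⟨C, hC, h⟩ := exists_solution_norm_sub_le (A.prod T) (b := (b, 0)) (x₀ := S₀)
    (by simp [hT, hA, hS₀])
  refine ⟨C, hC, fun X hX => ?_⟩
  obtain ⟨Y, hY, hXY⟩ := h X
  refine ⟨Y, sub_eq_zero.1 (congrArg Prod.snd hY), congrArg Prod.fst hY, ?_⟩
  simpa [hT, hX, Prod.norm_def] using hXY

/-- The Slater case. A nearby symmetric solution fails positivity by at most a multiple of its
distance to `X`; moving it slightly towards the interior solution `S₁` repairs this at linear cost.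
-/
theorem errorBound_of_strictlyPositive {k : ℕ} {E : Type*} [NormedAddCommGroup E]
    [NormedSpace ℝ E] (A : Matrix (Fin k) (Fin k) ℝ →ₗ[ℝ] E) {b : E}
    {S₁ : Matrix (Fin k) (Fin k) ℝ} (hsymm : S₁ᵀ = S₁) (hA : A S₁ = b)
    (hpos : S₁ ∈ strictlyPositive k) {M : ℝ} (hM : 0 ≤ M) :
    ∃ C, 0 ≤ C ∧ ∀ X : Matrix (Fin k) (Fin k) ℝ, X.PosSemidef → ‖X‖ ≤ M →
      ∃ Y, Y.PosSemidef ∧ A Y = b ∧ ‖X - Y‖ ≤ C * ‖A X - b‖ := by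
  obtain ⟨C₁, hC₁, h⟩ := exists_symm_solution A hsymm hA
  obtain ⟨κ, hκ, hS₁⟩ := hpos
  obtain ⟨α, hα0, hα⟩ := exists_norm_map_le A
  refine ⟨C₁ * (1 + k / κ * (‖S₁‖ + M + C₁ * (α * M + ‖b‖))), by positivity,
    fun X hX hXM => ?_⟩
  obtain ⟨Y, hYs, hY, hXY⟩ := h X hX.transpose_eq
  set r := ‖A X - b‖ with hr
  have hrR : r ≤ α * M + ‖b‖ := by
    refine (norm_sub_le _ _).trans ?_
    have := hα X
    have : α * ‖X‖ ≤ α * M := by gcongr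
    linarith
  have hr0 : 0 ≤ r := norm_nonneg _
  set η := ‖X - Y‖ with hη
  have hη0 : 0 ≤ η := norm_nonneg _
  have hden : 0 < κ + k * η := by positivity
  -- The weight that balances the two effects: `Y` may be negative by k η, `S₁` is positive by κ,
  -- and θ κ = (1 − θ) k η.
  set θ := k * η / (κ + k * η) with hθ
  have hθ0 : 0 ≤ θ := by positivity
  have hθ1 : θ ≤ 1 := by rw [hθ, div_le_one hden]; linarith
  have hθκ : θ * κ = (1 - θ) * (k * η) := by rw [hθ]; field_simp; ring
  have hθle : θ ≤ k / κ * η := by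
    rw [hθ, div_mul_eq_mul_div]
    gcongr
    nlinarith [mul_nonneg (Nat.cast_nonneg (α := ℝ) k) hη0]
  refine ⟨(1 - θ) • Y + θ • S₁, posSemidef_real_iff.2 ⟨by simp [hYs, hsymm], fun v => ?_⟩, ?_, ?_⟩
  · have hv : 0 ≤ v ⬝ᵥ v := by simpa using dotProduct_self_star_nonneg v
    have h1 := (abs_le.1 (dotProduct_mulVec_abs_le (X - Y) v)).2
    have h2 := (posSemidef_real_iff.1 hX).2 v
    simp only [Matrix.sub_mulVec, dotProduct_sub, Fintype.card_fin] at h1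
    simp only [Matrix.add_mulVec, Matrix.smul_mulVec, dotProduct_add, dotProduct_smul, smul_eq_mul]
    have h3 : -(k * η * (v ⬝ᵥ v)) ≤ v ⬝ᵥ Y *ᵥ v := by linarith
    have h4 := mul_le_mul_of_nonneg_left h3 (sub_nonneg.2 hθ1)
    have h5 := mul_le_mul_of_nonneg_left (hS₁ v) hθ0
    have h6 : θ * (κ * (v ⬝ᵥ v)) = (1 - θ) * (k * η * (v ⬝ᵥ v)) := by
      rw [← mul_assoc, hθκ]; ring
    linarith
  · rw [map_add, map_smul, map_smul, hY, hA, ← add_smul]; simp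
  · have h1 : X - ((1 - θ) • Y + θ • S₁) = (X - Y) - θ • (S₁ - X + (X - Y)) := by
      module
    have h2 : ‖θ • (S₁ - X + (X - Y))‖ ≤ θ * (‖S₁‖ + M + η) := by
      rw [norm_smul, Real.norm_of_nonneg hθ0]
      gcongr
      refine (norm_add_le _ _).trans ?_
      have := norm_sub_le S₁ X
      linarith
    have hηr : η ≤ C₁ * (α * M + ‖b‖) := hXY.trans (by gcongr)
    calc ‖X - ((1 - θ) • Y + θ • S₁)‖ ≤ η + θ * (‖S₁‖ + M + η) := by
          rw [h1]; exact (norm_sub_le _ _).trans (by linarith)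
      _ ≤ η + k / κ * η * (‖S₁‖ + M + C₁ * (α * M + ‖b‖)) := by gcongr
      _ = η * (1 + k / κ * (‖S₁‖ + M + C₁ * (α * M + ‖b‖))) := by ring
      _ ≤ (C₁ * r) * (1 + k / κ * (‖S₁‖ + M + C₁ * (α * M + ‖b‖))) := by gcongr
      _ = _ := by ring

/-- Bookkeeping of exponents. Passing to an approximation costs `a`, of order √r; an error bound
with exponent `N` at residual r + α a then costs `e`. The worst contribution is of order r^(1/(2N)).
-/
theorem pow_two_mul_le {N : ℕ} (hN : 1 ≤ N) {a e r R α K C C₂ : ℝ} (ha : 0 ≤ a) (he : 0 ≤ e)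
    (hr : 0 ≤ r) (hrR : r ≤ R) (hK : 0 ≤ K) (hC₂ : 0 ≤ C₂)
    (h1 : a ^ 2 ≤ C₂ * r) (h2 : e ^ N ≤ C * (r + α * a)) :
    (a + K * e) ^ (2 * N) ≤
      2 ^ (2 * N - 1) * (C₂ ^ N * R ^ (N - 1) + K ^ (2 * N) * (2 * C ^ 2 * (R + α ^ 2 * C₂))) * r := by
  have ha' : a ^ (2 * N) ≤ C₂ ^ N * R ^ (N - 1) * r := by
    calc a ^ (2 * N) = (a ^ 2) ^ N := by rw [pow_mul]
      _ ≤ (C₂ * r) ^ N := by gcongr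
      _ = C₂ ^ N * r ^ (N - 1) * r := by
          rw [mul_pow, mul_assoc, ← pow_succ, Nat.sub_add_cancel hN]
      _ ≤ _ := by gcongr
  have he' : e ^ (2 * N) ≤ 2 * C ^ 2 * (R + α ^ 2 * C₂) * r := by
    calc e ^ (2 * N) = (e ^ N) ^ 2 := by rw [mul_comm, pow_mul]
      _ ≤ (C * (r + α * a)) ^ 2 := by gcongr
      _ ≤ C ^ 2 * (2 * (r * r + α ^ 2 * a ^ 2)) := by
          rw [mul_pow]; gcongr; nlinarith [sq_nonneg (r - α * a)]
      _ ≤ C ^ 2 * (2 * (R * r + α ^ 2 * (C₂ * r))) := by gcongr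
      _ = _ := by ring
  calc (a + K * e) ^ (2 * N) ≤ 2 ^ (2 * N - 1) * (a ^ (2 * N) + (K * e) ^ (2 * N)) :=
        add_pow_le ha (by positivity) _
    _ ≤ 2 ^ (2 * N - 1) * (C₂ ^ N * R ^ (N - 1) * r +
          K ^ (2 * N) * (2 * C ^ 2 * (R + α ^ 2 * C₂) * r)) := by
        rw [mul_pow K]; gcongr
    _ = _ := by ring
-- The identity without column `i` is an isometric embedding, and this product is the projection
-- that kills coordinate `i`.
theorem submatrix_one_succAbove_mul_transpose {k : ℕ} (i : Fin (k + 1)) :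
    (1 : Matrix (Fin (k + 1)) (Fin (k + 1)) ℝ).submatrix id i.succAbove *
        ((1 : Matrix (Fin (k + 1)) (Fin (k + 1)) ℝ).submatrix id i.succAbove)ᵀ =
      Matrix.diagonal fun a => if a = i then 0 else 1 := by
  ext a c
  have h2 := congrFun (congrFun (one_mul (1 : Matrix (Fin (k + 1)) (Fin (k + 1)) ℝ)) a) c
  rw [Matrix.mul_apply, Fin.sum_univ_succAbove _ i] at h2
  have h3 : ((1 : Matrix (Fin (k + 1)) (Fin (k + 1)) ℝ).submatrix id i.succAbove *
        ((1 : Matrix (Fin (k + 1)) (Fin (k + 1)) ℝ).submatrix id i.succAbove)ᵀ) a c =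
      ∑ x, (1 : Matrix (Fin (k + 1)) (Fin (k + 1)) ℝ) a (i.succAbove x) *
        (1 : Matrix (Fin (k + 1)) (Fin (k + 1)) ℝ) (i.succAbove x) c := by
    simp only [Matrix.mul_apply, Matrix.transpose_apply, Matrix.submatrix_apply]
    exact Finset.sum_congr rfl fun x _ => by simp [Matrix.one_apply, eq_comm]
  rw [h3, eq_sub_of_add_eq' h2]
  by_cases hac : a = c
  · subst hac
    by_cases hai : a = i
    · subst hai; simp
    · simp [hai]
  · by_cases hai : a = i
    · subst hai; simp [hac]
    · simp [hac, hai]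

/-- A nonzero positive semidefinite `N` exposes a face of the cone of positive semidefinite
matrices; the distance to a linear span of a smaller cone is controlled by `Tr (N X)`. -/
theorem exists_face {k : ℕ} {N : Matrix (Fin (k + 1)) (Fin (k + 1)) ℝ} (hN : N.PosSemidef)
    (hN0 : N ≠ 0) :
    ∃ (Q : Matrix (Fin (k + 1)) (Fin k) ℝ) (K : ℝ), 0 ≤ K ∧ ∀ X, X.PosSemidef →
      ‖X - Q * (Qᵀ * X * Q) * Qᵀ‖ ^ 2 ≤ K * ‖X‖ * (N * X).trace := by
  set U : Matrix (Fin (k + 1)) (Fin (k + 1)) ℝ := hN.1.eigenvectorUnitary.1 with hU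
  set d := hN.1.eigenvalues with hd
  have hstar : star U = Uᵀ := rfl
  have hU2 : U * Uᵀ = 1 := by
    rw [← hstar]; exact Unitary.coe_mul_star_self hN.1.eigenvectorUnitary
  have hspec : N = U * Matrix.diagonal d * Uᵀ := by
    have := hN.1.spectral_theorem
    rw [Unitary.conjStarAlgAut_apply] at this
    exact this
  have hd0 : ∀ j, 0 ≤ d j := hN.eigenvalues_nonneg
  -- One positive eigenvalue suffices: only its eigenvector is removed, whatever the rank of `N`, so
  -- the size drops by exactly one.
  obtain ⟨i, hi⟩ : ∃ i, 0 < d i := by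
    by_contra! h
    apply hN0
    have : d = 0 := funext fun j => le_antisymm (h j) (hd0 j)
    rw [hspec, this]
    simp
  set P := (1 : Matrix (Fin (k + 1)) (Fin (k + 1)) ℝ).submatrix id i.succAbove with hP
  set D : Matrix (Fin (k + 1)) (Fin (k + 1)) ℝ := Matrix.diagonal fun a => if a = i then 0 else 1
    with hD
  have hPP : P * Pᵀ = D := submatrix_one_succAbove_mul_transpose i
  set κ := ((Fintype.card (Fin (k + 1)) : ℝ) ^ 2 * ‖U‖ ^ 2) with hκ
  refine ⟨U * P, κ ^ 2 * κ / d i, by positivity, fun X hX => ?_⟩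
  set X' := Uᵀ * X * U with hX'
  have hX'p : X'.PosSemidef := by
    have := hX.conjTranspose_mul_mul_same U
    rwa [Matrix.conjTranspose_eq_transpose_of_trivial] at this
  have hX'n : ‖X'‖ ≤ κ * ‖X‖ := by
    have := norm_conj_le Uᵀ X
    rwa [Matrix.transpose_transpose, Matrix.norm_transpose] at this
  have htr : d i * X' i i ≤ (N * X).trace := by
    have h1 : (N * X).trace = ∑ j, d j * X' j j := by
      rw [hspec, Matrix.mul_assoc, Matrix.mul_assoc, Matrix.trace_mul_comm, Matrix.mul_assoc,
        ← hX', Matrix.trace]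
      simp [Matrix.diagonal_mul]
    rw [h1]
    exact Finset.single_le_sum (f := fun j => d j * X' j j)
      (fun j _ => mul_nonneg (hd0 j) hX'p.diag_nonneg) (Finset.mem_univ i)
  have hdiff : X - U * P * ((U * P)ᵀ * X * (U * P)) * (U * P)ᵀ = U * (X' - D * X' * D) * Uᵀ := by
    have hDt : D = P * Pᵀ := hPP.symm
    have h1 : U * X' * Uᵀ = X := by
      rw [hX']
      calc U * (Uᵀ * X * U) * Uᵀ = (U * Uᵀ) * X * (U * Uᵀ) := by simp only [Matrix.mul_assoc]
        _ = X := by rw [hU2]; simp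
    rw [Matrix.mul_sub, Matrix.sub_mul, h1, hDt, hX', Matrix.transpose_mul]
    simp only [Matrix.mul_assoc]
  have hX'ii : 0 ≤ X' i i := hX'p.diag_nonneg
  -- Only row and column `i` survive in the difference, and the 2×2 minors bound their entries by
  -- the diagonal entry, which Tr(N X) controls.
  have hent : ∀ a c, |(X' - D * X' * D) a c| ^ 2 ≤ X' i i * ‖X'‖ := by
    intro a c
    have hb : ∀ j, X' j j ≤ ‖X'‖ := fun j =>
      (le_abs_self _).trans (X'.norm_entry_le_entrywise_sup_norm (i := j) (j := j))
    rw [sq_abs, hD, Matrix.sub_apply, Matrix.mul_diagonal, Matrix.diagonal_mul]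
    by_cases ha : a = i
    · subst ha
      simp only [if_true, zero_mul, sub_zero]
      exact (hX'p.sq_apply_le a c).trans (by gcongr; exact hb c)
    · by_cases hc : c = i
      · subst hc
        simp only [if_true, mul_zero, sub_zero]
        rw [mul_comm]
        exact (hX'p.sq_apply_le a c).trans (by gcongr; exact hb a)
      · simp only [ha, hc, if_false, one_mul, mul_one, sub_self]
        rw [zero_pow two_ne_zero]
        positivity
  have hn : ‖X' - D * X' * D‖ ^ 2 ≤ X' i i * ‖X'‖ := by
    have h1 : ‖X' - D * X' * D‖ ≤ √(X' i i * ‖X'‖) :=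
      (Matrix.norm_le_iff (Real.sqrt_nonneg _)).2 fun a c =>
        Real.le_sqrt_of_sq_le (by simpa using hent a c)
    calc _ ≤ √(X' i i * ‖X'‖) ^ 2 := by gcongr
      _ = _ := Real.sq_sqrt (by positivity)
  rw [hdiff]
  calc ‖U * (X' - D * X' * D) * Uᵀ‖ ^ 2 ≤ (κ * ‖X' - D * X' * D‖) ^ 2 := by
        gcongr; exact norm_conj_le _ _
    _ ≤ κ ^ 2 * (X' i i * ‖X'‖) := by rw [mul_pow]; gcongr
    _ ≤ κ ^ 2 * (((N * X).trace / d i) * (κ * ‖X‖)) := by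
        have h1 : X' i i ≤ (N * X).trace / d i := by rw [le_div_iff₀ hi, mul_comm]; exact htr
        have h2 := hX'ii.trans h1
        gcongr
    _ = _ := by ring

/-- **Sturm's error bound** for the intersection of the cone of positive semidefinite matrices with
an affine subspace. -/
theorem psd_errorBound {E : Type*} [NormedAddCommGroup E] [NormedSpace ℝ E] (k : ℕ) :
    ∀ (A : Matrix (Fin k) (Fin k) ℝ →ₗ[ℝ] E) (b : E) (S₀ : Matrix (Fin k) (Fin k) ℝ),
      S₀.PosSemidef → A S₀ = b → ∀ M : ℝ, 0 ≤ M → ∃ N : ℕ, 1 ≤ N ∧ ∃ C : ℝ, 0 ≤ C ∧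
        ∀ X : Matrix (Fin k) (Fin k) ℝ, X.PosSemidef → ‖X‖ ≤ M →
          ∃ Y, Y.PosSemidef ∧ A Y = b ∧ ‖X - Y‖ ^ N ≤ C * ‖A X - b‖ := by
  induction k with
  | zero =>
    intro A b S₀ hS₀ hA M _
    refine ⟨1, le_rfl, 0, le_rfl, fun X _ _ => ⟨S₀, hS₀, hA, ?_⟩⟩
    rw [Subsingleton.elim X S₀]
    simp
  | succ k ih =>
    intro A b S₀ hS₀ hA M hM
    -- Either there is a Slater point, or the problem reduces to a cone of size `k`.
    by_cases hno : ∀ Y, Yᵀ = Y → A Y = b → Y ∉ strictlyPositive (k + 1)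
    swap
    · push Not at hno
      obtain ⟨S₁, h1, h2, h3⟩ := hno
      obtain ⟨C, hC, h⟩ := errorBound_of_strictlyPositive A h1 h2 h3 hM
      exact ⟨1, le_rfl, C, hC, by simpa using h⟩
    obtain ⟨N, hN, hN0, hNV⟩ := exists_posSemidef_orthogonal A hS₀ hA hno
    obtain ⟨Q, K, hK, hface⟩ := exists_face hN hN0
    obtain ⟨C₁, hC₁, hsol⟩ := exists_symm_solution A hS₀.transpose_eq hA
    obtain ⟨α, hα0, hα⟩ := exists_norm_map_le A
    let J : Matrix (Fin k) (Fin k) ℝ →ₗ[ℝ] Matrix (Fin (k + 1)) (Fin (k + 1)) ℝ :=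
      { toFun := fun Z => Q * Z * Qᵀ
        map_add' := fun Z Z' => by rw [Matrix.mul_add, Matrix.add_mul]
        map_smul' := fun s Z => by simp }
    have hJ : ∀ Z, J Z = Q * Z * Qᵀ := fun Z => rfl
    have hcompress : ∀ X : Matrix (Fin (k + 1)) (Fin (k + 1)) ℝ, X.PosSemidef →
        (Qᵀ * X * Q).PosSemidef := fun X hX => by
      have := hX.conjTranspose_mul_mul_same Q
      rwa [Matrix.conjTranspose_eq_transpose_of_trivial] at this
    -- Tr(N S₀) = 0 puts `S₀` exactly on the face, so the compressed problem is still feasible.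
    have hS₀J : J (Qᵀ * S₀ * Q) = S₀ := by
      have h := hface S₀ hS₀
      rw [hNV S₀ hS₀.transpose_eq hA, mul_zero] at h
      have h' : ‖S₀ - Q * (Qᵀ * S₀ * Q) * Qᵀ‖ = 0 := by
        nlinarith [norm_nonneg (S₀ - Q * (Qᵀ * S₀ * Q) * Qᵀ)]
      exact (sub_eq_zero.1 (norm_eq_zero.1 h')).symm
    set κ := (Fintype.card (Fin (k + 1)) : ℝ) ^ 2 * ‖Qᵀ‖ ^ 2 with hκ
    obtain ⟨N', hN', C, hC, hih⟩ := ih (A ∘ₗ J) b (Qᵀ * S₀ * Q) (hcompress _ hS₀)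
      (by rw [LinearMap.comp_apply, hS₀J, hA]) (κ * M) (by positivity)
    set γ := (Fintype.card (Fin k) : ℝ) ^ 2 * ‖Q‖ ^ 2 with hγ
    set ν := Fintype.card (Fin (k + 1)) * (Fintype.card (Fin (k + 1)) * ‖N‖ * C₁) with hν
    set C₂ := K * M * ν with hC₂
    set R := α * M + ‖b‖ with hR
    refine ⟨2 * N', by omega, 2 ^ (2 * N' - 1) * (C₂ ^ N' * R ^ (N' - 1) +
      γ ^ (2 * N') * (2 * C ^ 2 * (R + α ^ 2 * C₂))), by positivity, fun X hX hXM => ?_⟩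
    set X' := J (Qᵀ * X * Q) with hX'
    set r := ‖A X - b‖ with hr
    have hr0 : 0 ≤ r := norm_nonneg _
    have hrR : r ≤ R := by
      refine (norm_sub_le _ _).trans ?_
      have := hα X
      have : α * ‖X‖ ≤ α * M := by gcongr
      linarith
    -- `N` is orthogonal to a symmetric solution at distance O(r) from `X`, so only that distance
    -- enters.
    have htr : (N * X).trace ≤ ν * r := by
      obtain ⟨Y, hYs, hY, hXY⟩ := hsol X hX.transpose_eq
      have h1 : (N * X).trace = (N * (X - Y)).trace := by
        rw [Matrix.mul_sub, Matrix.trace_sub, hNV Y hYs hY, sub_zero]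
      rw [h1]
      calc (N * (X - Y)).trace ≤ Fintype.card (Fin (k + 1)) * ‖N * (X - Y)‖ :=
            (le_abs_self _).trans (abs_trace_le _)
        _ ≤ Fintype.card (Fin (k + 1)) *
            (Fintype.card (Fin (k + 1)) * ‖N‖ * (C₁ * r)) := by
            gcongr
            exact (norm_mul_le_card _ _).trans (by gcongr)
        _ = ν * r := by rw [hν]; ring
    have h1 : ‖X - X'‖ ^ 2 ≤ C₂ * r := by
      calc ‖X - X'‖ ^ 2 ≤ K * ‖X‖ * (N * X).trace := hface X hX
        _ ≤ K * ‖X‖ * (ν * r) := by gcongr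
        _ ≤ K * M * (ν * r) := by gcongr
        _ = C₂ * r := by rw [hC₂]; ring
    obtain ⟨Y, hYp, hY, hXY⟩ := hih (Qᵀ * X * Q) (hcompress X hX) (by
      have := norm_conj_le Qᵀ X
      rw [Matrix.transpose_transpose] at this
      exact this.trans (by gcongr))
    -- The residual of the compressed matrix exceeds `r` by at most the image under `A` of the
    -- displacement to the face.
    have h2 : ‖Qᵀ * X * Q - Y‖ ^ N' ≤ C * (r + α * ‖X - X'‖) := by
      refine hXY.trans (mul_le_mul_of_nonneg_left ?_ hC)
      have h3 : (A ∘ₗ J) (Qᵀ * X * Q) - b = (A X - b) - A (X - X') := by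
        rw [LinearMap.comp_apply, map_sub, hX']; abel
      rw [h3]
      exact (norm_sub_le _ _).trans (add_le_add le_rfl (hα _))
    refine ⟨J Y, ?_, hY, ?_⟩
    · have := hYp.mul_mul_conjTranspose_same Q
      rwa [Matrix.conjTranspose_eq_transpose_of_trivial] at this
    · have h3 : ‖X - J Y‖ ≤ ‖X - X'‖ + γ * ‖Qᵀ * X * Q - Y‖ := by
        have h4 : X - J Y = (X - X') + J (Qᵀ * X * Q - Y) := by rw [map_sub, hX']; abel
        rw [h4]
        have h5 : ‖J (Qᵀ * X * Q - Y)‖ ≤ γ * ‖Qᵀ * X * Q - Y‖ := norm_conj_le Q _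
        exact (norm_add_le _ _).trans (by linarith)
      calc ‖X - J Y‖ ^ (2 * N') ≤ (‖X - X'‖ + γ * ‖Qᵀ * X * Q - Y‖) ^ (2 * N') := by gcongr
        _ ≤ _ := pow_two_mul_le hN' (norm_nonneg _) (norm_nonneg _) hr0 hrR (by positivity)
            (by positivity) h1 h2

end ErrorBound

/-! ### Tangents, convexity and first order conditions. -/

section Objective

variable {n p q r : ℕ}

theorem posDef_of_mem_constraint {σ : ℝ} (hσ : 0 < σ) {S : Matrix (Fin n) (Fin n) ℝ}
    (hS : S ∈ constraint n σ) : S.PosDef := by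
  have h := (Matrix.PosDef.one (n := Fin n) (R := ℝ)).smul hσ
  have := h.posSemidef_add hS
  simpa using this

theorem transpose_eq_of_mem_constraint {σ : ℝ} {S : Matrix (Fin n) (Fin n) ℝ}
    (hS : S ∈ constraint n σ) : Sᵀ = S := by
  have := Matrix.PosSemidef.transpose_eq hS
  simpa using this

theorem isUnit_det_of_mem_constraint {σ : ℝ} (hσ : 0 < σ) {S : Matrix (Fin n) (Fin n) ℝ}
    (hS : S ∈ constraint n σ) : IsUnit S.det :=
  (Matrix.isUnit_iff_isUnit_det S).1 (posDef_of_mem_constraint hσ hS).isUnit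

theorem convex_constraint (n : ℕ) (σ : ℝ) : Convex ℝ (constraint n σ) := by
  intro S hS S' hS' a b ha hb hab
  have h := (Matrix.PosSemidef.smul hS ha).add (Matrix.PosSemidef.smul hS' hb)
  have h2 : a • S + b • S' - σ • (1 : Matrix (Fin n) (Fin n) ℝ) =
      a • (S - σ • (1 : Matrix (Fin n) (Fin n) ℝ)) + b • (S' - σ • 1) := by
    obtain rfl : b = 1 - a := by linarith
    module
  show Matrix.PosSemidef _
  rwa [h2]

theorem convex_feasible (n p q : ℕ) (σ : ℝ) : Convex ℝ (feasible n p q σ) :=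
  fun _ hz _ hz' _ _ ha hb hab => convex_constraint n σ hz hz' ha hb hab

/-- Completing the square in `Tr (Rᵀ S⁻¹ R)`. -/
theorem trace_inv_eq_complete_square {κ : Type*} [Fintype κ] {S : Matrix (Fin n) (Fin n) ℝ}
    (hS : Sᵀ = S) (hu : IsUnit S.det) (R W : Matrix (Fin n) κ ℝ) :
    (Rᵀ * S⁻¹ * R).trace = ((R - S * W)ᵀ * S⁻¹ * (R - S * W)).trace +
      2 * (Wᵀ * R).trace - (Wᵀ * S * W).trace := by
  have h1 : (R - S * W)ᵀ * S⁻¹ * (R - S * W) =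
      Rᵀ * S⁻¹ * R - Rᵀ * W - Wᵀ * R + Wᵀ * S * W := by
    rw [Matrix.transpose_sub, Matrix.transpose_mul, hS, Matrix.sub_mul, Matrix.mul_sub,
      Matrix.sub_mul, Matrix.sub_mul, Matrix.mul_assoc Wᵀ S, Matrix.mul_nonsing_inv _ hu,
      Matrix.mul_one, Matrix.mul_assoc Rᵀ S⁻¹ (S * W), Matrix.nonsing_inv_mul_cancel_left _ _ hu,
      Matrix.mul_assoc Wᵀ S W]
    abel
  have h2 : (Rᵀ * W).trace = (Wᵀ * R).trace := by
    rw [← Matrix.trace_transpose, Matrix.transpose_mul, Matrix.transpose_transpose]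
  rw [h1, Matrix.trace_add, Matrix.trace_sub, Matrix.trace_sub, h2]
  ring

theorem trace_conj_inv_nonneg {κ : Type*} [Fintype κ] {σ : ℝ} (hσ : 0 < σ)
    {S : Matrix (Fin n) (Fin n) ℝ} (hS : S ∈ constraint n σ) (A : Matrix (Fin n) κ ℝ) :
    0 ≤ (Aᵀ * S⁻¹ * A).trace := by
  have := ((posDef_of_mem_constraint hσ hS).inv.posSemidef.conjTranspose_mul_mul_same A).trace_nonneg
  rwa [Matrix.conjTranspose_eq_transpose_of_trivial] at this

/-- Side by side repetition of a matrix. -/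
def stack (r : ℕ) (A : Matrix (Fin n) (Fin q) ℝ) : Matrix (Fin n) (Fin r × Fin q) ℝ :=
  Matrix.of fun i l => A i l.2

/-- All residuals `Y⁽ˡ⁾ - X B`, side by side. -/
def resid (X : Matrix (Fin n) (Fin p) ℝ) (Y : Fin r → Matrix (Fin n) (Fin q) ℝ)
    (B : Matrix (Fin p) (Fin q) ℝ) : Matrix (Fin n) (Fin r × Fin q) ℝ :=
  Matrix.of fun i l => Y l.1 i l.2 - (X * B) i l.2

theorem resid_sub (X : Matrix (Fin n) (Fin p) ℝ) (Y : Fin r → Matrix (Fin n) (Fin q) ℝ)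
    (B B' : Matrix (Fin p) (Fin q) ℝ) :
    resid X Y B' - resid X Y B = -stack r (X * (B' - B)) := by
  ext i l
  simp [resid, stack, Matrix.mul_sub]

/-- The normalizing constant of the data term. -/
def quadWeight (n q r : ℕ) : ℝ := 1 / (2 * (n : ℝ) * q * r)

/-- The normalizing constant of the trace term. -/
def traceWeight (n : ℕ) : ℝ := 1 / (2 * (n : ℝ))

theorem quadWeight_nonneg (n q r : ℕ) : 0 ≤ quadWeight n q r := by
  unfold quadWeight; positivity

theorem quadWeight_pos {n q r : ℕ} (hn : 0 < n) (hq : 0 < q) (hr : 0 < r) :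
    0 < quadWeight n q r := by
  unfold quadWeight; positivity

theorem traceWeight_pos {n : ℕ} (hn : 0 < n) : 0 < traceWeight n := by
  unfold traceWeight; positivity

/-- With all residuals in one matrix, the sum over repetitions becomes a single trace, so the square
is completed only once. -/
theorem dataFit_eq (X : Matrix (Fin n) (Fin p) ℝ) (Y : Fin r → Matrix (Fin n) (Fin q) ℝ)
    (B : Matrix (Fin p) (Fin q) ℝ) (S : Matrix (Fin n) (Fin n) ℝ) :
    dataFit X Y B S = quadWeight n q r * ((resid X Y B)ᵀ * S⁻¹ * resid X Y B).trace +
      traceWeight n * S.trace := by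
  have : ((resid X Y B)ᵀ * S⁻¹ * resid X Y B).trace =
      ∑ l, mahalanobisSq S⁻¹ (Y l - X * B) := by
    simp only [Matrix.trace, Matrix.diag, mahalanobisSq, Fintype.sum_prod_type]
    refine Finset.sum_congr rfl fun l _ => Finset.sum_congr rfl fun k _ => ?_
    simp only [Matrix.mul_apply, resid, Matrix.transpose_apply, Matrix.of_apply, Matrix.sub_apply]
  rw [this, dataFit, quadWeight, traceWeight, Finset.mul_sum]
  congr 1
  · exact Finset.sum_congr rfl fun l _ => by ring
  · ring

/-- The dual variable `S⁻¹ (Y - X B)`. -/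
def dualVar (X : Matrix (Fin n) (Fin p) ℝ) (Y : Fin r → Matrix (Fin n) (Fin q) ℝ)
    (B : Matrix (Fin p) (Fin q) ℝ) (S : Matrix (Fin n) (Fin n) ℝ) :
    Matrix (Fin n) (Fin r × Fin q) ℝ := S⁻¹ * resid X Y B

/-- The directional derivative of the data term in direction `(DB, DS)`, in terms of the dual
variable `W`. -/
def slope (X : Matrix (Fin n) (Fin p) ℝ) (W : Matrix (Fin n) (Fin r × Fin q) ℝ)
    (DB : Matrix (Fin p) (Fin q) ℝ) (DS : Matrix (Fin n) (Fin n) ℝ) : ℝ :=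
  -(2 * quadWeight n q r * (Wᵀ * stack r (X * DB)).trace) -
    quadWeight n q r * (Wᵀ * DS * W).trace + traceWeight n * DS.trace

theorem stack_smul (s : ℝ) (A : Matrix (Fin n) (Fin q) ℝ) : stack r (s • A) = s • stack r A := rfl

theorem stack_add (A A' : Matrix (Fin n) (Fin q) ℝ) :
    stack r (A + A') = stack r A + stack r A' := rfl

theorem stack_zero : stack r (0 : Matrix (Fin n) (Fin q) ℝ) = 0 := rfl

theorem slope_smul (X : Matrix (Fin n) (Fin p) ℝ) (W : Matrix (Fin n) (Fin r × Fin q) ℝ) (s : ℝ)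
    (DB : Matrix (Fin p) (Fin q) ℝ) (DS : Matrix (Fin n) (Fin n) ℝ) :
    slope X W (s • DB) (s • DS) = s * slope X W DB DS := by
  simp only [slope, Matrix.mul_smul, Matrix.smul_mul, stack_smul, Matrix.trace_smul, smul_eq_mul]
  ring

theorem slope_add (X : Matrix (Fin n) (Fin p) ℝ) (W : Matrix (Fin n) (Fin r × Fin q) ℝ)
    (DB DB' : Matrix (Fin p) (Fin q) ℝ) (DS DS' : Matrix (Fin n) (Fin n) ℝ) :
    slope X W (DB + DB') (DS + DS') = slope X W DB DS + slope X W DB' DS' := by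
  simp only [slope, Matrix.mul_add, Matrix.add_mul, stack_add, Matrix.trace_add]
  ring

/-- Exact second order expansion of the data term. -/
theorem dataFit_eq_add_slope {σ : ℝ} (hσ : 0 < σ) (X : Matrix (Fin n) (Fin p) ℝ)
    (Y : Fin r → Matrix (Fin n) (Fin q) ℝ) {B B' : Matrix (Fin p) (Fin q) ℝ}
    {S S' : Matrix (Fin n) (Fin n) ℝ} (hS : S ∈ constraint n σ) (hS' : S' ∈ constraint n σ) :
    dataFit X Y B' S' = dataFit X Y B S + slope X (dualVar X Y B S) (B' - B) (S' - S) +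
      quadWeight n q r * ((resid X Y B' - S' * dualVar X Y B S)ᵀ * S'⁻¹ *
        (resid X Y B' - S' * dualVar X Y B S)).trace := by
  have hu := isUnit_det_of_mem_constraint hσ hS
  have hR : resid X Y B' = resid X Y B - stack r (X * (B' - B)) := by
    rw [sub_eq_iff_eq_add'.1 (resid_sub X Y B B')]
    exact (sub_eq_add_neg _ _).symm
  have hSW : S * dualVar X Y B S = resid X Y B := Matrix.mul_nonsing_inv_cancel_left _ _ hu
  have h1 := trace_inv_eq_complete_square (transpose_eq_of_mem_constraint hS) hu
    (resid X Y B) (dualVar X Y B S)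
  rw [hSW, sub_self] at h1
  rw [dataFit_eq X Y B' S', dataFit_eq X Y B S, slope,
    trace_inv_eq_complete_square (transpose_eq_of_mem_constraint hS')
      (isUnit_det_of_mem_constraint hσ hS') (resid X Y B') (dualVar X Y B S), h1]
  have e1 : ((dualVar X Y B S)ᵀ * resid X Y B').trace = ((dualVar X Y B S)ᵀ * resid X Y B).trace -
      ((dualVar X Y B S)ᵀ * stack r (X * (B' - B))).trace := by
    rw [hR, Matrix.mul_sub, Matrix.trace_sub]
  rw [e1, Matrix.mul_sub (dualVar X Y B S)ᵀ S' S, Matrix.sub_mul, Matrix.trace_sub,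
    Matrix.trace_sub, Matrix.mul_zero, Matrix.trace_zero]
  ring

theorem dataFit_add_slope_le {σ : ℝ} (hσ : 0 < σ) (X : Matrix (Fin n) (Fin p) ℝ)
    (Y : Fin r → Matrix (Fin n) (Fin q) ℝ) {B B' : Matrix (Fin p) (Fin q) ℝ}
    {S S' : Matrix (Fin n) (Fin n) ℝ} (hS : S ∈ constraint n σ) (hS' : S' ∈ constraint n σ) :
    dataFit X Y B S + slope X (dualVar X Y B S) (B' - B) (S' - S) ≤ dataFit X Y B' S' := by
  rw [dataFit_eq_add_slope hσ X Y hS hS']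
  have := mul_nonneg (quadWeight_nonneg n q r)
    (trace_conj_inv_nonneg hσ hS' (resid X Y B' - S' * dualVar X Y B S))
  linear_combination this

/-- The tangent at the convex combination minorizes the function at both end points, and the two
slopes cancel on averaging. -/
theorem convexOn_dataFit {σ : ℝ} (hσ : 0 < σ) (X : Matrix (Fin n) (Fin p) ℝ)
    (Y : Fin r → Matrix (Fin n) (Fin q) ℝ) :
    ConvexOn ℝ (feasible n p q σ) fun z => dataFit X Y z.1 z.2 := by
  refine ⟨convex_feasible n p q σ, fun z hz z' hz' a b ha hb hab => ?_⟩
  have hw := convex_feasible n p q σ hz hz' ha hb hab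
  set w := a • z + b • z' with hw'
  have h1 := dataFit_add_slope_le hσ X Y (B := w.1) (B' := z.1) hw hz
  have h2 := dataFit_add_slope_le hσ X Y (B := w.1) (B' := z'.1) hw hz'
  have h3 : a * slope X (dualVar X Y w.1 w.2) (z.1 - w.1) (z.2 - w.2) +
      b * slope X (dualVar X Y w.1 w.2) (z'.1 - w.1) (z'.2 - w.2) = 0 := by
    rw [← slope_smul, ← slope_smul, ← slope_add]
    obtain rfl : b = 1 - a := by linarith
    have e1 : a • (z.1 - w.1) + (1 - a) • (z'.1 - w.1) = 0 := by
      simp only [hw', Prod.fst_add, Prod.smul_fst]; module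
    have e2 : a • (z.2 - w.2) + (1 - a) • (z'.2 - w.2) = 0 := by
      simp only [hw', Prod.snd_add, Prod.smul_snd]; module
    rw [e1, e2]
    simp [slope, stack_zero]
  simp only [smul_eq_mul]
  have h4 : dataFit X Y w.1 w.2 = a * dataFit X Y w.1 w.2 + b * dataFit X Y w.1 w.2 := by
    rw [← add_mul, hab, one_mul]
  linear_combination mul_le_mul_of_nonneg_left h1 ha + mul_le_mul_of_nonneg_left h2 hb + h4 - h3

theorem convexOn_norm_toLp (q : ℕ) :
    ConvexOn ℝ Set.univ fun v : Fin q → ℝ => ‖WithLp.toLp 2 v‖ :=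
  (convexOn_norm (E := EuclideanSpace ℝ (Fin q)) convex_univ).comp_linearMap
    (WithLp.linearEquiv 2 ℝ (Fin q → ℝ)).symm.toLinearMap

theorem convexOn_norm21 (p q : ℕ) :
    ConvexOn ℝ Set.univ fun B : Matrix (Fin p) (Fin q) ℝ => norm21 B := by
  refine ⟨convex_univ, fun B _ B' _ a b ha hb hab => ?_⟩
  simp only [norm21, smul_eq_mul, Finset.mul_sum, ← Finset.sum_add_distrib]
  exact Finset.sum_le_sum fun j _ =>
    (convexOn_norm_toLp q).2 (Set.mem_univ (B j)) (Set.mem_univ (B' j)) ha hb hab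

theorem convexOn_objective {σ lam : ℝ} (hσ : 0 < σ) (hlam : 0 ≤ lam)
    (X : Matrix (Fin n) (Fin p) ℝ) (Y : Fin r → Matrix (Fin n) (Fin q) ℝ) :
    ConvexOn ℝ (feasible n p q σ) fun z => objective X Y lam z.1 z.2 := by
  refine ConvexOn.add (convexOn_dataFit hσ X Y) (ConvexOn.smul hlam ?_)
  have := (convexOn_norm21 p q).comp_linearMap
    (LinearMap.fst ℝ (Matrix (Fin p) (Fin q) ℝ) (Matrix (Fin n) (Fin n) ℝ))
  exact this.subset (Set.subset_univ _) (convex_feasible n p q σ)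

theorem continuousAt_matrix_inv {S : Matrix (Fin n) (Fin n) ℝ} (hS : S.det ≠ 0) :
    ContinuousAt (fun T : Matrix (Fin n) (Fin n) ℝ => T⁻¹) S := by
  simp only [Matrix.inv_def, Ring.inverse_eq_inv']
  exact ((continuous_id.matrix_det).continuousAt.inv₀ hS).smul
    (continuous_id.matrix_adjugate).continuousAt

theorem continuous_resid (X : Matrix (Fin n) (Fin p) ℝ) (Y : Fin r → Matrix (Fin n) (Fin q) ℝ) :
    Continuous (resid X Y) := by
  refine continuous_matrix fun i l => ?_
  have : Continuous fun B : Matrix (Fin p) (Fin q) ℝ => X * B :=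
    continuous_const.matrix_mul continuous_id
  exact continuous_const.sub (this.matrix_elem i l.2)

theorem continuousAt_dualVar (X : Matrix (Fin n) (Fin p) ℝ) (Y : Fin r → Matrix (Fin n) (Fin q) ℝ)
    {z : Matrix (Fin p) (Fin q) ℝ × Matrix (Fin n) (Fin n) ℝ} (hz : z.2.det ≠ 0) :
    ContinuousAt (fun w : Matrix (Fin p) (Fin q) ℝ × Matrix (Fin n) (Fin n) ℝ =>
      dualVar X Y w.1 w.2) z := by
  have h1 : ContinuousAt
      (fun w : Matrix (Fin p) (Fin q) ℝ × Matrix (Fin n) (Fin n) ℝ => w.2⁻¹) z :=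
    (continuousAt_matrix_inv hz).comp continuousAt_snd
  have h2 : ContinuousAt
      (fun w : Matrix (Fin p) (Fin q) ℝ × Matrix (Fin n) (Fin n) ℝ => resid X Y w.1) z :=
    ((continuous_resid X Y).comp continuous_fst).continuousAt
  have h3 : Continuous fun w : Matrix (Fin n) (Fin n) ℝ × Matrix (Fin n) (Fin r × Fin q) ℝ =>
      w.1 * w.2 := continuous_fst.matrix_mul continuous_snd
  exact h3.continuousAt.comp (h1.prodMk h2)

theorem continuousAt_objective (X : Matrix (Fin n) (Fin p) ℝ)
    (Y : Fin r → Matrix (Fin n) (Fin q) ℝ) (lam : ℝ)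
    {z : Matrix (Fin p) (Fin q) ℝ × Matrix (Fin n) (Fin n) ℝ} (hz : z.2.det ≠ 0) :
    ContinuousAt (fun w : Matrix (Fin p) (Fin q) ℝ × Matrix (Fin n) (Fin n) ℝ =>
      objective X Y lam w.1 w.2) z := by
  have h1 := continuousAt_dualVar X Y hz
  have h2 : ContinuousAt
      (fun w : Matrix (Fin p) (Fin q) ℝ × Matrix (Fin n) (Fin n) ℝ => resid X Y w.1) z :=
    ((continuous_resid X Y).comp continuous_fst).continuousAt
  have h3 : Continuous fun w : Matrix (Fin n) (Fin r × Fin q) ℝ × Matrix (Fin n) (Fin r × Fin q) ℝ =>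
      (w.1ᵀ * w.2).trace := (continuous_fst.matrix_transpose.matrix_mul continuous_snd).matrix_trace
  have h4 := h3.continuousAt.comp (h2.prodMk h1)
  have h5 : Continuous fun w : Matrix (Fin p) (Fin q) ℝ × Matrix (Fin n) (Fin n) ℝ =>
      traceWeight n * w.2.trace + lam * norm21 w.1 := by
    refine (continuous_const.mul continuous_snd.matrix_trace).add (continuous_const.mul ?_)
    refine continuous_finsetSum _ fun j _ => ?_
    exact ((PiLp.continuous_toLp 2 _).comp ((continuous_apply j).comp continuous_fst)).norm
  have h6 := (continuousAt_const (y := quadWeight n q r)).mul h4 |>.add h5.continuousAt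
  refine h6.congr (Eventually.of_forall fun w => ?_)
  simp only [objective, dataFit_eq, dualVar, Function.comp, Matrix.mul_assoc, Pi.add_apply,
    Pi.mul_apply]
  ring

/-- First order optimality condition. -/
theorem slope_nonneg_of_isMin {σ lam : ℝ} (hσ : 0 < σ) (hlam : 0 ≤ lam)
    (X : Matrix (Fin n) (Fin p) ℝ) (Y : Fin r → Matrix (Fin n) (Fin q) ℝ)
    {B B' : Matrix (Fin p) (Fin q) ℝ} {S S' : Matrix (Fin n) (Fin n) ℝ}
    (hS : S ∈ constraint n σ) (hS' : S' ∈ constraint n σ)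
    (hmin : ∀ s : ℝ, 0 < s → s ≤ 1 →
      objective X Y lam B S ≤ objective X Y lam (B + s • (B' - B)) (S + s • (S' - S))) :
    0 ≤ slope X (dualVar X Y B S) (B' - B) (S' - S) + lam * (norm21 B' - norm21 B) := by
  set w : ℝ → Matrix (Fin p) (Fin q) ℝ × Matrix (Fin n) (Fin n) ℝ :=
    fun s => (B + s • (B' - B), S + s • (S' - S)) with hw
  have hwc : Continuous w := by fun_prop
  have hw0 : w 0 = (B, S) := by simp [hw]
  have hdet : (w 0).2.det ≠ 0 := by rw [hw0]; exact (isUnit_det_of_mem_constraint hσ hS).ne_zero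
  have hsl : Continuous fun W : Matrix (Fin n) (Fin r × Fin q) ℝ =>
      slope X W (B' - B) (S' - S) := by
    unfold slope
    have hid : Continuous fun W : Matrix (Fin n) (Fin r × Fin q) ℝ => W := continuous_id
    refine (Continuous.sub (continuous_const.mul
      (hid.matrix_transpose.matrix_mul continuous_const).matrix_trace).neg
      (continuous_const.mul
        ((hid.matrix_transpose.matrix_mul continuous_const).matrix_mul hid).matrix_trace)).add
      continuous_const
  have hlim : Tendsto (fun s => slope X (dualVar X Y (w s).1 (w s).2) (B' - B) (S' - S) +
      lam * (norm21 B' - norm21 B)) (𝓝[>] 0)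
      (𝓝 (slope X (dualVar X Y B S) (B' - B) (S' - S) + lam * (norm21 B' - norm21 B))) := by
    have h1 := (continuousAt_dualVar X Y hdet).comp (f := w) hwc.continuousAt
    have h2 := (hsl.continuousAt.comp h1).tendsto
    simp only [Function.comp, hw0] at h2
    exact (h2.mono_left nhdsWithin_le_nhds).add tendsto_const_nhds
  refine ge_of_tendsto hlim ?_
  have hev : ∀ᶠ s : ℝ in 𝓝[>] 0, s ∈ Set.Ioc (0 : ℝ) 1 := Ioc_mem_nhdsGT one_pos
  filter_upwards [hev] with s hs
  have hmem : (w s).2 ∈ constraint n σ := by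
    have := convex_constraint n σ hS hS' (sub_nonneg.2 hs.2) hs.1.le (by ring)
    have e : (w s).2 = (1 - s) • S + s • S' := by simp only [hw]; module
    rwa [e]
  have h1 := dataFit_add_slope_le hσ X Y (B := (w s).1) (B' := B) hmem hS
  have e1 : B - (w s).1 = (-s) • (B' - B) := by simp only [hw]; module
  have e2 : S - (w s).2 = (-s) • (S' - S) := by simp only [hw]; module
  rw [e1, e2, slope_smul] at h1
  have h2 : norm21 (w s).1 ≤ (1 - s) * norm21 B + s * norm21 B' := by
    have := (convexOn_norm21 p q).2 (Set.mem_univ B) (Set.mem_univ B') (sub_nonneg.2 hs.2) hs.1.le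
      (by ring)
    have e : (w s).1 = (1 - s) • B + s • B' := by simp only [hw]; module
    rw [e]; simpa using this
  have h3 := hmin s hs.1 hs.2
  simp only [objective] at h3
  have h4 := mul_le_mul_of_nonneg_left h2 hlam
  have h5 : 0 ≤ s * (slope X (dualVar X Y (w s).1 (w s).2) (B' - B) (S' - S) +
      lam * (norm21 B' - norm21 B)) := by
    linear_combination h1 + h3 + h4
  exact nonneg_of_mul_nonneg_right h5 hs.1

end Objective

/-! ### Smoothness of the data term in its entries. -/

section Smoothness

variable {n p q r : ℕ}

theorem contDiff_toPair_fst (j : Fin p) (k : Fin q) :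
    ContDiff ℝ ∞ fun x : PairSpace n p q => (toPair x).1 j k := by
  simp only [toPair, Matrix.of_apply]
  fun_prop

theorem contDiff_toPair_snd (i k : Fin n) :
    ContDiff ℝ ∞ fun x : PairSpace n p q => (toPair x).2 i k := by
  simp only [toPair, Matrix.of_apply]
  fun_prop

theorem contDiff_det {E : Type*} [NormedAddCommGroup E] [NormedSpace ℝ E] {m : Type*} [Fintype m]
    [DecidableEq m] {f : E → Matrix m m ℝ} (hf : ∀ i j, ContDiff ℝ ∞ fun x => f x i j) :
    ContDiff ℝ ∞ fun x => (f x).det := by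
  simp only [Matrix.det_apply']
  exact ContDiff.sum fun s _ => contDiff_const.mul (contDiff_prod fun i _ => hf _ _)

/-- Cramer's rule: every entry of the inverse is a quotient of polynomials in the entries. -/
theorem contDiffAt_inv_apply {E : Type*} [NormedAddCommGroup E] [NormedSpace ℝ E] {m : Type*}
    [Fintype m] [DecidableEq m] {f : E → Matrix m m ℝ} (hf : ∀ i j, ContDiff ℝ ∞ fun x => f x i j)
    {x : E} (hx : (f x).det ≠ 0) (i j : m) : ContDiffAt ℝ ∞ (fun x => (f x)⁻¹ i j) x := by
  have h : ∀ x, (f x)⁻¹ i j = (f x).det⁻¹ * (f x).adjugate i j := fun x => by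
    rw [Matrix.inv_def, Ring.inverse_eq_inv']; rfl
  simp only [h]
  refine ((contDiff_det hf).contDiffAt.inv hx).mul (ContDiff.contDiffAt ?_)
  simp only [Matrix.adjugate_apply]
  refine contDiff_det fun a b => ?_
  simp only [Matrix.updateRow_apply]
  split_ifs
  · exact contDiff_const
  · exact hf a b

theorem contDiffAt_dataFitPair (X : Matrix (Fin n) (Fin p) ℝ)
    (Y : Fin r → Matrix (Fin n) (Fin q) ℝ) {x : PairSpace n p q} (hx : (toPair x).2.det ≠ 0) :
    ContDiffAt ℝ ∞ (dataFitPair X Y) x := by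
  have hinv := contDiffAt_inv_apply (f := fun x : PairSpace n p q => (toPair x).2)
    contDiff_toPair_snd hx
  have hres : ∀ l i k, ContDiffAt ℝ ∞
      (fun x : PairSpace n p q => (Y l - X * (toPair x).1) i k) x := fun l i k => by
    simp only [Matrix.sub_apply, Matrix.mul_apply]
    exact contDiffAt_const.sub (ContDiffAt.sum fun j _ =>
      contDiffAt_const.mul (contDiff_toPair_fst j k).contDiffAt)
  have htr : ContDiffAt ℝ ∞ (fun x : PairSpace n p q => (toPair x).2.trace) x := by
    simp only [Matrix.trace, Matrix.diag]
    exact ContDiffAt.sum fun i _ => (contDiff_toPair_snd i i).contDiffAt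
  have hquad : ∀ l, ContDiffAt ℝ ∞ (fun x : PairSpace n p q =>
      mahalanobisSq (toPair x).2⁻¹ (Y l - X * (toPair x).1)) x := fun l => by
    simp only [mahalanobisSq, Matrix.trace, Matrix.diag, Matrix.mul_apply (M := _ * _),
      Matrix.mul_apply (M := (_)ᵀ), Matrix.transpose_apply]
    exact ContDiffAt.sum fun k _ => ContDiffAt.sum fun i _ => (ContDiffAt.sum fun i' _ =>
      (hres l i' k).mul (hinv i' i)).mul (hres l i k)
  unfold dataFitPair dataFit
  exact (ContDiffAt.sum fun l _ => (hquad l).div_const _).add (htr.div_const _)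

theorem continuous_toPair : Continuous (toPair : PairSpace n p q → _) :=
  (continuous_matrix fun j k => (contDiff_toPair_fst j k).continuous).prodMk
    (continuous_matrix fun i k => (contDiff_toPair_snd i k).continuous)

theorem isClosed_constraint (n : ℕ) (σ : ℝ) : IsClosed (constraint n σ) := by
  have h : constraint n σ = {S | (S - σ • (1 : Matrix (Fin n) (Fin n) ℝ))ᵀ = S - σ • 1} ∩
      ⋂ v : Fin n → ℝ, {S | 0 ≤ v ⬝ᵥ ((S - σ • (1 : Matrix (Fin n) (Fin n) ℝ)) *ᵥ v)} := by
    ext S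
    simp [constraint, posSemidef_real_iff]
  have hc : Continuous fun S : Matrix (Fin n) (Fin n) ℝ => S - σ • (1 : Matrix _ _ ℝ) :=
    continuous_id.sub continuous_const
  rw [h]
  refine (isClosed_eq hc.matrix_transpose hc).inter (isClosed_iInter fun v => ?_)
  exact isClosed_le continuous_const (continuous_const.dotProduct (hc.matrix_mulVec continuous_const))

/-- The constraint is closed, so the closure of `K` is a compact set of feasible points, and there
the C¹ gradient is locally Lipschitz. Compactness makes this global, without convexity of `K`. -/
theorem exists_lipschitzOnWith_gradient {σ : ℝ} (hσ : 0 < σ) (X : Matrix (Fin n) (Fin p) ℝ)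
    (Y : Fin r → Matrix (Fin n) (Fin q) ℝ) {K : Set (PairSpace n p q)}
    (hK : Bornology.IsBounded K) (hKF : ∀ x ∈ K, toPair x ∈ feasible n p q σ) :
    ∃ L : ℝ≥0, LipschitzOnWith L (gradient (dataFitPair X Y)) K := by
  have hclosed : IsClosed {x : PairSpace n p q | toPair x ∈ feasible n p q σ} :=
    (isClosed_constraint n σ).preimage (continuous_snd.comp continuous_toPair)
  have hcomp : IsCompact (closure K) :=
    Metric.isCompact_of_isClosed_isBounded isClosed_closure hK.closure
  have hsub : closure K ⊆ {x | toPair x ∈ feasible n p q σ} := closure_minimal hKF hclosed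
  have hloc : LocallyLipschitzOn (closure K) (gradient (dataFitPair X Y)) := by
    intro x hx
    have h1 : ContDiffAt ℝ ∞ (dataFitPair X Y) x :=
      contDiffAt_dataFitPair X Y (isUnit_det_of_mem_constraint hσ (hsub hx)).ne_zero
    have h2 : ContDiffAt ℝ 1 (fderiv ℝ (dataFitPair X Y)) x :=
      h1.fderiv_right (m := 1) (by norm_num; exact WithTop.coe_le_coe.2 le_top)
    have h3 : ContDiffAt ℝ 1 (gradient (dataFitPair X Y)) x :=
      (InnerProductSpace.toDual ℝ (PairSpace n p q)).symm.contDiff.contDiffAt.comp x h2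
    obtain ⟨L, t, ht, hL⟩ := h3.exists_lipschitzOnWith
    exact ⟨L, t, mem_nhdsWithin_of_mem_nhds ht, hL⟩
  obtain ⟨L, hL⟩ := hloc.exists_lipschitzOnWith_of_compact hcomp
  exact ⟨L, hL.mono subset_closure⟩

end Smoothness

/-! ### Coercivity, existence of minimizers and of the iterates. -/

section Existence

open scoped Matrix.Norms.Elementwise

variable {n p q r : ℕ}

theorem posSemidef_of_mem_constraint {σ : ℝ} (hσ : 0 < σ) {S : Matrix (Fin n) (Fin n) ℝ}
    (hS : S ∈ constraint n σ) : S.PosSemidef := (posDef_of_mem_constraint hσ hS).posSemidef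

/-- Off-diagonal entries are bounded through the 2×2 minors by diagonal ones, and these by the
trace. -/
theorem _root_.Matrix.PosSemidef.norm_le_trace {m : Type*} [Fintype m] {S : Matrix m m ℝ}
    (hS : S.PosSemidef) : ‖S‖ ≤ S.trace := by
  have hd : ∀ i, S i i ≤ S.trace := fun i =>
    Finset.single_le_sum (f := fun i => S i i) (fun j _ => hS.diag_nonneg) (Finset.mem_univ i)
  refine (Matrix.norm_le_iff hS.trace_nonneg).2 fun i j => ?_
  rw [Real.norm_eq_abs]
  refine abs_le_of_sq_le_sq ?_ hS.trace_nonneg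
  calc S i j ^ 2 ≤ S i i * S j j := hS.sq_apply_le i j
    _ ≤ S.trace * S.trace := by
      gcongr
      · exact hS.diag_nonneg
      · exact hS.trace_nonneg
      · exact hd i
      · exact hd j
    _ = _ := (sq _).symm

theorem norm_toLp_nonneg_le (v : Fin q → ℝ) (k : Fin q) : |v k| ≤ ‖WithLp.toLp 2 v‖ :=
  PiLp.norm_apply_le (WithLp.toLp 2 v) k

theorem norm_toLp_row_le_norm21 (B : Matrix (Fin p) (Fin q) ℝ) (j : Fin p) :
    ‖WithLp.toLp 2 (B j)‖ ≤ norm21 B :=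
  Finset.single_le_sum (f := fun j => ‖WithLp.toLp 2 (B j)‖) (fun _ _ => norm_nonneg _)
    (Finset.mem_univ j)

theorem norm21_nonneg (B : Matrix (Fin p) (Fin q) ℝ) : 0 ≤ norm21 B :=
  Finset.sum_nonneg fun _ _ => norm_nonneg _

theorem norm_le_norm21 (B : Matrix (Fin p) (Fin q) ℝ) : ‖B‖ ≤ norm21 B :=
  (Matrix.norm_le_iff (norm21_nonneg B)).2 fun j k =>
    (norm_toLp_nonneg_le (B j) k).trans (norm_toLp_row_le_norm21 B j)

theorem traceWeight_mul_trace_le_dataFit {σ : ℝ} (hσ : 0 < σ) (X : Matrix (Fin n) (Fin p) ℝ)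
    (Y : Fin r → Matrix (Fin n) (Fin q) ℝ) (B : Matrix (Fin p) (Fin q) ℝ)
    {S : Matrix (Fin n) (Fin n) ℝ} (hS : S ∈ constraint n σ) :
    traceWeight n * S.trace ≤ dataFit X Y B S := by
  rw [dataFit_eq]
  have := mul_nonneg (quadWeight_nonneg n q r) (trace_conj_inv_nonneg hσ hS (resid X Y B))
  linarith

/-- Coercivity: the quadratic term is nonnegative, so the penalty controls `B` and the trace
controls `S`, separately. -/
theorem norm_le_of_objective_le (hn : 0 < n) {σ lam : ℝ} (hσ : 0 < σ) (hlam : 0 < lam)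
    (X : Matrix (Fin n) (Fin p) ℝ) (Y : Fin r → Matrix (Fin n) (Fin q) ℝ)
    {B : Matrix (Fin p) (Fin q) ℝ} {S : Matrix (Fin n) (Fin n) ℝ} (hS : S ∈ constraint n σ)
    {c : ℝ} (hc : objective X Y lam B S ≤ c) :
    ‖B‖ ≤ c / lam ∧ ‖S‖ ≤ c / traceWeight n := by
  have h1 := traceWeight_mul_trace_le_dataFit hσ X Y B hS
  have hp := posSemidef_of_mem_constraint hσ hS
  have h2 := mul_nonneg (traceWeight_pos hn).le hp.trace_nonneg
  have h3 := mul_nonneg hlam.le (norm21_nonneg B)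
  unfold objective at hc
  constructor
  · refine (norm_le_norm21 B).trans ?_
    rw [le_div_iff₀ hlam]; linarith
  · refine hp.norm_le_trace.trans ?_
    rw [le_div_iff₀ (traceWeight_pos hn)]; linarith

/-- The objective attains its minimum on every nonempty closed set of feasible pairs. -/
theorem exists_isMinOn_objective (hn : 0 < n) {σ lam : ℝ} (hσ : 0 < σ) (hlam : 0 < lam)
    (X : Matrix (Fin n) (Fin p) ℝ) (Y : Fin r → Matrix (Fin n) (Fin q) ℝ)
    {Z : Set (Matrix (Fin p) (Fin q) ℝ × Matrix (Fin n) (Fin n) ℝ)} (hZ : IsClosed Z)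
    (hne : Z.Nonempty) (hsub : Z ⊆ feasible n p q σ) :
    ∃ z ∈ Z, ∀ w ∈ Z, objective X Y lam z.1 z.2 ≤ objective X Y lam w.1 w.2 := by
  obtain ⟨z₀, hz₀⟩ := hne
  set c := objective X Y lam z₀.1 z₀.2 with hc
  set M := max (c / lam) (c / traceWeight n) with hM
  have hball : ∀ w ∈ Z, objective X Y lam w.1 w.2 ≤ c → w ∈ Metric.closedBall
      (0 : Matrix (Fin p) (Fin q) ℝ × Matrix (Fin n) (Fin n) ℝ) M := fun w hw hwc => by
    obtain ⟨h1, h2⟩ := norm_le_of_objective_le hn hσ hlam X Y (hsub hw) hwc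
    rw [mem_closedBall_zero_iff, Prod.norm_def]
    exact max_le_max h1 h2
  have hproper : ProperSpace (Matrix (Fin p) (Fin q) ℝ × Matrix (Fin n) (Fin n) ℝ) :=
    FiniteDimensional.proper ℝ _
  have hcomp : IsCompact (Metric.closedBall
      (0 : Matrix (Fin p) (Fin q) ℝ × Matrix (Fin n) (Fin n) ℝ) M ∩ Z) :=
    (isCompact_closedBall _ _).inter_right hZ
  have hcont : ContinuousOn (fun w : Matrix (Fin p) (Fin q) ℝ × Matrix (Fin n) (Fin n) ℝ =>
      objective X Y lam w.1 w.2) (Metric.closedBall 0 M ∩ Z) := fun w hw =>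
    (continuousAt_objective X Y lam
      (isUnit_det_of_mem_constraint hσ (hsub hw.2)).ne_zero).continuousWithinAt
  obtain ⟨z, hz, hmin⟩ := hcomp.exists_isMinOn ⟨z₀, hball z₀ hz₀ le_rfl, hz₀⟩ hcont
  refine ⟨z, hz.2, fun w hw => ?_⟩
  by_cases hwc : objective X Y lam w.1 w.2 ≤ c
  · exact hmin ⟨hball w hw hwc, hw⟩
  · exact (hmin ⟨hball z₀ hz₀ le_rfl, hz₀⟩ : _ ≤ c).trans (not_le.1 hwc).le

theorem smul_one_mem_constraint (n : ℕ) (σ : ℝ) :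
    σ • (1 : Matrix (Fin n) (Fin n) ℝ) ∈ constraint n σ := by
  simp [constraint, Matrix.PosSemidef.zero]

theorem exists_isNoiseUpdate (hn : 0 < n) {σ lam : ℝ} (hσ : 0 < σ) (hlam : 0 < lam)
    (X : Matrix (Fin n) (Fin p) ℝ) (Y : Fin r → Matrix (Fin n) (Fin q) ℝ)
    (B : Matrix (Fin p) (Fin q) ℝ) : ∃ S, IsNoiseUpdate X Y lam σ B S := by
  obtain ⟨z, hz, hmin⟩ := exists_isMinOn_objective (Z := {B} ×ˢ constraint n σ) hn hσ hlam X Y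
    (isClosed_singleton.prod (isClosed_constraint n σ))
    ⟨(B, σ • 1), rfl, smul_one_mem_constraint n σ⟩ (fun z hz => hz.2)
  obtain ⟨rfl, h2⟩ := hz
  exact ⟨z.2, h2, fun S' hS' => hmin (z.1, S') ⟨rfl, hS'⟩⟩

theorem exists_isRowUpdate (hn : 0 < n) {σ lam : ℝ} (hσ : 0 < σ) (hlam : 0 < lam)
    (X : Matrix (Fin n) (Fin p) ℝ) (Y : Fin r → Matrix (Fin n) (Fin q) ℝ)
    {S : Matrix (Fin n) (Fin n) ℝ} (hS : S ∈ constraint n σ) (j : Fin p)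
    (B : Matrix (Fin p) (Fin q) ℝ) : ∃ B', IsRowUpdate X Y lam S j B B' := by
  have hcl : IsClosed {B' : Matrix (Fin p) (Fin q) ℝ | ∀ i k, i ≠ j → B' i k = B i k} := by
    simp only [Set.ofPred_forall]
    exact isClosed_iInter fun i => isClosed_iInter fun k => isClosed_iInter fun _ =>
      isClosed_eq (continuous_id.matrix_elem i k) continuous_const
  have hmem : ∀ v : Fin q → ℝ, B.updateRow j v ∈
      {B' : Matrix (Fin p) (Fin q) ℝ | ∀ i k, i ≠ j → B' i k = B i k} := fun v i k hi => by
    rw [Matrix.updateRow_ne hi]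
  obtain ⟨z, hz, hmin⟩ := exists_isMinOn_objective
    (Z := {B' : Matrix (Fin p) (Fin q) ℝ | ∀ i k, i ≠ j → B' i k = B i k} ×ˢ {S}) hn hσ hlam X Y
    (hcl.prod isClosed_singleton) ⟨(B, S), fun _ _ _ => rfl, rfl⟩
    (fun z hz => by show z.2 ∈ constraint n σ; rw [hz.2]; exact hS)
  obtain ⟨h1, rfl⟩ := hz
  have hB' : z.1 = B.updateRow j (z.1 j) := by
    ext i k
    by_cases hi : i = j
    · subst hi; simp
    · rw [Matrix.updateRow_ne hi]; exact h1 i k hi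
  refine ⟨z.1, z.1 j, hB', fun w => ?_⟩
  rw [← hB']
  exact hmin (B.updateRow j w, z.2) ⟨hmem w, rfl⟩

theorem exists_isSweep (hn : 0 < n) {σ lam : ℝ} (hσ : 0 < σ) (hlam : 0 < lam)
    (X : Matrix (Fin n) (Fin p) ℝ) (Y : Fin r → Matrix (Fin n) (Fin q) ℝ)
    {S : Matrix (Fin n) (Fin n) ℝ} (hS : S ∈ constraint n σ)
    (B : Matrix (Fin p) (Fin q) ℝ) : ∃ B', IsSweep X Y lam S B B' := by
  choose step hstep using exists_isRowUpdate hn hσ hlam X Y hS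
  let C : Fin (p + 1) → Matrix (Fin p) (Fin q) ℝ := fun i =>
    Fin.induction (motive := fun _ => Matrix (Fin p) (Fin q) ℝ) B (fun j D => step j D) i
  exact ⟨C (Fin.last p), C, rfl, rfl, fun j => by
    have : C j.succ = step j (C j.castSucc) := Fin.induction_succ _ _ _
    rw [this]; exact hstep j _⟩

/-- One epoch of alternate minimization. -/
def IsEpoch (X : Matrix (Fin n) (Fin p) ℝ) (Y : Fin r → Matrix (Fin n) (Fin q) ℝ) (lam σ : ℝ)
    (freq t : ℕ) (z z' : Matrix (Fin p) (Fin q) ℝ × Matrix (Fin n) (Fin n) ℝ) : Prop :=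
  (freq ∣ t → IsNoiseUpdate X Y lam σ z.1 z'.2) ∧ (¬ freq ∣ t → z'.2 = z.2) ∧
    IsSweep X Y lam z'.2 z.1 z'.1

theorem exists_isAlternateMinimization (hn : 0 < n) {σ lam : ℝ} (hσ : 0 < σ) (hlam : 0 < lam)
    (X : Matrix (Fin n) (Fin p) ℝ) (Y : Fin r → Matrix (Fin n) (Fin q) ℝ) (freq : ℕ)
    (B₀ : Matrix (Fin p) (Fin q) ℝ) (S₀ : Matrix (Fin n) (Fin n) ℝ) :
    ∃ (B : ℕ → Matrix (Fin p) (Fin q) ℝ) (S : ℕ → Matrix (Fin n) (Fin n) ℝ),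
      B 0 = B₀ ∧ S 0 = S₀ ∧ IsAlternateMinimization X Y lam σ freq B S := by
  -- `S₀` may violate the constraint. Epoch 0 always contains a noise update, as every `freq`
  -- divides 0, so feasibility is needed only for later epochs.
  have hstep : ∀ (t : ℕ) (z : Matrix (Fin p) (Fin q) ℝ × Matrix (Fin n) (Fin n) ℝ),
      ∃ z' : Matrix (Fin p) (Fin q) ℝ × Matrix (Fin n) (Fin n) ℝ,
        t = 0 ∨ z.2 ∈ constraint n σ →
          z'.2 ∈ constraint n σ ∧ IsEpoch X Y lam σ freq t z z' := fun t z => by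
    by_cases ht : freq ∣ t
    · obtain ⟨S, hS⟩ := exists_isNoiseUpdate hn hσ hlam X Y z.1
      obtain ⟨B, hB⟩ := exists_isSweep hn hσ hlam X Y hS.1 z.1
      exact ⟨(B, S), fun _ => ⟨hS.1, fun _ => hS, fun h => absurd ht h, hB⟩⟩
    · by_cases hz : z.2 ∈ constraint n σ
      · obtain ⟨B, hB⟩ := exists_isSweep hn hσ hlam X Y hz z.1
        exact ⟨(B, z.2), fun _ => ⟨hz, fun h => absurd h ht, fun _ => rfl, hB⟩⟩
      · refine ⟨z, fun h => ?_⟩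
        rcases h with rfl | h
        · exact absurd (dvd_zero freq) ht
        · exact absurd h hz
  choose step hstep using hstep
  let z : ℕ → Matrix (Fin p) (Fin q) ℝ × Matrix (Fin n) (Fin n) ℝ :=
    fun t => Nat.rec (B₀, S₀) step t
  have hz : ∀ t, z (t + 1) = step t (z t) := fun t => rfl
  have hgood : ∀ t, t = 0 ∨ (z t).2 ∈ constraint n σ := fun t => by
    induction t with
    | zero => exact Or.inl rfl
    | succ t ih => right; rw [hz]; exact (hstep t _ ih).1
  refine ⟨fun t => (z t).1, fun t => (z t).2, rfl, rfl, fun t => ?_⟩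
  have := (hstep t (z t) (hgood t)).2
  rwa [← hz] at this

end Existence

/-! ### Optimality conditions and the decomposition of the suboptimality. -/

section Certificate

variable {n p q r : ℕ}

/-- The rows of `(2c / lam) ∑ₗ Xᵀ W⁽ˡ⁾`. -/
def dualRows (X : Matrix (Fin n) (Fin p) ℝ) (lam : ℝ) (W : Matrix (Fin n) (Fin r × Fin q) ℝ) :
    Matrix (Fin p) (Fin q) ℝ :=
  Matrix.of fun j k => 2 * quadWeight n q r / lam * ∑ l, ∑ i, X i j * W i (l, k)

/-- The multiplier of the constraint `S ⪰ σ Id`. -/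
def multiplier (W : Matrix (Fin n) (Fin r × Fin q) ℝ) : Matrix (Fin n) (Fin n) ℝ :=
  traceWeight n • 1 - quadWeight n q r • (W * Wᵀ)

theorem slope_eq {lam : ℝ} (hlam : 0 < lam) (X : Matrix (Fin n) (Fin p) ℝ)
    (W : Matrix (Fin n) (Fin r × Fin q) ℝ)
    (DB : Matrix (Fin p) (Fin q) ℝ) (DS : Matrix (Fin n) (Fin n) ℝ) :
    slope X W DB DS = (multiplier W * DS).trace - lam * ∑ j, dualRows X lam W j ⬝ᵥ DB j := by
  have h1 : (Wᵀ * stack r (X * DB)).trace = ∑ j, ∑ k, (∑ l, ∑ i, X i j * W i (l, k)) * DB j k := by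
    simp only [Matrix.trace, Matrix.diag, Matrix.mul_apply, Matrix.transpose_apply, stack,
      Matrix.of_apply, Fintype.sum_prod_type, Finset.mul_sum, Finset.sum_mul]
    calc ∑ l, ∑ k, ∑ i, ∑ j, W i (l, k) * (X i j * DB j k)
        = ∑ l, ∑ k, ∑ j, ∑ i, W i (l, k) * (X i j * DB j k) :=
          Finset.sum_congr rfl fun l _ => Finset.sum_congr rfl fun k _ => Finset.sum_comm
      _ = ∑ l, ∑ j, ∑ k, ∑ i, W i (l, k) * (X i j * DB j k) :=
          Finset.sum_congr rfl fun l _ => Finset.sum_comm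
      _ = ∑ j, ∑ l, ∑ k, ∑ i, W i (l, k) * (X i j * DB j k) := Finset.sum_comm
      _ = ∑ j, ∑ k, ∑ l, ∑ i, W i (l, k) * (X i j * DB j k) :=
          Finset.sum_congr rfl fun j _ => Finset.sum_comm
      _ = _ := Finset.sum_congr rfl fun j _ => Finset.sum_congr rfl fun k _ =>
          Finset.sum_congr rfl fun l _ => Finset.sum_congr rfl fun i _ => by ring
  have h2 : lam * ∑ j, dualRows X lam W j ⬝ᵥ DB j =
      2 * quadWeight n q r * (Wᵀ * stack r (X * DB)).trace := by
    rw [h1, Finset.mul_sum, Finset.mul_sum]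
    refine Finset.sum_congr rfl fun j _ => ?_
    simp only [dotProduct, dualRows, Matrix.of_apply]
    rw [Finset.mul_sum, Finset.mul_sum]
    refine Finset.sum_congr rfl fun k _ => ?_
    field_simp
  have h3 : (Wᵀ * DS * W).trace = (W * Wᵀ * DS).trace := by
    rw [Matrix.mul_assoc W, ← Matrix.trace_mul_comm]
  rw [h2, slope, multiplier, h3, Matrix.sub_mul, Matrix.trace_sub]
  simp only [Matrix.smul_mul, Matrix.one_mul, Matrix.trace_smul, smul_eq_mul]
  ring

theorem norm21_updateRow (B : Matrix (Fin p) (Fin q) ℝ) (j : Fin p) (v : Fin q → ℝ) :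
    norm21 (B.updateRow j v) = norm21 B + ‖WithLp.toLp 2 v‖ - ‖WithLp.toLp 2 (B j)‖ := by
  unfold norm21
  rw [← Finset.add_sum_erase _ _ (Finset.mem_univ j),
    ← Finset.add_sum_erase (a := j) _ (fun j => ‖WithLp.toLp 2 (B j)‖) (Finset.mem_univ j),
    Matrix.updateRow_self]
  have : ∑ i ∈ Finset.univ.erase j, ‖WithLp.toLp 2 (B.updateRow j v i)‖ =
      ∑ i ∈ Finset.univ.erase j, ‖WithLp.toLp 2 (B i)‖ :=
    Finset.sum_congr rfl fun i hi => by rw [Matrix.updateRow_ne (Finset.ne_of_mem_erase hi)]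
  rw [this]; ring

theorem sum_dotProduct_updateRow_sub (U B : Matrix (Fin p) (Fin q) ℝ) (j : Fin p)
    (v : Fin q → ℝ) :
    ∑ i, U i ⬝ᵥ (B.updateRow j v - B) i = U j ⬝ᵥ v - U j ⬝ᵥ B j := by
  rw [Finset.sum_eq_single j]
  · show U j ⬝ᵥ (B.updateRow j v j - B j) = _
    rw [Matrix.updateRow_self, dotProduct_sub]
  · intro i _ hi
    show U i ⬝ᵥ (B.updateRow j v i - B i) = _
    rw [Matrix.updateRow_ne hi]; simp
  · simp

/-- A minimizer satisfies the optimality conditions of Karush, Kuhn and Tucker. -/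
theorem kkt_of_isMin {σ lam : ℝ} (hσ : 0 < σ) (hlam : 0 < lam)
    (X : Matrix (Fin n) (Fin p) ℝ) (Y : Fin r → Matrix (Fin n) (Fin q) ℝ)
    {B₀ : Matrix (Fin p) (Fin q) ℝ} {S₀ : Matrix (Fin n) (Fin n) ℝ} (hS₀ : S₀ ∈ constraint n σ)
    (hmin : ∀ z ∈ feasible n p q σ, objective X Y lam B₀ S₀ ≤ objective X Y lam z.1 z.2) :
    let W := dualVar X Y B₀ S₀
    (∀ S ∈ constraint n σ, 0 ≤ (multiplier W * (S - σ • 1)).trace) ∧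
    (multiplier W * (S₀ - σ • 1)).trace = 0 ∧
    (∀ j v, dualRows X lam W j ⬝ᵥ v ≤ ‖WithLp.toLp 2 v‖) ∧
    ∀ j, dualRows X lam W j ⬝ᵥ B₀ j = ‖WithLp.toLp 2 (B₀ j)‖ := by
  intro W
  have hVI : ∀ B, ∀ S ∈ constraint n σ, 0 ≤ (multiplier W * (S - S₀)).trace -
      lam * ∑ j, dualRows X lam W j ⬝ᵥ (B - B₀) j + lam * (norm21 B - norm21 B₀) := by
    intro B S hS
    have h := slope_nonneg_of_isMin hσ hlam.le X Y (B := B₀) (B' := B) hS₀ hS fun s hs hs1 => by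
      refine hmin (B₀ + s • (B - B₀), S₀ + s • (S - S₀)) ?_
      have := convex_constraint n σ hS₀ hS (sub_nonneg.2 hs1) hs.le (by ring)
      have e : S₀ + s • (S - S₀) = (1 - s) • S₀ + s • S := by module
      show S₀ + s • (S - S₀) ∈ constraint n σ
      rwa [e]
    rwa [slope_eq hlam] at h
  have hS : ∀ S ∈ constraint n σ, 0 ≤ (multiplier W * (S - S₀)).trace := fun S hS => by
    have h := hVI B₀ S hS
    have e : ∑ j, dualRows X lam W j ⬝ᵥ (B₀ - B₀) j = 0 :=
      Finset.sum_eq_zero fun j _ => by rw [sub_self]; exact dotProduct_zero _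
    rw [e] at h
    simpa using h
  have hrow : ∀ j v, dualRows X lam W j ⬝ᵥ v - dualRows X lam W j ⬝ᵥ B₀ j ≤
      ‖WithLp.toLp 2 v‖ - ‖WithLp.toLp 2 (B₀ j)‖ := fun j v => by
    have h := hVI (B₀.updateRow j v) S₀ hS₀
    rw [sub_self, Matrix.mul_zero, Matrix.trace_zero, sum_dotProduct_updateRow_sub,
      norm21_updateRow, zero_sub, neg_add_eq_sub, ← mul_sub] at h
    have := nonneg_of_mul_nonneg_right h hlam
    linarith
  -- By homogeneity of the norm, the test rows 0 and 2 B₀ⱼ give the two inequalities.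
  have heq : ∀ j, dualRows X lam W j ⬝ᵥ B₀ j = ‖WithLp.toLp 2 (B₀ j)‖ := fun j => by
    have h1 := hrow j 0
    have h2 := hrow j ((2 : ℝ) • B₀ j)
    have e : ‖WithLp.toLp 2 ((2 : ℝ) • B₀ j)‖ = 2 * ‖WithLp.toLp 2 (B₀ j)‖ := by
      rw [WithLp.toLp_smul, norm_smul]; simp
    rw [e, dotProduct_smul, smul_eq_mul] at h2
    simp at h1
    linarith
  -- Complementarity by the same scaling: the test points σ Id and 2 S₀ − σ Id lie on the ray from σ
  -- Id through `S₀`.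
  have hcompl : (multiplier W * (S₀ - σ • 1)).trace = 0 := by
    have h1 := hS (σ • 1) (smul_one_mem_constraint n σ)
    have h2 := hS ((2 : ℝ) • S₀ - σ • 1) (by
      have := Matrix.PosSemidef.smul hS₀ (zero_le_two (α := ℝ))
      have e : (2 : ℝ) • S₀ - σ • 1 - σ • (1 : Matrix (Fin n) (Fin n) ℝ) =
        (2 : ℝ) • (S₀ - σ • 1) := by module
      show Matrix.PosSemidef _
      rwa [e])
    have e1 : σ • 1 - S₀ = -(S₀ - σ • (1 : Matrix (Fin n) (Fin n) ℝ)) := by abel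
    have e2 : (2 : ℝ) • S₀ - σ • 1 - S₀ = S₀ - σ • (1 : Matrix (Fin n) (Fin n) ℝ) := by module
    rw [e1, Matrix.mul_neg, Matrix.trace_neg] at h1
    rw [e2] at h2
    linarith
  refine ⟨fun S hS' => ?_, hcompl, fun j v => ?_, heq⟩
  · have e : S - σ • (1 : Matrix (Fin n) (Fin n) ℝ) = (S - S₀) + (S₀ - σ • 1) := by abel
    rw [e, Matrix.mul_add, Matrix.trace_add, hcompl, add_zero]
    exact hS S hS'
  · have := hrow j v
    rw [heq j] at this
    linarith

/-- The suboptimality of a feasible pair is a sum of nonnegative terms. -/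
theorem objective_eq_of_isMin {σ lam : ℝ} (hσ : 0 < σ) (hlam : 0 < lam)
    (X : Matrix (Fin n) (Fin p) ℝ) (Y : Fin r → Matrix (Fin n) (Fin q) ℝ)
    {B₀ : Matrix (Fin p) (Fin q) ℝ} {S₀ : Matrix (Fin n) (Fin n) ℝ} (hS₀ : S₀ ∈ constraint n σ)
    (hmin : ∀ z ∈ feasible n p q σ, objective X Y lam B₀ S₀ ≤ objective X Y lam z.1 z.2)
    (B : Matrix (Fin p) (Fin q) ℝ) {S : Matrix (Fin n) (Fin n) ℝ} (hS : S ∈ constraint n σ) :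
    let W := dualVar X Y B₀ S₀
    objective X Y lam B S = objective X Y lam B₀ S₀ +
      quadWeight n q r * ((resid X Y B - S * W)ᵀ * S⁻¹ * (resid X Y B - S * W)).trace +
      (multiplier W * (S - σ • 1)).trace +
      lam * ∑ j, (‖WithLp.toLp 2 (B j)‖ - dualRows X lam W j ⬝ᵥ B j) := by
  intro W
  obtain ⟨-, h2, -, h4⟩ := kkt_of_isMin hσ hlam X Y hS₀ hmin
  unfold objective
  rw [dataFit_eq_add_slope hσ X Y (B := B₀) (B' := B) hS₀ hS, slope_eq hlam]
  have e : S - S₀ = (S - σ • (1 : Matrix (Fin n) (Fin n) ℝ)) - (S₀ - σ • 1) := by abel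
  have e2 : ∑ j, dualRows X lam W j ⬝ᵥ (B - B₀) j =
      ∑ j, dualRows X lam W j ⬝ᵥ B j - norm21 B₀ := by
    rw [norm21, ← Finset.sum_sub_distrib]
    refine Finset.sum_congr rfl fun j _ => ?_
    rw [← h4 j]
    exact dotProduct_sub _ _ _
  rw [e, Matrix.mul_sub, Matrix.trace_sub, h2, e2, Finset.sum_sub_distrib]
  simp only [norm21, W]
  ring

end Certificate

/-! ### Quantitative equality in Cauchy–Schwarz, row by row. -/

section Rows

variable {q : ℕ}

theorem inner_toLp (u v : Fin q → ℝ) : inner ℝ (WithLp.toLp 2 u) (WithLp.toLp 2 v) = u ⬝ᵥ v := by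
  rw [EuclideanSpace.inner_toLp_toLp, dotProduct_comm]; simp

theorem norm_toLp_le_one {u : Fin q → ℝ} (hu : ∀ v, u ⬝ᵥ v ≤ ‖WithLp.toLp 2 v‖) :
    ‖WithLp.toLp 2 u‖ ≤ 1 := by
  have h := hu u
  rw [← inner_toLp, real_inner_self_eq_norm_sq] at h
  nlinarith [norm_nonneg (WithLp.toLp 2 u)]

/-- Expanding the square and using ‖u‖ ≤ 1. Thus a small gap in u · v ≤ ‖v‖ makes `v` nearly ‖v‖ u,
and a row can be recovered linearly from its norm. -/
theorem norm_sub_smul_sq_le {u : Fin q → ℝ} (hu : ‖WithLp.toLp 2 u‖ ≤ 1) (v : Fin q → ℝ) :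
    ‖WithLp.toLp 2 (v - ‖WithLp.toLp 2 v‖ • u)‖ ^ 2 ≤
      2 * ‖WithLp.toLp 2 v‖ * (‖WithLp.toLp 2 v‖ - u ⬝ᵥ v) := by
  set s := ‖WithLp.toLp 2 v‖ with hs
  have hs0 : 0 ≤ s := norm_nonneg _
  rw [WithLp.toLp_sub, WithLp.toLp_smul, norm_sub_sq_real, inner_smul_right, inner_toLp, norm_smul,
    ← hs, Real.norm_of_nonneg hs0, dotProduct_comm v u]
  have : (s * ‖WithLp.toLp 2 u‖) ^ 2 ≤ s ^ 2 := by
    have : s * ‖WithLp.toLp 2 u‖ ≤ s := mul_le_of_le_one_right hs0 hu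
    gcongr
  nlinarith

/-- Since 1 − ‖u‖² = 2(1 − ‖u‖) − (1 − ‖u‖)², this follows from Cauchy–Schwarz. It quantifies that a
nonzero optimal row needs ‖u‖ = 1. -/
theorem mul_one_sub_norm_sq_le (u v : Fin q → ℝ) :
    ‖WithLp.toLp 2 v‖ * (1 - ‖WithLp.toLp 2 u‖ ^ 2) ≤ 2 * (‖WithLp.toLp 2 v‖ - u ⬝ᵥ v) := by
  have h := real_inner_le_norm (WithLp.toLp 2 u) (WithLp.toLp 2 v)
  rw [inner_toLp] at h
  have h1 : 0 ≤ ‖WithLp.toLp 2 v‖ * (1 - ‖WithLp.toLp 2 u‖) ^ 2 := by positivity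
  nlinarith [norm_nonneg (WithLp.toLp 2 u)]

theorem norm_smul_eq_dotProduct {u : Fin q → ℝ} {t : ℝ} (ht : 0 ≤ t)
    (h : t * (1 - ‖WithLp.toLp 2 u‖ ^ 2) = 0) : ‖WithLp.toLp 2 (t • u)‖ = u ⬝ᵥ (t • u) := by
  rw [WithLp.toLp_smul, norm_smul, dotProduct_smul, ← inner_toLp, real_inner_self_eq_norm_sq,
    Real.norm_of_nonneg ht, smul_eq_mul]
  rcases mul_eq_zero.1 h with h | h
  · simp [h]
  · have : ‖WithLp.toLp 2 u‖ = 1 := by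
      nlinarith [norm_nonneg (WithLp.toLp 2 u)]
    simp [this]

end Rows

/-! ### Hölder growth of the objective away from its minimizers. -/

section Growth

open scoped Matrix.Norms.Elementwise

variable {n p q r : ℕ}

/-- The block diagonal matrix with blocks `T` and `diag t`. -/
def blockPair (T : Matrix (Fin n) (Fin n) ℝ) (t : Fin p → ℝ) :
    Matrix (Fin (n + p)) (Fin (n + p)) ℝ :=
  (Matrix.fromBlocks T 0 0 (Matrix.diagonal t)).submatrix finSumFinEquiv.symm finSumFinEquiv.symm

theorem posSemidef_blockPair {T : Matrix (Fin n) (Fin n) ℝ} (hT : T.PosSemidef) {t : Fin p → ℝ}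
    (ht : ∀ j, 0 ≤ t j) : (blockPair T t).PosSemidef := by
  refine Matrix.PosSemidef.submatrix (posSemidef_real_iff.2 ⟨?_, fun v => ?_⟩) _
  · rw [Matrix.fromBlocks_transpose]
    simp [hT.transpose_eq]
  · rw [Matrix.fromBlocks_mulVec]
    have h1 := (posSemidef_real_iff.1 hT).2 (v ∘ Sum.inl)
    have h2 := (posSemidef_real_iff.1 (Matrix.PosSemidef.diagonal ht)).2 (v ∘ Sum.inr)
    simpa [dotProduct] using add_nonneg h1 h2

theorem norm_blockPair_le {T : Matrix (Fin n) (Fin n) ℝ} {t : Fin p → ℝ} {M : ℝ} (hM : 0 ≤ M)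
    (hT : ‖T‖ ≤ M) (ht : ∀ j, |t j| ≤ M) : ‖blockPair T t‖ ≤ M := by
  refine (Matrix.norm_le_iff hM).2 fun a b => ?_
  simp only [blockPair, Matrix.submatrix_apply]
  rcases finSumFinEquiv.symm a with i | i <;> rcases finSumFinEquiv.symm b with j | j
  · exact T.norm_entry_le_entrywise_sup_norm.trans hT
  · simpa using hM
  · simpa using hM
  · rw [Matrix.fromBlocks_apply₂₂, Matrix.diagonal_apply]
    split_ifs
    · exact ht i
    · simpa using hM

/-- The matrix with rows `t j • U j`. -/
def scaleRows (t : Fin p → ℝ) (U : Matrix (Fin p) (Fin q) ℝ) : Matrix (Fin p) (Fin q) ℝ :=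
  Matrix.of fun j k => t j * U j k

theorem scaleRows_row (t : Fin p → ℝ) (U : Matrix (Fin p) (Fin q) ℝ) (j : Fin p) :
    scaleRows t U j = t j • U j := rfl

/-- The linear part of the conditions of Karush, Kuhn and Tucker, for the block diagonal matrix of
`S - σ Id` and of the norms of the rows of `B`. -/
def kktMap (X : Matrix (Fin n) (Fin p) ℝ) (Λ : Matrix (Fin n) (Fin n) ℝ)
    (W : Matrix (Fin n) (Fin r × Fin q) ℝ) (U : Matrix (Fin p) (Fin q) ℝ) :
    Matrix (Fin (n + p)) (Fin (n + p)) ℝ →ₗ[ℝ]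
      ℝ × Matrix (Fin n) (Fin r × Fin q) ℝ × (Fin p → ℝ) where
  toFun Z := ((Λ * Z.submatrix (Fin.castAdd p) (Fin.castAdd p)).trace,
    Z.submatrix (Fin.castAdd p) (Fin.castAdd p) * W +
      stack r (X * scaleRows (fun j => Z (Fin.natAdd n j) (Fin.natAdd n j)) U),
    fun j => Z (Fin.natAdd n j) (Fin.natAdd n j) * (1 - ‖WithLp.toLp 2 (U j)‖ ^ 2))
  map_add' Z Z' := by
    have h : scaleRows (fun j => (Z + Z') (Fin.natAdd n j) (Fin.natAdd n j)) U =
        scaleRows (fun j => Z (Fin.natAdd n j) (Fin.natAdd n j)) U +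
          scaleRows (fun j => Z' (Fin.natAdd n j) (Fin.natAdd n j)) U := by
      ext j k; simp [scaleRows, add_mul]
    refine Prod.ext ?_ (Prod.ext ?_ ?_)
    · simp [Matrix.submatrix_add, Matrix.mul_add]
    · simp only [h, Matrix.submatrix_add, Pi.add_apply, Matrix.add_mul, Matrix.mul_add, stack_add,
        Prod.mk_add_mk]
      abel
    · ext j; simp [add_mul]
  map_smul' s Z := by
    have h : scaleRows (fun j => (s • Z) (Fin.natAdd n j) (Fin.natAdd n j)) U =
        s • scaleRows (fun j => Z (Fin.natAdd n j) (Fin.natAdd n j)) U := by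
      ext j k; simp [scaleRows, mul_assoc]
    refine Prod.ext ?_ (Prod.ext ?_ ?_)
    · simp [Matrix.submatrix_smul]
    · simp only [h, Matrix.submatrix_smul, Pi.smul_apply, Matrix.smul_mul, Matrix.mul_smul,
        stack_smul, Prod.smul_mk, smul_add, RingHom.id_apply]
    · ext j; simp [mul_assoc]

theorem kktMap_blockPair (X : Matrix (Fin n) (Fin p) ℝ) (Λ : Matrix (Fin n) (Fin n) ℝ)
    (W : Matrix (Fin n) (Fin r × Fin q) ℝ) (U : Matrix (Fin p) (Fin q) ℝ)
    (T : Matrix (Fin n) (Fin n) ℝ) (t : Fin p → ℝ) :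
    kktMap X Λ W U (blockPair T t) = ((Λ * T).trace, T * W + stack r (X * scaleRows t U),
      fun j => t j * (1 - ‖WithLp.toLp 2 (U j)‖ ^ 2)) := by
  have h1 : (blockPair T t).submatrix (Fin.castAdd p) (Fin.castAdd p) = T := by
    ext i j; simp [blockPair]
  have h2 : (fun j => blockPair T t (Fin.natAdd n j) (Fin.natAdd n j)) = t := by
    ext j; simp [blockPair]
  have h3 : ∀ j, blockPair T t (Fin.natAdd n j) (Fin.natAdd n j) = t j := congrFun h2
  show ((Λ * _).trace, _ * W + stack r (X * scaleRows _ U), fun j => _ * _) = _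
  simp only [h1, h3]
  rfl

theorem norm_toLp_le_card (v : Fin q → ℝ) {M : ℝ} (hv : ∀ k, |v k| ≤ M) :
    ‖WithLp.toLp 2 v‖ ≤ q * M := by
  have h : WithLp.toLp 2 v = ∑ k, v k • EuclideanSpace.single k (1 : ℝ) := by
    ext k; simp [Finset.sum_apply, Pi.single_apply]
  rw [h]
  refine (norm_sum_le _ _).trans ?_
  calc ∑ k, ‖v k • EuclideanSpace.single k (1 : ℝ)‖ ≤ ∑ _k : Fin q, M :=
        Finset.sum_le_sum fun k _ => by rw [norm_smul]; simpa using hv k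
    _ = _ := by simp

theorem norm_toLp_row_le (B : Matrix (Fin p) (Fin q) ℝ) (j : Fin p) :
    ‖WithLp.toLp 2 (B j)‖ ≤ q * ‖B‖ :=
  norm_toLp_le_card _ fun _ => B.norm_entry_le_entrywise_sup_norm

theorem norm_stack_le (A : Matrix (Fin n) (Fin q) ℝ) : ‖stack r A‖ ≤ ‖A‖ :=
  (Matrix.norm_le_iff (norm_nonneg _)).2 fun _ _ => A.norm_entry_le_entrywise_sup_norm

theorem norm_stack_mul_le (X : Matrix (Fin n) (Fin p) ℝ) (B : Matrix (Fin p) (Fin q) ℝ) :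
    ‖stack r (X * B)‖ ≤ p * ‖X‖ * ‖B‖ := by
  simpa using (norm_stack_le (X * B)).trans (norm_mul_le_card X B)

/-- `S⁻¹ ⪰ (Tr S)⁻¹ Id` in integrated form. -/
theorem norm_sq_le_trace_mul {κ : Type*} [Fintype κ] {σ : ℝ} (hσ : 0 < σ)
    {S : Matrix (Fin n) (Fin n) ℝ} (hS : S ∈ constraint n σ) (A : Matrix (Fin n) κ ℝ) :
    ‖A‖ ^ 2 ≤ S.trace * (Aᵀ * S⁻¹ * A).trace := by
  classical
  have hpos := posDef_of_mem_constraint hσ hS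
  have htr := hpos.posSemidef.trace_nonneg
  have hq := trace_conj_inv_nonneg hσ hS A
  have hent : ∀ i k, A i k ^ 2 ≤ S.trace * (Aᵀ * S⁻¹ * A).trace := fun i k => by
    have hii : 0 < S i i := hpos.diag_pos
    have hile : S i i ≤ S.trace := Finset.single_le_sum (f := fun i => S i i)
      (fun j _ => hpos.posSemidef.diag_nonneg) (Finset.mem_univ i)
    -- The test matrix has one nonzero entry, the maximizer w = A i k / S i i of 2 w A i k − w² S i
    -- i.
    have h := trace_inv_eq_complete_square (transpose_eq_of_mem_constraint hS)
      (isUnit_det_of_mem_constraint hσ hS) A (Matrix.single i k (A i k / S i i))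
    have h1 := trace_conj_inv_nonneg hσ hS (A - S * Matrix.single i k (A i k / S i i))
    have e1 : ((Matrix.single i k (A i k / S i i))ᵀ * A).trace = A i k / S i i * A i k := by
      rw [Matrix.transpose_single, Matrix.trace_single_mul]; simp
    have e2 : ((Matrix.single i k (A i k / S i i))ᵀ * S * Matrix.single i k (A i k / S i i)).trace =
        A i k / S i i * S i i * (A i k / S i i) := by
      rw [Matrix.transpose_single, Matrix.single_mul_mul_single]; simp
    rw [e1, e2] at h
    have h2 : A i k ^ 2 / S i i ≤ (Aᵀ * S⁻¹ * A).trace := by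
      have e3 : A i k ^ 2 / S i i = 2 * (A i k / S i i * A i k) -
          A i k / S i i * S i i * (A i k / S i i) := by field_simp; ring
      linarith
    calc A i k ^ 2 = S i i * (A i k ^ 2 / S i i) := by field_simp
      _ ≤ S.trace * (Aᵀ * S⁻¹ * A).trace := by gcongr
  have h1 : ‖A‖ ≤ √(S.trace * (Aᵀ * S⁻¹ * A).trace) :=
    (Matrix.norm_le_iff (Real.sqrt_nonneg _)).2 fun i k =>
      Real.le_sqrt_of_sq_le (by simpa using hent i k)
  calc _ ≤ √(S.trace * (Aᵀ * S⁻¹ * A).trace) ^ 2 := by gcongr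
    _ = _ := Real.sq_sqrt (by positivity)

theorem resid_eq (X : Matrix (Fin n) (Fin p) ℝ) (Y : Fin r → Matrix (Fin n) (Fin q) ℝ)
    (B : Matrix (Fin p) (Fin q) ℝ) : resid X Y B = resid X Y 0 - stack r (X * B) := by
  have := resid_sub X Y 0 B
  rw [sub_eq_iff_eq_add', sub_zero] at this
  rw [this]
  exact (sub_eq_add_neg _ _).symm

theorem norm_sub_scaleRows_sq_le {U : Matrix (Fin p) (Fin q) ℝ}
    (hU : ∀ j, ‖WithLp.toLp 2 (U j)‖ ≤ 1) (B : Matrix (Fin p) (Fin q) ℝ) {M δ : ℝ}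
    (hM0 : 0 ≤ M) (hδ0 : 0 ≤ δ) (hM : ∀ j, ‖WithLp.toLp 2 (B j)‖ ≤ M)
    (hδ : ∀ j, ‖WithLp.toLp 2 (B j)‖ - U j ⬝ᵥ B j ≤ δ) :
    ‖B - scaleRows (fun j => ‖WithLp.toLp 2 (B j)‖) U‖ ^ 2 ≤ 2 * M * δ := by
  have h : ‖B - scaleRows (fun j => ‖WithLp.toLp 2 (B j)‖) U‖ ≤ √(2 * M * δ) := by
    refine (Matrix.norm_le_iff (Real.sqrt_nonneg _)).2 fun j k => ?_
    refine (norm_toLp_nonneg_le (B j - ‖WithLp.toLp 2 (B j)‖ • U j) k).trans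
      (Real.le_sqrt_of_sq_le ((norm_sub_smul_sq_le (hU j) (B j)).trans ?_))
    have := hM j
    have := norm_nonneg (WithLp.toLp 2 (B j))
    calc 2 * ‖WithLp.toLp 2 (B j)‖ * (‖WithLp.toLp 2 (B j)‖ - U j ⬝ᵥ B j)
        ≤ 2 * ‖WithLp.toLp 2 (B j)‖ * δ := by gcongr; exact hδ j
      _ ≤ 2 * M * δ := by gcongr
  calc _ ≤ √(2 * M * δ) ^ 2 := by gcongr
    _ = _ := Real.sq_sqrt (by positivity)

/-- The right hand side of the linear system of Karush, Kuhn and Tucker. -/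
def kktRhs (p : ℕ) (σ : ℝ) (R W : Matrix (Fin n) (Fin r × Fin q) ℝ) :
    ℝ × Matrix (Fin n) (Fin r × Fin q) ℝ × (Fin p → ℝ) := (0, R - σ • W, 0)

theorem kktMap_blockPair_sub_kktRhs {σ : ℝ} (X : Matrix (Fin n) (Fin p) ℝ)
    (Y : Fin r → Matrix (Fin n) (Fin q) ℝ) (Λ : Matrix (Fin n) (Fin n) ℝ)
    (W : Matrix (Fin n) (Fin r × Fin q) ℝ) (U B : Matrix (Fin p) (Fin q) ℝ)
    (S : Matrix (Fin n) (Fin n) ℝ) (t : Fin p → ℝ) :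
    kktMap X Λ W U (blockPair (S - σ • 1) t) - kktRhs p σ (resid X Y 0) W =
      ((Λ * (S - σ • 1)).trace, -(resid X Y B - S * W) - stack r (X * (B - scaleRows t U)),
        fun j => t j * (1 - ‖WithLp.toLp 2 (U j)‖ ^ 2)) := by
  rw [kktMap_blockPair, kktRhs, resid_eq X Y B]
  refine Prod.ext (by simp) (Prod.ext ?_ (by simp))
  have h : stack r (X * (B - scaleRows t U)) =
      stack r (X * B) - stack r (X * scaleRows t U) := by
    rw [Matrix.mul_sub]; rfl
  simp only [h, Matrix.sub_mul, Matrix.smul_mul, Matrix.one_mul, Prod.mk_sub_mk]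
  abel

/-- Positive semidefinite solutions of the linear system are minimizers. -/
theorem objective_eq_of_kktMap_eq {σ lam : ℝ} (hσ : 0 < σ) (hlam : 0 < lam)
    (X : Matrix (Fin n) (Fin p) ℝ) (Y : Fin r → Matrix (Fin n) (Fin q) ℝ)
    {B₀ : Matrix (Fin p) (Fin q) ℝ} {S₀ : Matrix (Fin n) (Fin n) ℝ} (hS₀ : S₀ ∈ constraint n σ)
    (hmin : ∀ z ∈ feasible n p q σ, objective X Y lam B₀ S₀ ≤ objective X Y lam z.1 z.2)
    {W : Matrix (Fin n) (Fin r × Fin q) ℝ} (hW : W = dualVar X Y B₀ S₀)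
    {Z : Matrix (Fin (n + p)) (Fin (n + p)) ℝ} (hZ : Z.PosSemidef)
    (hsol : kktMap X (multiplier W) W (dualRows X lam W) Z = kktRhs p σ (resid X Y 0) W) :
    Z.submatrix (Fin.castAdd p) (Fin.castAdd p) + σ • 1 ∈ constraint n σ ∧
    objective X Y lam
      (scaleRows (fun j => Z (Fin.natAdd n j) (Fin.natAdd n j)) (dualRows X lam W))
      (Z.submatrix (Fin.castAdd p) (Fin.castAdd p) + σ • 1) = objective X Y lam B₀ S₀ := by
  -- `Z` need not be block diagonal: the equations see only the upper left block, which is positive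
  -- semidefinite, and the diagonal entries of the lower right one, which are nonnegative.
  set T := Z.submatrix (Fin.castAdd p) (Fin.castAdd p) with hT
  set U := dualRows X lam W with hU
  set t : Fin p → ℝ := fun j => Z (Fin.natAdd n j) (Fin.natAdd n j) with ht
  have hmem : T + σ • 1 ∈ constraint n σ := by
    show Matrix.PosSemidef _
    rw [add_sub_cancel_right]
    exact hZ.submatrix _
  have h1 : (multiplier W * T).trace = 0 := congrArg Prod.fst hsol
  have h2 : T * W + stack r (X * scaleRows t U) = resid X Y 0 - σ • W :=
    congrArg (fun x => x.2.1) hsol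
  have h3 : ∀ j, t j * (1 - ‖WithLp.toLp 2 (U j)‖ ^ 2) = 0 := fun j =>
    congrFun (congrArg (fun x => x.2.2) hsol) j
  have ht0 : ∀ j, 0 ≤ t j := fun j => hZ.diag_nonneg
  refine ⟨hmem, ?_⟩
  have h := objective_eq_of_isMin hσ hlam X Y hS₀ hmin (scaleRows t U) hmem
  rw [← hW] at h
  have e1 : resid X Y (scaleRows t U) - (T + σ • 1) * W = 0 := by
    rw [resid_eq, Matrix.add_mul, Matrix.smul_mul, Matrix.one_mul]
    rw [eq_sub_iff_add_eq] at h2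
    rw [← h2]
    abel
  have e3 : ∑ j, (‖WithLp.toLp 2 (scaleRows t U j)‖ - U j ⬝ᵥ scaleRows t U j) = 0 :=
    Finset.sum_eq_zero fun j _ => by
      rw [scaleRows_row, norm_smul_eq_dotProduct (ht0 j) (h3 j), sub_self]
  rw [h, e1, add_sub_cancel_right, h1, ← hU, e3]
  simp

/-- The block diagonal matrix of a minimizer solves the linear system. -/
theorem kktMap_blockPair_of_isMin {σ lam : ℝ} (hσ : 0 < σ) (hlam : 0 < lam)
    (X : Matrix (Fin n) (Fin p) ℝ) (Y : Fin r → Matrix (Fin n) (Fin q) ℝ)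
    {B₀ : Matrix (Fin p) (Fin q) ℝ} {S₀ : Matrix (Fin n) (Fin n) ℝ} (hS₀ : S₀ ∈ constraint n σ)
    (hmin : ∀ z ∈ feasible n p q σ, objective X Y lam B₀ S₀ ≤ objective X Y lam z.1 z.2)
    {W : Matrix (Fin n) (Fin r × Fin q) ℝ} (hW : W = dualVar X Y B₀ S₀) :
    kktMap X (multiplier W) W (dualRows X lam W)
      (blockPair (S₀ - σ • 1) fun j => ‖WithLp.toLp 2 (B₀ j)‖) = kktRhs p σ (resid X Y 0) W := by
  obtain ⟨k1, k2, k3, k4⟩ := kkt_of_isMin hσ hlam X Y hS₀ hmin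
  simp only [← hW] at k1 k2 k3 k4
  have hU1 : ∀ j, ‖WithLp.toLp 2 (dualRows X lam W j)‖ ≤ 1 := fun j => norm_toLp_le_one (k3 j)
  have hrow : scaleRows (fun j => ‖WithLp.toLp 2 (B₀ j)‖) (dualRows X lam W) = B₀ := by
    have h := norm_sub_scaleRows_sq_le hU1 B₀ (norm21_nonneg B₀) le_rfl
      (norm_toLp_row_le_norm21 B₀) (fun j => by rw [k4 j, sub_self])
    rw [mul_zero] at h
    have h' := pow_eq_zero_iff (two_ne_zero) |>.1 (le_antisymm h (sq_nonneg _))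
    exact (sub_eq_zero.1 (norm_eq_zero.1 h')).symm
  have hR : resid X Y B₀ - S₀ * W = 0 := by
    rw [hW, dualVar,
      Matrix.mul_nonsing_inv_cancel_left _ _ (isUnit_det_of_mem_constraint hσ hS₀), sub_self]
  rw [← sub_eq_zero, kktMap_blockPair_sub_kktRhs X Y _ W _ B₀, k2, hR, hrow, sub_self,
    Matrix.mul_zero, stack_zero]
  refine Prod.ext rfl (Prod.ext (by simp) (funext fun j => ?_))
  have h1 := mul_one_sub_norm_sq_le (dualRows X lam W j) (B₀ j)
  rw [k4 j, sub_self, mul_zero] at h1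
  have h2 : 0 ≤ 1 - ‖WithLp.toLp 2 (dualRows X lam W j)‖ ^ 2 := by
    nlinarith [hU1 j, norm_nonneg (WithLp.toLp 2 (dualRows X lam W j))]
  exact le_antisymm h1 (mul_nonneg (norm_nonneg _) h2)

/-- A constant for the residual of the linear system. -/
def residualConst (n q r : ℕ) (lam E M : ℝ) : ℝ :=
  E + n * M / quadWeight n q r + 2 * (q * M) / lam + 4 * E / lam ^ 2

/-- The residual of the linear system is controlled by the suboptimality. -/
theorem kkt_residual_le (hn : 0 < n) (hq : 0 < q) (hr : 0 < r) {σ lam : ℝ} (hσ : 0 < σ)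
    (hlam : 0 < lam) (X : Matrix (Fin n) (Fin p) ℝ) (Y : Fin r → Matrix (Fin n) (Fin q) ℝ)
    {B₀ : Matrix (Fin p) (Fin q) ℝ} {S₀ : Matrix (Fin n) (Fin n) ℝ} (hS₀ : S₀ ∈ constraint n σ)
    (hmin : ∀ z ∈ feasible n p q σ, objective X Y lam B₀ S₀ ≤ objective X Y lam z.1 z.2)
    {W : Matrix (Fin n) (Fin r × Fin q) ℝ} (hW : W = dualVar X Y B₀ S₀)
    {B : Matrix (Fin p) (Fin q) ℝ} {S : Matrix (Fin n) (Fin n) ℝ} (hS : S ∈ constraint n σ)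
    {E M ε : ℝ} (hBM : ‖B‖ ≤ M) (hSM : ‖S‖ ≤ M)
    (hε : objective X Y lam B S = objective X Y lam B₀ S₀ + ε) (hεE : ε ≤ E) :
    ‖B - scaleRows (fun j => ‖WithLp.toLp 2 (B j)‖) (dualRows X lam W)‖ ≤
      √(residualConst n q r lam E M * ε) ∧
    ‖kktMap X (multiplier W) W (dualRows X lam W)
        (blockPair (S - σ • 1) fun j => ‖WithLp.toLp 2 (B j)‖) - kktRhs p σ (resid X Y 0) W‖ ≤
      (1 + p * ‖X‖) * √(residualConst n q r lam E M * ε) := by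
  obtain ⟨k1, -, k3, -⟩ := kkt_of_isMin hσ hlam X Y hS₀ hmin
  have hdec := objective_eq_of_isMin hσ hlam X Y hS₀ hmin B hS
  simp only [← hW] at k1 k3 hdec
  rw [hε] at hdec
  obtain ⟨U, hU⟩ : ∃ U, U = dualRows X lam W := ⟨_, rfl⟩
  obtain ⟨Λ, hΛ⟩ : ∃ Λ, Λ = multiplier W := ⟨_, rfl⟩
  rw [← hU, ← hΛ] at hdec ⊢
  rw [← hU] at k3
  rw [← hΛ] at k1
  have hU1 : ∀ j, ‖WithLp.toLp 2 (U j)‖ ≤ 1 := fun j => norm_toLp_le_one (k3 j)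
  have hc : 0 < quadWeight n q r := quadWeight_pos hn hq hr
  have hM0 : 0 ≤ M := (norm_nonneg _).trans hBM
  have hε0 : 0 ≤ ε := by
    have : _ ≤ objective X Y lam B S := hmin (B, S) hS
    linarith
  have hE0 : 0 ≤ E := hε0.trans hεE
  obtain ⟨t, ht⟩ : ∃ t : Fin p → ℝ, t = fun j => ‖WithLp.toLp 2 (B j)‖ := ⟨_, rfl⟩
  have htj : ∀ j, t j = ‖WithLp.toLp 2 (B j)‖ := congrFun ht
  have ht0 : ∀ j, 0 ≤ t j := fun j => by rw [htj]; exact norm_nonneg _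
  rw [← ht]
  simp only [← htj] at hdec
  have htM : ∀ j, t j ≤ q * M := fun j => by
    rw [htj]; exact (norm_toLp_row_le B j).trans (by gcongr)
  obtain ⟨Q, hQ⟩ : ∃ Q, Q = ((resid X Y B - S * W)ᵀ * S⁻¹ * (resid X Y B - S * W)).trace :=
    ⟨_, rfl⟩
  have hQ0 : 0 ≤ Q := hQ ▸ trace_conj_inv_nonneg hσ hS _
  rw [← hQ] at hdec
  have hgap0 : ∀ j, 0 ≤ t j - U j ⬝ᵥ B j := fun j => by rw [htj]; exact sub_nonneg.2 (k3 j _)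
  have hΛ0 := k1 S hS
  have hsum0 : 0 ≤ ∑ j, (t j - U j ⬝ᵥ B j) := Finset.sum_nonneg fun j _ => hgap0 j
  have hcQ : 0 ≤ quadWeight n q r * Q := by positivity
  have hls : 0 ≤ lam * ∑ j, (t j - U j ⬝ᵥ B j) := by positivity
  -- All terms of the decomposition of ε are nonnegative, so each of them is at most ε.
  have hgap : ∀ j, t j - U j ⬝ᵥ B j ≤ ε / lam := fun j => by
    rw [le_div_iff₀ hlam, mul_comm]
    have h1 : t j - U j ⬝ᵥ B j ≤ ∑ j, (t j - U j ⬝ᵥ B j) :=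
      Finset.single_le_sum (f := fun j => t j - U j ⬝ᵥ B j) (fun j _ => hgap0 j)
        (Finset.mem_univ j)
    have := mul_le_mul_of_nonneg_left h1 hlam.le
    linarith
  have hQε : Q ≤ ε / quadWeight n q r := by
    rw [le_div_iff₀ hc, mul_comm]; linarith
  have hC₂ε : residualConst n q r lam E M * ε = E * ε + n * M / quadWeight n q r * ε +
      2 * (q * M) / lam * ε + 4 * E / lam ^ 2 * ε := by
    rw [residualConst]; ring
  obtain ⟨a, ha⟩ : ∃ a, a = √(residualConst n q r lam E M * ε) := ⟨_, rfl⟩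
  rw [← ha]
  have ha0 : 0 ≤ a := ha ▸ Real.sqrt_nonneg _
  have hle : ∀ {x : ℝ}, x ^ 2 ≤ residualConst n q r lam E M * ε → x ≤ a :=
    fun h => ha ▸ Real.le_sqrt_of_sq_le h
  rw [hC₂ε] at hle
  have t1 : 0 ≤ E * ε := by positivity
  have t2 : 0 ≤ n * M / quadWeight n q r * ε := by positivity
  have t3 : 0 ≤ 2 * (q * M) / lam * ε := by positivity
  have t4 : 0 ≤ 4 * E / lam ^ 2 * ε := by positivity
  -- This residual is even linear in ε; ε ≤ E weakens it to the common rate √ε.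
  have r1 : |(Λ * (S - σ • 1)).trace| ≤ a := by
    refine hle ?_
    rw [sq_abs]
    have h1 : (Λ * (S - σ • 1)).trace ≤ ε := by linarith
    have : (Λ * (S - σ • 1)).trace ^ 2 ≤ E * ε := by
      rw [sq]
      exact mul_le_mul (h1.trans hεE) h1 hΛ0 hE0
    linarith
  have r2 : ‖resid X Y B - S * W‖ ≤ a := by
    refine hle ?_
    have h1 : S.trace ≤ n * M := by
      have := (le_abs_self _).trans (abs_trace_le S)
      rw [Fintype.card_fin] at this
      exact this.trans (by gcongr)
    have : ‖resid X Y B - S * W‖ ^ 2 ≤ n * M / quadWeight n q r * ε := by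
      calc ‖resid X Y B - S * W‖ ^ 2 ≤ S.trace * Q := hQ ▸ norm_sq_le_trace_mul hσ hS _
        _ ≤ n * M * (ε / quadWeight n q r) := by gcongr
        _ = _ := by ring
    linarith
  have r3 : ‖B - scaleRows t U‖ ≤ a := by
    refine hle ?_
    have := norm_sub_scaleRows_sq_le hU1 B (M := q * M) (δ := ε / lam) (by positivity)
      (by positivity) (fun j => htj j ▸ htM j) (fun j => htj j ▸ hgap j)
    rw [← ht] at this
    have e : 2 * (q * M) * (ε / lam) = 2 * (q * M) / lam * ε := by ring
    linarith
  have r4 : ∀ j, |t j * (1 - ‖WithLp.toLp 2 (U j)‖ ^ 2)| ≤ a := fun j => by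
    refine hle ?_
    rw [sq_abs]
    have h2 : 0 ≤ 1 - ‖WithLp.toLp 2 (U j)‖ ^ 2 := by
      nlinarith [hU1 j, norm_nonneg (WithLp.toLp 2 (U j))]
    have h1 : t j * (1 - ‖WithLp.toLp 2 (U j)‖ ^ 2) ≤ 2 * (ε / lam) := by
      have := mul_one_sub_norm_sq_le (U j) (B j)
      rw [← htj] at this
      linarith [hgap j]
    have h3 : 0 ≤ t j * (1 - ‖WithLp.toLp 2 (U j)‖ ^ 2) := mul_nonneg (ht0 j) h2
    have : (t j * (1 - ‖WithLp.toLp 2 (U j)‖ ^ 2)) ^ 2 ≤ 4 * E / lam ^ 2 * ε := by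
      calc (t j * (1 - ‖WithLp.toLp 2 (U j)‖ ^ 2)) ^ 2 ≤ (2 * (ε / lam)) ^ 2 :=
            pow_le_pow_left₀ h3 h1 2
        _ = 4 / lam ^ 2 * (ε * ε) := by ring
        _ ≤ 4 / lam ^ 2 * (E * ε) := by gcongr
        _ = _ := by ring
    linarith
  refine ⟨r3, ?_⟩
  have hge : a ≤ (1 + p * ‖X‖) * a := le_mul_of_one_le_left ha0 (by
    have : 0 ≤ p * ‖X‖ := by positivity
    linarith)
  -- In the middle equation `B` is replaced by the matrix rebuilt from its row norms; that error,
  -- multiplied by `X`, explains the factor 1 + p‖X‖.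
  rw [kktMap_blockPair_sub_kktRhs X Y Λ W U B]
  refine max_le (r1.trans hge) (max_le ?_ ((pi_norm_le_iff_of_nonneg (by positivity)).2
    fun j => (r4 j).trans hge))
  refine (norm_sub_le _ _).trans ?_
  rw [norm_neg, add_mul, one_mul]
  exact add_le_add r2 ((norm_stack_mul_le _ _).trans (by gcongr))

theorem norm_sub_scaleRows_le {U : Matrix (Fin p) (Fin q) ℝ}
    (hU : ∀ j, ‖WithLp.toLp 2 (U j)‖ ≤ 1) (B : Matrix (Fin p) (Fin q) ℝ)
    (T : Matrix (Fin n) (Fin n) ℝ) (t : Fin p → ℝ) (Z : Matrix (Fin (n + p)) (Fin (n + p)) ℝ) :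
    ‖B - scaleRows (fun j => Z (Fin.natAdd n j) (Fin.natAdd n j)) U‖ ≤
      ‖B - scaleRows t U‖ + ‖blockPair T t - Z‖ := by
  have h1 : B - scaleRows (fun j => Z (Fin.natAdd n j) (Fin.natAdd n j)) U =
      (B - scaleRows t U) +
        scaleRows (fun j => (blockPair T t - Z) (Fin.natAdd n j) (Fin.natAdd n j)) U := by
    ext j k
    simp [scaleRows, blockPair]
    ring
  rw [h1]
  refine (norm_add_le _ _).trans (add_le_add le_rfl
    ((Matrix.norm_le_iff (norm_nonneg _)).2 fun j k => ?_))
  simp only [scaleRows, Matrix.of_apply, norm_mul]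
  have h2 : ‖U j k‖ ≤ 1 := (norm_toLp_nonneg_le (U j) k).trans (hU j)
  exact (mul_le_of_le_one_right (norm_nonneg _) h2).trans
    (Matrix.norm_entry_le_entrywise_sup_norm _)

theorem norm_sub_submatrix_le (T : Matrix (Fin n) (Fin n) ℝ) (t : Fin p → ℝ)
    (Z : Matrix (Fin (n + p)) (Fin (n + p)) ℝ) :
    ‖T - Z.submatrix (Fin.castAdd p) (Fin.castAdd p)‖ ≤ ‖blockPair T t - Z‖ := by
  refine (Matrix.norm_le_iff (norm_nonneg _)).2 fun i k => ?_
  have h1 : (T - Z.submatrix (Fin.castAdd p) (Fin.castAdd p)) i k =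
      (blockPair T t - Z) (Fin.castAdd p i) (Fin.castAdd p k) := by
    simp [blockPair]
  rw [h1]
  exact Matrix.norm_entry_le_entrywise_sup_norm _

/-- **Hölder error bound** for the objective: on sublevel sets, a power of the distance to the set
of minimizers is controlled by the suboptimality. -/
theorem exists_growth (hn : 0 < n) (hq : 0 < q) (hr : 0 < r) {σ lam : ℝ} (hσ : 0 < σ)
    (hlam : 0 < lam) (X : Matrix (Fin n) (Fin p) ℝ) (Y : Fin r → Matrix (Fin n) (Fin q) ℝ)
    {B₀ : Matrix (Fin p) (Fin q) ℝ} {S₀ : Matrix (Fin n) (Fin n) ℝ} (hS₀ : S₀ ∈ constraint n σ)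
    (hmin : ∀ z ∈ feasible n p q σ, objective X Y lam B₀ S₀ ≤ objective X Y lam z.1 z.2)
    (c₀ : ℝ) :
    ∃ N : ℕ, 2 ≤ N ∧ ∃ C : ℝ, 0 ≤ C ∧ ∀ (B : Matrix (Fin p) (Fin q) ℝ) (S : Matrix (Fin n) (Fin n) ℝ),
      S ∈ constraint n σ → objective X Y lam B S ≤ c₀ →
      ∃ (B' : Matrix (Fin p) (Fin q) ℝ) (S' : Matrix (Fin n) (Fin n) ℝ), S' ∈ constraint n σ ∧
        objective X Y lam B' S' = objective X Y lam B₀ S₀ ∧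
        (‖B - B'‖ + ‖S - S'‖) ^ N ≤ C * (objective X Y lam B S - objective X Y lam B₀ S₀) := by
  by_cases hc₀ : objective X Y lam B₀ S₀ ≤ c₀
  swap
  · exact ⟨2, le_rfl, 0, le_rfl, fun B S hS h => absurd ((hmin (B, S) hS).trans h) hc₀⟩
  obtain ⟨W, hW⟩ : ∃ W, W = dualVar X Y B₀ S₀ := ⟨_, rfl⟩
  obtain ⟨-, -, k3, -⟩ := kkt_of_isMin hσ hlam X Y hS₀ hmin
  simp only [← hW] at k3
  have hU1 : ∀ j, ‖WithLp.toLp 2 (dualRows X lam W j)‖ ≤ 1 := fun j => norm_toLp_le_one (k3 j)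
  obtain ⟨M, hM⟩ : ∃ M, M = |c₀ / lam| + |c₀ / traceWeight n| := ⟨_, rfl⟩
  have hM0 : 0 ≤ M := by rw [hM]; positivity
  obtain ⟨E, hE⟩ : ∃ E, E = c₀ - objective X Y lam B₀ S₀ := ⟨_, rfl⟩
  have hE0 : 0 ≤ E := hE ▸ sub_nonneg.2 hc₀
  have hopt := kktMap_blockPair_of_isMin hσ hlam X Y hS₀ hmin hW
  have hZ₀ : (blockPair (S₀ - σ • 1) fun j => ‖WithLp.toLp 2 (B₀ j)‖).PosSemidef :=
    posSemidef_blockPair hS₀ fun j => norm_nonneg _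
  have hqM : 0 ≤ q * M := by positivity
  have hσ1 : 0 ≤ σ * ‖(1 : Matrix (Fin n) (Fin n) ℝ)‖ := by positivity
  -- The block matrix of the fixed minimizer is the feasible point that the error bound asks for;
  -- the radius bounds the block matrices of the whole sublevel set.
  obtain ⟨N, hN, C, hC, hbound⟩ := psd_errorBound (n + p) _ _ _ hZ₀ hopt
    (M + σ * ‖(1 : Matrix (Fin n) (Fin n) ℝ)‖ + q * M) (by positivity)
  obtain ⟨C₂, hC₂⟩ : ∃ C₂, C₂ = residualConst n q r lam E M := ⟨_, rfl⟩
  have hC₂0 : 0 ≤ C₂ := by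
    have := quadWeight_nonneg n q r
    rw [hC₂, residualConst]; positivity
  obtain ⟨C₃, hC₃⟩ : ∃ C₃, C₃ = C * (1 + p * ‖X‖) := ⟨_, rfl⟩
  have hC₃0 : 0 ≤ C₃ := by rw [hC₃]; positivity
  refine ⟨2 * N, by omega, 2 ^ (2 * N - 1) *
    (C₂ ^ N * E ^ (N - 1) + 2 ^ (2 * N) * (2 * C₃ ^ 2 * (E + 1 ^ 2 * C₂))), by positivity,
    fun B S hS hBS => ?_⟩
  obtain ⟨hBM, hSM⟩ := norm_le_of_objective_le hn hσ hlam X Y hS hBS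
  have hBM' : ‖B‖ ≤ M := by
    rw [hM]; exact hBM.trans ((le_abs_self _).trans (le_add_of_nonneg_right (abs_nonneg _)))
  have hSM' : ‖S‖ ≤ M := by
    rw [hM]; exact hSM.trans ((le_abs_self _).trans (le_add_of_nonneg_left (abs_nonneg _)))
  obtain ⟨ε, hε⟩ : ∃ ε, ε = objective X Y lam B S - objective X Y lam B₀ S₀ := ⟨_, rfl⟩
  have hε0 : 0 ≤ ε := hε ▸ sub_nonneg.2 (hmin (B, S) hS)
  have hεE : ε ≤ E := by linarith
  obtain ⟨r1, r2⟩ := kkt_residual_le hn hq hr hσ hlam X Y hS₀ hmin hW hS hBM' hSM'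
    (eq_add_of_sub_eq' hε.symm) hεE
  rw [← hC₂] at r1 r2
  obtain ⟨a, ha⟩ : ∃ a, a = √(C₂ * ε) := ⟨_, rfl⟩
  rw [← ha] at r1 r2
  have ha0 : 0 ≤ a := ha ▸ Real.sqrt_nonneg _
  have ha2 : a ^ 2 = C₂ * ε := by rw [ha]; exact Real.sq_sqrt (by positivity)
  have hZM : ‖blockPair (S - σ • 1) fun j => ‖WithLp.toLp 2 (B j)‖‖ ≤
      M + σ * ‖(1 : Matrix (Fin n) (Fin n) ℝ)‖ + q * M := by
    refine norm_blockPair_le (by positivity) ?_ fun j => ?_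
    · refine (norm_sub_le _ _).trans ?_
      rw [norm_smul, Real.norm_of_nonneg hσ.le]
      linarith
    · rw [abs_of_nonneg (norm_nonneg _)]
      have : ‖WithLp.toLp 2 (B j)‖ ≤ q * M := (norm_toLp_row_le B j).trans (by gcongr)
      linarith
  obtain ⟨Z', hZ'p, hZ', hdist⟩ := hbound _
    (posSemidef_blockPair hS fun j => norm_nonneg (WithLp.toLp 2 (B j))) hZM
  obtain ⟨hmem, hobj⟩ := objective_eq_of_kktMap_eq hσ hlam X Y hS₀ hmin hW hZ'p hZ'
  refine ⟨_, _, hmem, hobj, ?_⟩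
  have hd1 := norm_sub_scaleRows_le hU1 B (S - σ • 1) (fun j => ‖WithLp.toLp 2 (B j)‖) Z'
  have hd2 := norm_sub_submatrix_le (S - σ • 1) (fun j => ‖WithLp.toLp 2 (B j)‖) Z'
  obtain ⟨e, he⟩ : ∃ e, e = ‖blockPair (S - σ • 1) (fun j => ‖WithLp.toLp 2 (B j)‖) - Z'‖ :=
    ⟨_, rfl⟩
  rw [← he] at hd1 hd2 hdist
  have he0 : 0 ≤ e := he ▸ norm_nonneg _
  rw [sub_sub, add_comm (σ • 1)] at hd2
  -- Brought into the form required by `pow_two_mul_le`, with α = 1; K = 2 there because `e` occurs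
  -- once in the distance of `B` and once in that of `S`.
  have heN : e ^ N ≤ C₃ * (ε + 1 * a) := by
    calc e ^ N ≤ C * ((1 + p * ‖X‖) * a) := hdist.trans (mul_le_mul_of_nonneg_left r2 hC)
      _ = C₃ * a := by rw [hC₃]; ring
      _ ≤ _ := mul_le_mul_of_nonneg_left (by linarith) hC₃0
  rw [← hε]
  refine le_trans (pow_le_pow_left₀ (by positivity) (?_ : _ ≤ a + 2 * e) _)
    (pow_two_mul_le hN ha0 he0 hε0 hεE zero_le_two hC₂0 ha2.le heN)
  linarith

end Growth

/-! ### Descent sequences of finite length. -/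

section Sequences

theorem pow_sub_pow_le_mul {x y : ℝ} (hy : 0 ≤ y) (hxy : y ≤ x) (N : ℕ) :
    x ^ N - y ^ N ≤ N * x ^ (N - 1) * (x - y) := by
  rw [← geom_sum₂_mul]
  refine mul_le_mul_of_nonneg_right ?_ (sub_nonneg.2 hxy)
  calc ∑ i ∈ Finset.range N, x ^ i * y ^ (N - 1 - i) ≤ ∑ _i ∈ Finset.range N, x ^ (N - 1) := by
        refine Finset.sum_le_sum fun i hi => ?_
        have hi' := Finset.mem_range.1 hi
        calc x ^ i * y ^ (N - 1 - i) ≤ x ^ i * x ^ (N - 1 - i) := by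
              have := hy.trans hxy
              gcongr
          _ = x ^ (N - 1) := by rw [← pow_add]; congr 1; omega
    _ = _ := by simp

/-- A descent sequence satisfying a Łojasiewicz inequality has finite length. -/
theorem bounded_sum_of_descent {a d : ℕ → ℝ} {N : ℕ} (hN : 2 ≤ N) {c C : ℝ} (hc : 0 < c)
    (hC : 0 ≤ C) (ha : ∀ k, 0 ≤ a k) (hd : ∀ k, 0 ≤ d k)
    (hdesc : ∀ k, c * d (k + 1) ^ 2 ≤ a k - a (k + 1))
    (hloj : ∀ k, a k ^ (N - 1) ≤ C * d k ^ N) :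
    (∃ D, ∀ K, ∑ k ∈ Finset.range K, d k ≤ D) ∧ Tendsto a atTop (𝓝 0) := by
  have hN0 : N ≠ 0 := by omega
  -- The desingularizing function x ↦ x^(1/N): in terms of `e` the Łojasiewicz inequality becomes
  -- e^(N−1) ≤ C₁ d, which cancels the slope of e ↦ e^N.
  set e : ℕ → ℝ := fun k => a k ^ (N⁻¹ : ℝ) with he
  have he0 : ∀ k, 0 ≤ e k := fun k => Real.rpow_nonneg (ha k) _
  have heN : ∀ k, e k ^ N = a k := fun k => Real.rpow_inv_natCast_pow (ha k) hN0
  obtain ⟨C₁, hC₁, hC₁N⟩ : ∃ C₁ : ℝ, 0 ≤ C₁ ∧ C₁ ^ N = C :=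
    ⟨C ^ (N⁻¹ : ℝ), Real.rpow_nonneg hC _, Real.rpow_inv_natCast_pow hC hN0⟩
  have h1 : ∀ k, e k ^ (N - 1) ≤ C₁ * d k := fun k => by
    refine le_of_pow_le_pow_left₀ hN0 (mul_nonneg hC₁ (hd k)) ?_
    rw [← pow_mul, mul_comm, pow_mul, heN, mul_pow, hC₁N]
    exact hloj k
  have hanti : ∀ k, a (k + 1) ≤ a k := fun k => by
    have := hdesc k
    have : 0 ≤ c * d (k + 1) ^ 2 := by positivity
    linarith
  have heanti : ∀ k, e (k + 1) ≤ e k := fun k =>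
    Real.rpow_le_rpow (ha _) (hanti k) (by positivity)
  set K₀ : ℝ := N * C₁ / c with hK₀
  have h2 : ∀ k, d (k + 1) ≤ (d k + K₀ * (e k - e (k + 1))) / 2 := fun k => by
    have hx : 0 ≤ e k - e (k + 1) := sub_nonneg.2 (heanti k)
    have hK₀0 : 0 ≤ K₀ := by positivity
    have h3 : d (k + 1) ^ 2 ≤ d k * (K₀ * (e k - e (k + 1))) := by
      have h4 : c * d (k + 1) ^ 2 ≤ N * (C₁ * d k) * (e k - e (k + 1)) := by
        calc c * d (k + 1) ^ 2 ≤ e k ^ N - e (k + 1) ^ N := by rw [heN, heN]; exact hdesc k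
          _ ≤ N * e k ^ (N - 1) * (e k - e (k + 1)) :=
              pow_sub_pow_le_mul (he0 _) (heanti k) N
          _ ≤ _ := by gcongr; exact h1 k
      have h5 : d (k + 1) ^ 2 ≤ N * (C₁ * d k) * (e k - e (k + 1)) / c := by
        rw [le_div_iff₀ hc]; linarith
      refine h5.trans (le_of_eq ?_)
      rw [hK₀]; field_simp
    have h6 := hd k
    have h7 : 0 ≤ K₀ * (e k - e (k + 1)) := mul_nonneg hK₀0 hx
    refine le_of_sq_le_sq ?_ (by linarith)
    nlinarith [sq_nonneg (d k - K₀ * (e k - e (k + 1)))]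
  -- The differences of `e` telescope, and half of every `d` is absorbed into the next one; the term
  -- −d K makes the induction close.
  have hsum : ∀ K, ∑ k ∈ Finset.range K, d (k + 1) ≤ d 0 + K₀ * (e 0 - e K) - d K := by
    intro K
    induction K with
    | zero => simp
    | succ K ih =>
      rw [Finset.sum_range_succ]
      have := h2 K
      linarith
  have hbound : ∀ K, ∑ k ∈ Finset.range K, d k ≤ 2 * d 0 + K₀ * e 0 := fun K => by
    have hmono : ∑ k ∈ Finset.range K, d k ≤ ∑ k ∈ Finset.range (K + 1), d k :=
      Finset.sum_le_sum_of_subset_of_nonneg (Finset.range_mono (Nat.le_succ K))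
        fun k _ _ => hd k
    rw [Finset.sum_range_succ'] at hmono
    have := hsum K
    have h8 : 0 ≤ K₀ * e K := mul_nonneg (by positivity) (he0 K)
    have := hd K
    linarith
  refine ⟨⟨_, hbound⟩, ?_⟩
  have hd0 : Tendsto d atTop (𝓝 0) :=
    (summable_of_sum_range_le hd hbound).tendsto_atTop_zero
  have hele : ∀ k, e k ≤ e 0 := fun k => antitone_nat_of_succ_le heanti (Nat.zero_le k)
  refine squeeze_zero ha (g := fun k => C₁ * d k * e 0) (fun k => ?_) ?_
  · calc a k = e k ^ (N - 1) * e k := by rw [← heN k, ← pow_succ]; congr 1; omega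
      _ ≤ C₁ * d k * e 0 := mul_le_mul (h1 k) (hele k) (he0 k) (mul_nonneg hC₁ (hd k))
  · simpa using (hd0.const_mul C₁).mul_const (e 0)

/-- The N-th power of the first inequality and the second give a^N ≤ const · d^N · a, and one factor
`a` cancels. -/
theorem lojasiewicz_of_growth {a d D K C : ℝ} {N : ℕ} (hN : 2 ≤ N) (ha : 0 ≤ a) (hd : 0 ≤ d)
    (hK : 0 ≤ K) (hC : 0 ≤ C) (h1 : a ≤ K * d * D) (h2 : D ^ N ≤ C * a) :
    a ^ (N - 1) ≤ K ^ N * C * d ^ N := by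
  rcases ha.eq_or_lt with rfl | ha
  · rw [zero_pow (by omega)]; positivity
  · refine le_of_mul_le_mul_right ?_ ha
    calc a ^ (N - 1) * a = a ^ N := by rw [← pow_succ]; congr 1; omega
      _ ≤ (K * d * D) ^ N := by gcongr
      _ = K ^ N * d ^ N * D ^ N := by ring
      _ ≤ K ^ N * d ^ N * (C * a) := by gcongr
      _ = _ := by ring

end Sequences

/-! ### Uniqueness of the noise minimizer. -/

section NoiseUpdate

open scoped Matrix.Norms.Elementwise

variable {n p q r : ℕ}

/-- For A = CᴴC and B = DᴴD the trace is the squared Frobenius norm of D Cᴴ. -/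
theorem mul_eq_zero_of_trace_mul_eq_zero {A B : Matrix (Fin n) (Fin n) ℝ} (hA : A.PosSemidef)
    (hB : B.PosSemidef) (h : (A * B).trace = 0) : B * A = 0 := by
  obtain ⟨C, rfl⟩ : ∃ C : Matrix (Fin n) (Fin n) ℝ, A = Cᴴ * C := by
    open scoped MatrixOrder in
    exact CStarAlgebra.nonneg_iff_eq_star_mul_self.mp hA.nonneg
  obtain ⟨D, rfl⟩ : ∃ D : Matrix (Fin n) (Fin n) ℝ, B = Dᴴ * D := by
    open scoped MatrixOrder in
    exact CStarAlgebra.nonneg_iff_eq_star_mul_self.mp hB.nonneg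
  have h1 : ((D * Cᴴ)ᴴ * (D * Cᴴ)).trace = 0 := by
    rw [Matrix.conjTranspose_mul, Matrix.conjTranspose_conjTranspose, Matrix.mul_assoc,
      Matrix.trace_mul_comm, ← h, ← Matrix.trace_mul_comm (Dᴴ * D)]
    simp only [Matrix.mul_assoc]
  have h2 := Matrix.trace_conjTranspose_mul_self_eq_zero_iff.1 h1
  calc Dᴴ * D * (Cᴴ * C) = Dᴴ * (D * Cᴴ) * C := by simp only [Matrix.mul_assoc]
    _ = 0 := by rw [h2]; simp

theorem transpose_multiplier (W : Matrix (Fin n) (Fin r × Fin q) ℝ) :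
    (multiplier W)ᵀ = multiplier W := by
  simp [multiplier, Matrix.transpose_sub, Matrix.transpose_smul, Matrix.transpose_mul]

theorem slope_zero_left (X : Matrix (Fin n) (Fin p) ℝ) (W : Matrix (Fin n) (Fin r × Fin q) ℝ)
    (DS : Matrix (Fin n) (Fin n) ℝ) : slope X W 0 DS = (multiplier W * DS).trace := by
  rw [slope_eq one_pos]
  have : ∑ j, dualRows X 1 W j ⬝ᵥ (0 : Matrix (Fin p) (Fin q) ℝ) j = 0 :=
    Finset.sum_eq_zero fun j _ => dotProduct_zero _
  rw [this]; ring

theorem IsNoiseUpdate.trace_nonneg {σ lam : ℝ} (hσ : 0 < σ) (hlam : 0 < lam)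
    {X : Matrix (Fin n) (Fin p) ℝ} {Y : Fin r → Matrix (Fin n) (Fin q) ℝ}
    {B : Matrix (Fin p) (Fin q) ℝ} {S : Matrix (Fin n) (Fin n) ℝ}
    (h : IsNoiseUpdate X Y lam σ B S) {S' : Matrix (Fin n) (Fin n) ℝ} (hS' : S' ∈ constraint n σ) :
    0 ≤ (multiplier (dualVar X Y B S) * (S' - S)).trace := by
  have h1 := slope_nonneg_of_isMin hσ hlam.le X Y (B := B) (B' := B) h.1 hS' fun s hs hs1 => by
    rw [sub_self, smul_zero, add_zero]
    refine h.2 _ ?_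
    have := convex_constraint n σ h.1 hS' (sub_nonneg.2 hs1) hs.le (by ring)
    have e : S + s • (S' - S) = (1 - s) • S + s • S' := by module
    rwa [e]
  rw [sub_self, sub_self, mul_zero, add_zero, slope_zero_left] at h1
  exact h1

/-- The remainder in the exact expansion must vanish, so S'W = SW. Complementarity holds at both
minimizers with the same multiplier Λ, so (S' − S)Λ = 0. As Λ is a positive multiple of Id minus a
multiple of W Wᵀ, it follows that S' = S; strict convexity in `S` is not used. -/
theorem IsNoiseUpdate.unique (hn : 0 < n) (hq : 0 < q) (hr : 0 < r) {σ lam : ℝ} (hσ : 0 < σ)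
    (hlam : 0 < lam) {X : Matrix (Fin n) (Fin p) ℝ} {Y : Fin r → Matrix (Fin n) (Fin q) ℝ}
    {B : Matrix (Fin p) (Fin q) ℝ} {S S' : Matrix (Fin n) (Fin n) ℝ}
    (h : IsNoiseUpdate X Y lam σ B S) (h' : IsNoiseUpdate X Y lam σ B S') : S' = S := by
  obtain ⟨W, hW⟩ : ∃ W, W = dualVar X Y B S := ⟨_, rfl⟩
  have hVI : ∀ T ∈ constraint n σ, 0 ≤ (multiplier W * (T - S)).trace := fun T hT =>
    hW ▸ h.trace_nonneg hσ hlam hT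
  have hexp := dataFit_eq_add_slope hσ X Y (B := B) (B' := B) h.1 h'.1
  rw [sub_self, slope_zero_left, ← hW] at hexp
  have hle := h'.2 S h.1
  unfold objective at hle
  obtain ⟨Q, hQ⟩ : ∃ Q, Q =
    ((resid X Y B - S' * W)ᵀ * S'⁻¹ * (resid X Y B - S' * W)).trace := ⟨_, rfl⟩
  have hQ0 : 0 ≤ Q := hQ ▸ trace_conj_inv_nonneg hσ h'.1 _
  rw [← hQ] at hexp
  have hc := quadWeight_pos hn hq hr
  have hcQ : 0 ≤ quadWeight n q r * Q := by positivity
  have h1 := hVI S' h'.1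
  have hQz : Q = 0 := by
    have : quadWeight n q r * Q = 0 := by linarith
    exact (mul_eq_zero.1 this).resolve_left hc.ne'
  have htr : (multiplier W * (S' - S)).trace = 0 := by linarith
  have hSW' : resid X Y B - S' * W = 0 := by
    have := norm_sq_le_trace_mul hσ h'.1 (resid X Y B - S' * W)
    rw [← hQ, hQz, mul_zero] at this
    exact norm_eq_zero.1 (pow_eq_zero_iff two_ne_zero |>.1 (le_antisymm this (sq_nonneg _)))
  have hSW : resid X Y B - S * W = 0 := by
    rw [hW, dualVar,
      Matrix.mul_nonsing_inv_cancel_left _ _ (isUnit_det_of_mem_constraint hσ h.1), sub_self]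
  have hHW : (S' - S) * W = 0 := by
    rw [Matrix.sub_mul, sub_eq_zero]
    rw [sub_eq_zero] at hSW hSW'
    rw [← hSW, ← hSW']
  have hΛ : (multiplier W).PosSemidef := by
    refine posSemidef_real_iff.2 ⟨transpose_multiplier W, fun v => ?_⟩
    have hmem : S + Matrix.vecMulVec v v ∈ constraint n σ := by
      have h1 := Matrix.posSemidef_vecMulVec_self_star v
      have h2 := Matrix.PosSemidef.add h.1 h1
      have e : S + Matrix.vecMulVec v v - σ • (1 : Matrix (Fin n) (Fin n) ℝ) =
        (S - σ • 1) + Matrix.vecMulVec v v := by abel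
      show Matrix.PosSemidef _
      rw [e]
      simpa using h2
    have h3 := hVI _ hmem
    rwa [add_sub_cancel_left, Matrix.mul_vecMulVec, Matrix.trace_vecMulVec, dotProduct_comm] at h3
  have hcompl : (multiplier W * (S - σ • 1)).trace = 0 := by
    refine le_antisymm ?_ ?_
    · have h1 := hVI (σ • 1) (smul_one_mem_constraint n σ)
      have e1 : σ • 1 - S = -(S - σ • (1 : Matrix (Fin n) (Fin n) ℝ)) := by abel
      rw [e1, Matrix.mul_neg, Matrix.trace_neg] at h1
      linarith
    · have h2 := hVI ((2 : ℝ) • S - σ • 1) (by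
        have := Matrix.PosSemidef.smul h.1 (zero_le_two (α := ℝ))
        have e : (2 : ℝ) • S - σ • 1 - σ • (1 : Matrix (Fin n) (Fin n) ℝ) =
          (2 : ℝ) • (S - σ • 1) := by module
        show Matrix.PosSemidef _
        rwa [e])
      have e2 : (2 : ℝ) • S - σ • 1 - S = S - σ • (1 : Matrix (Fin n) (Fin n) ℝ) := by module
      rwa [e2] at h2
  have hcompl' : (multiplier W * (S' - σ • 1)).trace = 0 := by
    have e : S' - σ • (1 : Matrix (Fin n) (Fin n) ℝ) = (S' - S) + (S - σ • 1) := by abel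
    rw [e, Matrix.mul_add, Matrix.trace_add, htr, hcompl, add_zero]
  have hz := mul_eq_zero_of_trace_mul_eq_zero hΛ h.1 hcompl
  have hz' := mul_eq_zero_of_trace_mul_eq_zero hΛ h'.1 hcompl'
  have hHΛ : (S' - S) * multiplier W = 0 := by
    have e : S' - S = (S' - σ • (1 : Matrix (Fin n) (Fin n) ℝ)) - (S - σ • 1) := by abel
    rw [e, Matrix.sub_mul, hz, hz', sub_zero]
  have hfin : traceWeight n • (S' - S) = 0 := by
    rw [multiplier, Matrix.mul_sub, Matrix.mul_smul, Matrix.mul_smul, ← Matrix.mul_assoc, hHW,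
      Matrix.zero_mul, smul_zero, sub_zero, Matrix.mul_one] at hHΛ
    exact hHΛ
  exact sub_eq_zero.1 ((smul_eq_zero.1 hfin).resolve_left (traceWeight_pos hn).ne')

end NoiseUpdate

/-! ### Continuity of the noise update and decrease by a row update. -/

section Descent

open scoped Matrix.Norms.Elementwise

variable {n p q r : ℕ}

theorem abs_trace_transpose_mul_le {m κ : Type*} [Fintype m] [Fintype κ] (A B : Matrix m κ ℝ) :
    |(Aᵀ * B).trace| ≤ Fintype.card κ * Fintype.card m * ‖A‖ * ‖B‖ := by
  calc |(Aᵀ * B).trace| ≤ Fintype.card κ * ‖Aᵀ * B‖ := abs_trace_le _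
    _ ≤ Fintype.card κ * (Fintype.card m * ‖Aᵀ‖ * ‖B‖) := by
        gcongr; exact norm_mul_le_card _ _
    _ = _ := by rw [Matrix.norm_transpose]; ring

theorem isCompact_constraint_inter_closedBall (n : ℕ) (σ M : ℝ) :
    IsCompact (Metric.closedBall (0 : Matrix (Fin n) (Fin n) ℝ) M ∩ constraint n σ) := by
  have : ProperSpace (Matrix (Fin n) (Fin n) ℝ) := FiniteDimensional.proper ℝ _
  exact (isCompact_closedBall _ _).inter_right (isClosed_constraint n σ)

theorem exists_norm_inv_le {σ : ℝ} (hσ : 0 < σ) (M : ℝ) :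
    ∃ K, 0 ≤ K ∧ ∀ S ∈ constraint n σ, ‖S‖ ≤ M → ‖S⁻¹‖ ≤ K := by
  have hcont : ContinuousOn (fun S : Matrix (Fin n) (Fin n) ℝ => S⁻¹)
      (Metric.closedBall 0 M ∩ constraint n σ) := fun S hS =>
    (continuousAt_matrix_inv (isUnit_det_of_mem_constraint hσ hS.2).ne_zero).continuousWithinAt
  obtain ⟨K, hK⟩ :=
    (isCompact_constraint_inter_closedBall n σ M).exists_bound_of_continuousOn hcont
  exact ⟨|K|, abs_nonneg _, fun S hS hSM =>
    (hK S ⟨mem_closedBall_zero_iff.2 hSM, hS⟩).trans (le_abs_self _)⟩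

/-- Minimizers in the noise variable depend continuously on `B`. -/
theorem tendsto_isNoiseUpdate (hn : 0 < n) (hq : 0 < q) (hr : 0 < r) {σ lam : ℝ} (hσ : 0 < σ)
    (hlam : 0 < lam) {X : Matrix (Fin n) (Fin p) ℝ} {Y : Fin r → Matrix (Fin n) (Fin q) ℝ}
    {B : ℕ → Matrix (Fin p) (Fin q) ℝ} {S : ℕ → Matrix (Fin n) (Fin n) ℝ}
    (h : ∀ k, IsNoiseUpdate X Y lam σ (B k) (S k)) {B' : Matrix (Fin p) (Fin q) ℝ}
    {S' : Matrix (Fin n) (Fin n) ℝ} (h' : IsNoiseUpdate X Y lam σ B' S')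
    (hB : Tendsto B atTop (𝓝 B')) {M : ℝ} (hM : ∀ k, ‖S k‖ ≤ M) : Tendsto S atTop (𝓝 S') := by
  have hfc : FirstCountableTopology (Matrix (Fin n) (Fin n) ℝ) :=
    inferInstanceAs (FirstCountableTopology (Fin n → Fin n → ℝ))
  refine tendsto_of_subseq_tendsto fun ns hns => ?_
  obtain ⟨y, hy, φ, hφ, hlim⟩ := (isCompact_constraint_inter_closedBall n σ M).tendsto_subseq
    (x := fun k => S (ns k)) fun k => ⟨mem_closedBall_zero_iff.2 (hM _), (h _).1⟩
  refine ⟨φ, ?_⟩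
  have hBl : Tendsto (fun k => B (ns (φ k))) atTop (𝓝 B') :=
    hB.comp (hns.comp hφ.tendsto_atTop)
  -- Minimality passes to the limit along the subsequence, and uniqueness identifies the cluster
  -- point.
  have hy' : IsNoiseUpdate X Y lam σ B' y := by
    refine ⟨hy.2, fun T hT => ?_⟩
    have h1 := (continuousAt_objective X Y lam (z := (B', y))
      (isUnit_det_of_mem_constraint hσ hy.2).ne_zero).tendsto.comp (hBl.prodMk_nhds hlim)
    have h2 := (continuousAt_objective X Y lam (z := (B', T))
      (isUnit_det_of_mem_constraint hσ hT).ne_zero).tendsto.comp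
      (hBl.prodMk_nhds (tendsto_const_nhds (x := T)))
    exact le_of_tendsto_of_tendsto' h1 h2 fun k => (h _).2 T hT
  rwa [h'.unique hn hq hr hσ hlam hy'] at hlim

theorem slope_sub_left (X : Matrix (Fin n) (Fin p) ℝ) (W W' : Matrix (Fin n) (Fin r × Fin q) ℝ)
    (DB : Matrix (Fin p) (Fin q) ℝ) :
    slope X W' DB 0 - slope X W DB 0 =
      -(2 * quadWeight n q r * ((W' - W)ᵀ * stack r (X * DB)).trace) := by
  simp only [slope, Matrix.mul_zero, Matrix.zero_mul, Matrix.trace_zero, Matrix.transpose_sub,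
    Matrix.sub_mul, Matrix.trace_sub]
  ring

theorem abs_slope_sub_le (X : Matrix (Fin n) (Fin p) ℝ) (W W' : Matrix (Fin n) (Fin r × Fin q) ℝ)
    (DB : Matrix (Fin p) (Fin q) ℝ) :
    |slope X W' DB 0 - slope X W DB 0| ≤
      2 * quadWeight n q r * ((r * q) * n * (p * ‖X‖)) * ‖W' - W‖ * ‖DB‖ := by
  have hc := quadWeight_nonneg n q r
  rw [slope_sub_left, abs_neg, abs_mul, abs_of_nonneg (by positivity)]
  have h := abs_trace_transpose_mul_le (W' - W) (stack r (X * DB))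
  simp only [Fintype.card_prod, Fintype.card_fin, Nat.cast_mul] at h
  calc 2 * quadWeight n q r * |((W' - W)ᵀ * stack r (X * DB)).trace|
      ≤ 2 * quadWeight n q r * (r * q * n * ‖W' - W‖ * (p * ‖X‖ * ‖DB‖)) := by
        gcongr
        exact h.trans (by gcongr; exact norm_stack_mul_le X DB)
    _ = _ := by ring

theorem norm_dualVar_sub_le (X : Matrix (Fin n) (Fin p) ℝ) (Y : Fin r → Matrix (Fin n) (Fin q) ℝ)
    (S : Matrix (Fin n) (Fin n) ℝ) (B B' : Matrix (Fin p) (Fin q) ℝ) :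
    ‖dualVar X Y B' S - dualVar X Y B S‖ ≤ n * ‖S⁻¹‖ * (p * ‖X‖ * ‖B' - B‖) := by
  rw [dualVar, dualVar, ← Matrix.mul_sub, resid_sub]
  refine (norm_mul_le_card _ _).trans ?_
  rw [norm_neg, Fintype.card_fin]
  gcongr
  exact norm_stack_mul_le X _

theorem norm_dualVar_le (X : Matrix (Fin n) (Fin p) ℝ) (Y : Fin r → Matrix (Fin n) (Fin q) ℝ)
    (S : Matrix (Fin n) (Fin n) ℝ) (B : Matrix (Fin p) (Fin q) ℝ) :
    ‖dualVar X Y B S‖ ≤ n * ‖S⁻¹‖ * (‖resid X Y 0‖ + p * ‖X‖ * ‖B‖) := by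
  refine (norm_mul_le_card _ _).trans ?_
  rw [Fintype.card_fin, resid_eq]
  gcongr
  exact (norm_sub_le _ _).trans (by gcongr; exact norm_stack_mul_le X _)

/-- The first order condition of a row update. -/
theorem IsRowUpdate.slope_nonneg {σ lam : ℝ} (hσ : 0 < σ) (hlam : 0 < lam)
    {X : Matrix (Fin n) (Fin p) ℝ} {Y : Fin r → Matrix (Fin n) (Fin q) ℝ}
    {S : Matrix (Fin n) (Fin n) ℝ} (hS : S ∈ constraint n σ) {j : Fin p}
    {B B' : Matrix (Fin p) (Fin q) ℝ} (h : IsRowUpdate X Y lam S j B B') (w : Fin q → ℝ) :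
    0 ≤ slope X (dualVar X Y B' S) (B'.updateRow j w - B') 0 +
      lam * (‖WithLp.toLp 2 w‖ - ‖WithLp.toLp 2 (B' j)‖) := by
  obtain ⟨v, hv, hmin⟩ := h
  have hupd : ∀ w', B'.updateRow j w' = B.updateRow j w' := fun w' => by
    rw [hv]; simp
  have h1 := slope_nonneg_of_isMin hσ hlam.le X Y (B := B') (B' := B'.updateRow j w) hS hS
    fun s _ _ => by
      have e : B' + s • (B'.updateRow j w - B') = B'.updateRow j (B' j + s • (w - B' j)) := by
        ext i k
        by_cases hi : i = j
        · subst hi; simp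
        · simp [Matrix.updateRow_ne hi]
      rw [e, sub_self, smul_zero, add_zero, hupd]
      conv_lhs => rw [hv]
      exact hmin _
  rw [sub_self, norm21_updateRow] at h1
  have e : norm21 B' + ‖WithLp.toLp 2 w‖ - ‖WithLp.toLp 2 (B' j)‖ - norm21 B' =
    ‖WithLp.toLp 2 w‖ - ‖WithLp.toLp 2 (B' j)‖ := by ring
  rwa [e] at h1

theorem resid_updateRow_of_col_eq_zero {X : Matrix (Fin n) (Fin p) ℝ}
    (Y : Fin r → Matrix (Fin n) (Fin q) ℝ) {j : Fin p} (hX : ∀ i, X i j = 0)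
    (B : Matrix (Fin p) (Fin q) ℝ) (v : Fin q → ℝ) : resid X Y (B.updateRow j v) = resid X Y B := by
  ext i l
  simp only [resid, Matrix.of_apply, Matrix.mul_apply]
  congr 1
  refine Finset.sum_congr rfl fun j' _ => ?_
  by_cases hj : j' = j
  · subst hj; simp [hX]
  · rw [Matrix.updateRow_ne hj]

/-- Sufficient decrease of a row update. -/
theorem exists_row_decrease (hn : 0 < n) (hq : 0 < q) (hr : 0 < r) {σ lam : ℝ} (hσ : 0 < σ)
    (hlam : 0 < lam) (X : Matrix (Fin n) (Fin p) ℝ) (Y : Fin r → Matrix (Fin n) (Fin q) ℝ)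
    (c₀ : ℝ) (j : Fin p) :
    ∃ κ > 0, ∀ S ∈ constraint n σ, ∀ B B', objective X Y lam B S ≤ c₀ →
      IsRowUpdate X Y lam S j B B' →
      κ * ‖B' - B‖ ^ 2 ≤ objective X Y lam B S - objective X Y lam B' S := by
  have hc := quadWeight_pos hn hq hr
  have hμ := traceWeight_pos hn
  -- For a zero column only the penalty depends on row `j`. The new row is 0 and the decrease is
  -- linear in the old row norm; boundedness of the sublevel set turns this into a quadratic bound.
  by_cases hX : ∀ i, X i j = 0
  · refine ⟨lam / (|c₀ / lam| + 1), by positivity, fun S hS B B' hBS hupd => ?_⟩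
    obtain ⟨v, rfl, hmin⟩ := hupd
    have hobj : ∀ w : Fin q → ℝ, objective X Y lam (B.updateRow j w) S = objective X Y lam B S +
        lam * (‖WithLp.toLp 2 w‖ - ‖WithLp.toLp 2 (B j)‖) := fun w => by
      rw [objective, objective, dataFit_eq, dataFit_eq, resid_updateRow_of_col_eq_zero Y hX,
        norm21_updateRow]
      ring
    have h0 := hmin 0
    rw [hobj, hobj, WithLp.toLp_zero, norm_zero] at h0
    have hv : ‖WithLp.toLp 2 v‖ ≤ 0 := by
      have : lam * ‖WithLp.toLp 2 v‖ ≤ 0 := by linarith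
      exact nonpos_of_mul_nonpos_right this hlam
    have hv0 : v = 0 := by
      have := norm_eq_zero.1 (le_antisymm hv (norm_nonneg _))
      simpa using this
    subst hv0
    have hdiff : ‖B.updateRow j 0 - B‖ ≤ ‖WithLp.toLp 2 (B j)‖ := by
      refine (Matrix.norm_le_iff (norm_nonneg _)).2 fun i k => ?_
      by_cases hi : i = j
      · subst hi
        simpa using norm_toLp_nonneg_le (B i) k
      · simp [Matrix.updateRow_ne hi]
    have hBM := (norm_le_of_objective_le hn hσ hlam X Y hS hBS).1
    have hrow : ‖B.updateRow j 0 - B‖ ≤ |c₀ / lam| + 1 := by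
      have h1 : ‖B.updateRow j 0 - B‖ ≤ ‖B‖ := by
        refine (Matrix.norm_le_iff (norm_nonneg _)).2 fun i k => ?_
        by_cases hi : i = j
        · subst hi
          simpa using B.norm_entry_le_entrywise_sup_norm (i := i) (j := k)
        · simp [Matrix.updateRow_ne hi]
      linarith [le_abs_self (c₀ / lam)]
    rw [hobj, WithLp.toLp_zero, norm_zero]
    have hpos : 0 < |c₀ / lam| + 1 := by positivity
    calc lam / (|c₀ / lam| + 1) * ‖B.updateRow j 0 - B‖ ^ 2
        = lam / (|c₀ / lam| + 1) * (‖B.updateRow j 0 - B‖ * ‖B.updateRow j 0 - B‖) := by rw [sq]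
      _ ≤ lam / (|c₀ / lam| + 1) * ((|c₀ / lam| + 1) * ‖WithLp.toLp 2 (B j)‖) := by gcongr
      _ = lam * ‖WithLp.toLp 2 (B j)‖ := by field_simp
      _ = _ := by ring
  -- A nonzero entry X i j makes the data term strongly convex in row `j`, with a modulus uniform on
  -- the sublevel set because Tr S is bounded there.
  · push Not at hX
    obtain ⟨i, hi⟩ := hX
    have hi' : 0 < |X i j| := abs_pos.2 hi
    have hτ : 0 < n * |c₀ / traceWeight n| + 1 := by positivity
    refine ⟨quadWeight n q r * |X i j| ^ 2 / (n * |c₀ / traceWeight n| + 1), by positivity,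
      fun S hS B B' hBS hupd => ?_⟩
    have hVI := hupd.slope_nonneg hσ hlam hS (B j)
    obtain ⟨v, hv, -⟩ := hupd
    have hback : B'.updateRow j (B j) = B := by rw [hv]; simp
    have hn21 := norm21_updateRow B' j (B j)
    rw [hback] at hVI hn21
    have hexp := dataFit_eq_add_slope hσ X Y (B := B') (B' := B) hS hS
    have hSW : S * dualVar X Y B' S = resid X Y B' :=
      Matrix.mul_nonsing_inv_cancel_left _ _ (isUnit_det_of_mem_constraint hσ hS)
    rw [hSW, sub_self, resid_sub] at hexp
    obtain ⟨Q, hQ⟩ : ∃ Q, Q = ((-stack r (X * (B - B')))ᵀ * S⁻¹ *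
      -stack r (X * (B - B'))).trace := ⟨_, rfl⟩
    rw [← hQ] at hexp
    have hdec : quadWeight n q r * Q ≤ objective X Y lam B S - objective X Y lam B' S := by
      unfold objective
      rw [hexp, hn21]
      nlinarith
    have hQ0 : 0 ≤ Q := hQ ▸ trace_conj_inv_nonneg hσ hS _
    have htr : S.trace ≤ n * |c₀ / traceWeight n| + 1 := by
      have h1 := (le_abs_self _).trans (abs_trace_le S)
      rw [Fintype.card_fin] at h1
      have h2 := (norm_le_of_objective_le hn hσ hlam X Y hS hBS).2.trans (le_abs_self _)
      have : (n : ℝ) * ‖S‖ ≤ n * |c₀ / traceWeight n| := by gcongr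
      linarith
    have h1 : ‖stack r (X * (B - B'))‖ ^ 2 ≤ (n * |c₀ / traceWeight n| + 1) * Q := by
      have h2 := norm_sq_le_trace_mul hσ hS (-stack r (X * (B - B')))
      rw [← hQ, norm_neg] at h2
      exact h2.trans (by gcongr)
    have hcol : |X i j| * ‖B' - B‖ ≤ ‖stack r (X * (B - B'))‖ := by
      rw [← Real.norm_eq_abs, ← norm_smul]
      refine (Matrix.norm_le_iff (norm_nonneg _)).2 fun i' k => ?_
      by_cases hij : i' = j
      · subst hij
        have e : ‖(X i i' • (B' - B)) i' k‖ = ‖stack r (X * (B - B')) i (⟨0, hr⟩, k)‖ := by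
          have : stack r (X * (B - B')) i (⟨0, hr⟩, k) = X i i' * (B - B') i' k := by
            simp only [stack, Matrix.of_apply, Matrix.mul_apply]
            refine Finset.sum_eq_single i' (fun b _ hb => ?_) (by simp)
            rw [Matrix.sub_apply, hv, Matrix.updateRow_ne hb, sub_self, mul_zero]
          rw [this, Matrix.smul_apply, smul_eq_mul, norm_mul, norm_mul, Matrix.sub_apply,
            Matrix.sub_apply, norm_sub_rev]
        rw [e]
        exact Matrix.norm_entry_le_entrywise_sup_norm _
      · have e : (X i j • (B' - B)) i' k = 0 := by
          rw [Matrix.smul_apply, Matrix.sub_apply, hv, Matrix.updateRow_ne hij, sub_self, smul_zero]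
        rw [e, norm_zero]
        exact norm_nonneg _
    calc quadWeight n q r * |X i j| ^ 2 / (n * |c₀ / traceWeight n| + 1) * ‖B' - B‖ ^ 2
        = quadWeight n q r / (n * |c₀ / traceWeight n| + 1) * (|X i j| * ‖B' - B‖) ^ 2 := by ring
      _ ≤ quadWeight n q r / (n * |c₀ / traceWeight n| + 1) *
          ((n * |c₀ / traceWeight n| + 1) * Q) := by
          gcongr
          exact (pow_le_pow_left₀ (by positivity) hcol 2).trans h1
      _ = quadWeight n q r * Q := by field_simp
      _ ≤ _ := hdec

end Descent

/-! ### Estimates for a whole sweep. -/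

section Sweep

open scoped Matrix.Norms.Elementwise

variable {n p q r : ℕ}

theorem slope_sum (X : Matrix (Fin n) (Fin p) ℝ) (W : Matrix (Fin n) (Fin r × Fin q) ℝ)
    {ι : Type*} (s : Finset ι) (D : ι → Matrix (Fin p) (Fin q) ℝ) :
    slope X W (∑ i ∈ s, D i) 0 = ∑ i ∈ s, slope X W (D i) 0 :=
  map_sum (AddMonoidHom.mk' (fun A : Matrix (Fin p) (Fin q) ℝ => slope X W A 0) fun A A' => by
    have := slope_add X W A A' 0 0
    rwa [add_zero] at this) D s

theorem sum_updateRow_sub (A B : Matrix (Fin p) (Fin q) ℝ) :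
    ∑ j, (B.updateRow j (A j) - B) = A - B := by
  ext i k
  rw [Matrix.sum_apply, Finset.sum_eq_single i]
  · simp
  · intro j _ hj
    simp [Matrix.updateRow_ne hj.symm]
  · simp

/-- The rows of the intermediate matrices of a sweep. -/
theorem sweep_rows {X : Matrix (Fin n) (Fin p) ℝ} {Y : Fin r → Matrix (Fin n) (Fin q) ℝ} {lam : ℝ}
    {S : Matrix (Fin n) (Fin n) ℝ} {C : Fin (p + 1) → Matrix (Fin p) (Fin q) ℝ}
    (h : ∀ j : Fin p, IsRowUpdate X Y lam S j (C j.castSucc) (C j.succ)) (k : Fin (p + 1)) :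
    ∀ i, (k ≤ i.castSucc → C k i = C 0 i) ∧ (i.castSucc < k → C k i = C i.succ i) := by
  induction k using Fin.induction with
  | zero => exact fun i => ⟨fun _ => rfl, fun h => absurd h (Fin.not_lt_zero _)⟩
  | succ j ih =>
    intro i
    have hne : i ≠ j → C j.succ i = C j.castSucc i := fun hij => by
      obtain ⟨v, hv, -⟩ := h j
      rw [hv]
      exact Matrix.updateRow_ne hij
    constructor
    · intro hle
      have hij : j < i := by
        change j.val + 1 ≤ i.val at hle
        exact Fin.lt_def.2 hle
      rw [hne hij.ne']
      exact (ih i).1 (Fin.castSucc_le_castSucc_iff.2 hij.le)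
    · intro hlt
      by_cases hij : i = j
      · rw [hij]
      · have hij' : i < j := by
          have h1 : i ≤ j := by
            change i.val < j.val + 1 at hlt
            exact Fin.le_def.2 (Nat.lt_succ_iff.1 hlt)
          exact lt_of_le_of_ne h1 hij
        rw [hne hij]
        exact (ih i).2 (Fin.castSucc_lt_castSucc_iff.2 hij')

theorem fin_sum_sub_telescope (g : Fin (p + 1) → ℝ) :
    ∑ j : Fin p, (g j.castSucc - g j.succ) = g 0 - g (Fin.last p) := by
  have h1 := Fin.sum_univ_succ g
  have h2 := Fin.sum_univ_castSucc g
  rw [Finset.sum_sub_distrib]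
  linarith

/-- A sweep decreases the objective sufficiently, and its result is nearly optimal in `B`. -/
theorem exists_sweep_estimate (hn : 0 < n) (hq : 0 < q) (hr : 0 < r) {σ lam : ℝ} (hσ : 0 < σ)
    (hlam : 0 < lam) (X : Matrix (Fin n) (Fin p) ℝ) (Y : Fin r → Matrix (Fin n) (Fin q) ℝ)
    (c₀ : ℝ) :
    ∃ κ > 0, ∃ K, 0 ≤ K ∧ ∀ S ∈ constraint n σ, ∀ B B', objective X Y lam B S ≤ c₀ →
      IsSweep X Y lam S B B' → ∃ δ, 0 ≤ δ ∧ ‖B' - B‖ ≤ δ ∧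
        κ * δ ^ 2 ≤ objective X Y lam B S - objective X Y lam B' S ∧
        ∀ A, -(K * δ * ‖A - B'‖) ≤
          slope X (dualVar X Y B' S) (A - B') 0 + lam * (norm21 A - norm21 B') := by
  choose κ₁ hκ₁ hdec using exists_row_decrease hn hq hr hσ hlam X Y c₀
  -- A common lower bound for finitely many positive constants, found as a small positive number so
  -- that p = 0 needs no separate case.
  obtain ⟨κ₀, hκ₀le, hκ₀⟩ : ∃ κ₀ : ℝ, (∀ j, κ₀ ≤ κ₁ j) ∧ 0 < κ₀ := by
    have h1 : ∀ᶠ κ : ℝ in 𝓝[>] 0, ∀ j, κ ≤ κ₁ j := eventually_all.2 fun j =>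
      Filter.mem_of_superset (Ioc_mem_nhdsGT (hκ₁ j)) fun x hx => hx.2
    exact (h1.and self_mem_nhdsWithin).exists
  obtain ⟨Ki, hKi, hinv⟩ := exists_norm_inv_le (n := n) hσ |c₀ / traceWeight n|
  have hc := quadWeight_nonneg n q r
  obtain ⟨L, hL⟩ : ∃ L, L = 2 * quadWeight n q r * ((r * q) * n * (p * ‖X‖)) := ⟨_, rfl⟩
  have hL0 : 0 ≤ L := by rw [hL]; positivity
  refine ⟨κ₀ / (p + 1), by positivity, p * (L * (n * Ki * (p * ‖X‖))), by positivity,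
    fun S hS B B' hBS hsw => ?_⟩
  obtain ⟨C, rfl, rfl, hstep⟩ := hsw
  have hmono : ∀ j : Fin p, objective X Y lam (C j.succ) S ≤ objective X Y lam (C j.castSucc) S :=
    fun j => by
      obtain ⟨v, hv, hmin⟩ := hstep j
      have := hmin (C j.castSucc j)
      rwa [Matrix.updateRow_eq_self, ← hv] at this
  have hle : ∀ k, objective X Y lam (C k) S ≤ c₀ := fun k => by
    induction k using Fin.induction with
    | zero => exact hBS
    | succ j ih => exact (hmono j).trans ih
  have hrows := sweep_rows hstep
  obtain ⟨d, hd⟩ : ∃ d : Fin p → ℝ, ∀ j, d j = ‖C j.succ - C j.castSucc‖ := ⟨_, fun _ => rfl⟩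
  have hd0 : ∀ j, 0 ≤ d j := fun j => by rw [hd]; exact norm_nonneg _
  -- The total movement, rather than the distance of the end points, also controls the distance to
  -- every intermediate matrix.
  obtain ⟨δ, hδ⟩ : ∃ δ, δ = ∑ j, d j := ⟨_, rfl⟩
  have hδ0 : 0 ≤ δ := hδ ▸ Finset.sum_nonneg fun j _ => hd0 j
  have hlast : ∀ i, C (Fin.last p) i = C i.succ i := fun i =>
    (hrows (Fin.last p) i).2 (Fin.castSucc_lt_last i)
  have hfirst : ∀ i, C i.castSucc i = C 0 i := fun i => (hrows i.castSucc i).1 le_rfl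
  have hent : ∀ i k, |C (Fin.last p) i k - C 0 i k| ≤ δ := fun i k => by
    rw [hlast, ← hfirst]
    have h1 : |C i.succ i k - C i.castSucc i k| ≤ d i := by
      rw [hd]
      exact (C i.succ - C i.castSucc).norm_entry_le_entrywise_sup_norm (i := i) (j := k)
    exact h1.trans (hδ ▸ Finset.single_le_sum (fun j _ => hd0 j) (Finset.mem_univ i))
  have hdist : ∀ k, ‖C (Fin.last p) - C k‖ ≤ δ := fun k =>
    (Matrix.norm_le_iff hδ0).2 fun i m => by
      rw [Matrix.sub_apply, Real.norm_eq_abs]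
      rcases le_or_gt k i.castSucc with hk | hk
      · rw [(hrows k i).1 hk]; exact hent i m
      · rw [(hrows k i).2 hk, hlast, sub_self, abs_zero]; exact hδ0
  refine ⟨δ, hδ0, hdist 0, ?_, fun A => ?_⟩
  · have h1 : ∀ j, κ₀ * d j ^ 2 ≤
        objective X Y lam (C j.castSucc) S - objective X Y lam (C j.succ) S := fun j => by
      rw [hd]
      refine le_trans ?_ (hdec j S hS _ _ (hle _) (hstep j))
      gcongr
      exact hκ₀le j
    have h2 := Finset.sum_le_sum fun j (_ : j ∈ Finset.univ) => h1 j
    rw [fin_sum_sub_telescope (fun k => objective X Y lam (C k) S), ← Finset.mul_sum] at h2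
    have h3 : δ ^ 2 ≤ p * ∑ j, d j ^ 2 := by
      have := sq_sum_le_card_mul_sum_sq (s := Finset.univ) (f := d)
      rwa [Finset.card_univ, Fintype.card_fin, ← hδ] at this
    have h4 : 0 ≤ ∑ j, d j ^ 2 := Finset.sum_nonneg fun j _ => sq_nonneg _
    calc κ₀ / (p + 1) * δ ^ 2 ≤ κ₀ / (p + 1) * ((p + 1) * ∑ j, d j ^ 2) := by
          gcongr; linarith
      _ = κ₀ * ∑ j, d j ^ 2 := by field_simp
      _ ≤ _ := h2
  · obtain ⟨B', hB'⟩ : ∃ B', B' = C (Fin.last p) := ⟨_, rfl⟩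
    rw [← hB'] at hlast hdist ⊢
    have hrow : ∀ j, -(L * (n * Ki * (p * ‖X‖)) * δ * ‖A - B'‖) ≤
        slope X (dualVar X Y B' S) (B'.updateRow j (A j) - B') 0 +
          lam * (‖WithLp.toLp 2 (A j)‖ - ‖WithLp.toLp 2 (B' j)‖) := fun j => by
      -- This condition holds at the intermediate matrix. Row `j` is not changed afterwards, so the
      -- direction is the same at the end of the sweep and only the dual variable moves, by O(δ).
      have h1 := (hstep j).slope_nonneg hσ hlam hS (A j)
      have e : (C j.succ).updateRow j (A j) - C j.succ = B'.updateRow j (A j) - B' := by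
        ext i k
        by_cases hi : i = j
        · subst hi; simp [hlast]
        · simp [Matrix.updateRow_ne hi]
      rw [e, ← hlast] at h1
      have h2 := abs_slope_sub_le X (dualVar X Y (C j.succ) S) (dualVar X Y B' S)
        (B'.updateRow j (A j) - B')
      rw [← hL] at h2
      have h3 : ‖B'.updateRow j (A j) - B'‖ ≤ ‖A - B'‖ :=
        (Matrix.norm_le_iff (norm_nonneg _)).2 fun i k => by
          by_cases hi : i = j
          · subst hi
            have := (A - B').norm_entry_le_entrywise_sup_norm (i := i) (j := k)
            simpa using this
          · simp [Matrix.updateRow_ne hi]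
      have h4 : ‖dualVar X Y B' S - dualVar X Y (C j.succ) S‖ ≤ n * Ki * (p * ‖X‖ * δ) := by
        refine (norm_dualVar_sub_le X Y S _ _).trans ?_
        have h5 := hinv S hS
          ((norm_le_of_objective_le hn hσ hlam X Y hS hBS).2.trans (le_abs_self _))
        have h6 := hdist j.succ
        gcongr
      have h5 : L * ‖dualVar X Y B' S - dualVar X Y (C j.succ) S‖ *
          ‖B'.updateRow j (A j) - B'‖ ≤ L * (n * Ki * (p * ‖X‖ * δ)) * ‖A - B'‖ := by gcongr
      have h6 := (abs_le.1 (h2.trans h5)).1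
      have e2 : L * (n * Ki * (p * ‖X‖ * δ)) * ‖A - B'‖ =
        L * (n * Ki * (p * ‖X‖)) * δ * ‖A - B'‖ := by ring
      rw [e2] at h6
      linarith
    have hsum := Finset.sum_le_sum fun j (_ : j ∈ Finset.univ) => hrow j
    rw [Finset.sum_add_distrib, ← slope_sum, sum_updateRow_sub, ← Finset.mul_sum,
      Finset.sum_sub_distrib, Finset.sum_const, Finset.card_univ, Fintype.card_fin] at hsum
    refine le_trans (le_of_eq ?_) hsum
    rw [nsmul_eq_mul]; ring

/-- W'W'ᵀ − WWᵀ = W'(W' − W)ᵀ + (W' − W)Wᵀ with bounded W, W'. It carries the optimality of `S`,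
valid at the `B` of the last noise update, over to a later `B`. -/
theorem exists_multiplier_lipschitz {σ : ℝ} (hσ : 0 < σ) (X : Matrix (Fin n) (Fin p) ℝ)
    (Y : Fin r → Matrix (Fin n) (Fin q) ℝ) {M : ℝ} (hM : 0 ≤ M) :
    ∃ K, 0 ≤ K ∧ ∀ S ∈ constraint n σ, ‖S‖ ≤ M → ∀ B B', ‖B‖ ≤ M → ‖B'‖ ≤ M → ∀ H,
      |(multiplier (dualVar X Y B' S) * H).trace - (multiplier (dualVar X Y B S) * H).trace| ≤
        K * ‖B' - B‖ * ‖H‖ := by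
  obtain ⟨Ki, hKi, hinv⟩ := exists_norm_inv_le (n := n) hσ M
  have hc := quadWeight_nonneg n q r
  obtain ⟨V, hV⟩ : ∃ V, V = n * Ki * (‖resid X Y 0‖ + p * ‖X‖ * M) := ⟨_, rfl⟩
  have hV0 : 0 ≤ V := by rw [hV]; positivity
  refine ⟨quadWeight n q r * (n * (n * (2 * (r * q * V * (n * Ki * (p * ‖X‖)))))), by positivity,
    fun S hS hSM B B' hB hB' H => ?_⟩
  have hi := hinv S hS hSM
  obtain ⟨W, hW⟩ : ∃ W, W = dualVar X Y B S := ⟨_, rfl⟩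
  obtain ⟨W', hW'⟩ : ∃ W', W' = dualVar X Y B' S := ⟨_, rfl⟩
  have h1 : ‖W‖ ≤ V := by rw [hW, hV]; exact (norm_dualVar_le X Y S B).trans (by gcongr)
  have h1' : ‖W'‖ ≤ V := by rw [hW', hV]; exact (norm_dualVar_le X Y S B').trans (by gcongr)
  have h2 : ‖W' - W‖ ≤ n * Ki * (p * ‖X‖) * ‖B' - B‖ := by
    rw [hW, hW']
    refine (norm_dualVar_sub_le X Y S B B').trans ?_
    rw [← mul_assoc]
    gcongr
  rw [← hW, ← hW']
  have e : (multiplier W' * H).trace - (multiplier W * H).trace =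
      -(quadWeight n q r * ((W' * (W' - W)ᵀ + (W' - W) * Wᵀ) * H).trace) := by
    simp only [multiplier, Matrix.sub_mul, Matrix.add_mul, Matrix.mul_sub, Matrix.transpose_sub,
      Matrix.smul_mul, Matrix.trace_sub, Matrix.trace_add, Matrix.trace_smul, smul_eq_mul]
    ring
  have h3 : ‖W' * (W' - W)ᵀ + (W' - W) * Wᵀ‖ ≤ 2 * (r * q * V * ‖W' - W‖) := by
    have a1 := norm_mul_le_card W' (W' - W)ᵀ
    have a2 := norm_mul_le_card (W' - W) Wᵀ
    rw [Matrix.norm_transpose, Fintype.card_prod, Fintype.card_fin, Fintype.card_fin,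
      Nat.cast_mul] at a1 a2
    have a3 : (r : ℝ) * q * ‖W'‖ * ‖W' - W‖ ≤ r * q * V * ‖W' - W‖ := by gcongr
    have a4 : (r : ℝ) * q * ‖W' - W‖ * ‖W‖ ≤ r * q * ‖W' - W‖ * V := by gcongr
    refine (norm_add_le _ _).trans ?_
    linarith
  rw [e, abs_neg, abs_mul, abs_of_nonneg hc]
  have h4 := (abs_trace_le ((W' * (W' - W)ᵀ + (W' - W) * Wᵀ) * H)).trans
    (mul_le_mul_of_nonneg_left (norm_mul_le_card _ _) (Nat.cast_nonneg _))
  rw [Fintype.card_fin] at h4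
  calc quadWeight n q r * |((W' * (W' - W)ᵀ + (W' - W) * Wᵀ) * H).trace|
      ≤ quadWeight n q r * (n * (n * (2 * (r * q * V * (n * Ki * (p * ‖X‖) * ‖B' - B‖))) *
          ‖H‖)) := by
        gcongr
        refine h4.trans ?_
        gcongr
        exact h3.trans (by gcongr)
    _ = _ := by ring

end Sweep

/-! ### Convergence of alternate minimization. -/

section Convergence

open scoped Matrix.Norms.Elementwise

variable {n p q r : ℕ}

/-- Between noise updates `S` is frozen; `freq * (t / freq)` is the epoch of the latest one. In
particular every `S (t + 1)` is feasible. -/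
theorem IsAlternateMinimization.isNoiseUpdate {X : Matrix (Fin n) (Fin p) ℝ}
    {Y : Fin r → Matrix (Fin n) (Fin q) ℝ} {lam σ : ℝ} {freq : ℕ}
    {B : ℕ → Matrix (Fin p) (Fin q) ℝ} {S : ℕ → Matrix (Fin n) (Fin n) ℝ}
    (h : IsAlternateMinimization X Y lam σ freq B S) (t : ℕ) :
    IsNoiseUpdate X Y lam σ (B (freq * (t / freq))) (S (t + 1)) := by
  induction t with
  | zero => simpa using (h 0).1 (dvd_zero freq)
  | succ t ih =>
    by_cases hd : freq ∣ t + 1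
    · rw [Nat.mul_div_cancel' hd]
      exact (h (t + 1)).1 hd
    · rw [(h (t + 1)).2.1 hd, Nat.succ_div_of_not_dvd hd]
      exact ih

/-- The comparison starts with `S (t + 1)`, since `S 0` may be infeasible and then bounds nothing.
-/
theorem IsAlternateMinimization.objective_noise_le {X : Matrix (Fin n) (Fin p) ℝ}
    {Y : Fin r → Matrix (Fin n) (Fin q) ℝ} {lam σ : ℝ} {freq : ℕ}
    {B : ℕ → Matrix (Fin p) (Fin q) ℝ} {S : ℕ → Matrix (Fin n) (Fin n) ℝ}
    (h : IsAlternateMinimization X Y lam σ freq B S) (t : ℕ) :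
    objective X Y lam (B (t + 1)) (S (t + 2)) ≤ objective X Y lam (B (t + 1)) (S (t + 1)) := by
  by_cases hd : freq ∣ t + 1
  · exact ((h (t + 1)).1 hd).2 _ (h.isNoiseUpdate t).1
  · rw [(h (t + 1)).2.1 hd]

theorem norm_sub_le_sum_range {V : Type*} [SeminormedAddCommGroup V] {B : ℕ → V} {δ : ℕ → ℝ}
    (h : ∀ t, ‖B (t + 1) - B t‖ ≤ δ t) (s j : ℕ) :
    ‖B (s + j) - B s‖ ≤ ∑ i ∈ Finset.range j, δ (s + i) := by
  induction j with
  | zero => simp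
  | succ j ih =>
    rw [Finset.sum_range_succ]
    have e : B (s + (j + 1)) - B s = (B (s + j) - B s) + (B (s + j + 1) - B (s + j)) := by
      rw [← add_assoc]; abel
    rw [e]
    exact (norm_add_le _ _).trans (add_le_add ih (h _))

theorem sum_range_mul_eq (δ : ℕ → ℝ) (ν K : ℕ) :
    ∑ t ∈ Finset.range (K * ν), δ t =
      ∑ k ∈ Finset.range K, ∑ i ∈ Finset.range ν, δ (k * ν + i) := by
  induction K with
  | zero => simp
  | succ K ih => rw [Finset.sum_range_succ, ← ih, Nat.succ_mul, Finset.sum_range_add]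

/-- The suboptimality after a sweep that follows a noise update. -/
theorem suboptimality_le {σ lam : ℝ} (hσ : 0 < σ) (hlam : 0 < lam) {X : Matrix (Fin n) (Fin p) ℝ}
    {Y : Fin r → Matrix (Fin n) (Fin q) ℝ} {K K' d M : ℝ} (hK' : 0 ≤ K')
    (hK : 0 ≤ K)
    (hlip : ∀ S ∈ constraint n σ, ‖S‖ ≤ M → ∀ B B' : Matrix (Fin p) (Fin q) ℝ, ‖B‖ ≤ M → ‖B'‖ ≤ M →
      ∀ H, |(multiplier (dualVar X Y B' S) * H).trace -
        (multiplier (dualVar X Y B S) * H).trace| ≤ K' * ‖B' - B‖ * ‖H‖)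
    {B B' : Matrix (Fin p) (Fin q) ℝ} {S : Matrix (Fin n) (Fin n) ℝ}
    (hB : ‖B‖ ≤ M) (hB' : ‖B'‖ ≤ M) (hS : ‖S‖ ≤ M) (hnoise : IsNoiseUpdate X Y lam σ B S)
    (hd0 : 0 ≤ d) (hd : ‖B' - B‖ ≤ d) {A : Matrix (Fin p) (Fin q) ℝ}
    (hrows : -(K * d * ‖A - B'‖) ≤
      slope X (dualVar X Y B' S) (A - B') 0 + lam * (norm21 A - norm21 B'))
    {T : Matrix (Fin n) (Fin n) ℝ} (hT : T ∈ constraint n σ) :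
    objective X Y lam B' S - objective X Y lam A T ≤
      (K + K') * d * (‖B' - A‖ + ‖S - T‖) := by
  have h1 := dataFit_add_slope_le hσ X Y (B := B') (B' := A) hnoise.1 hT
  have h2 : slope X (dualVar X Y B' S) (A - B') (T - S) =
      slope X (dualVar X Y B' S) (A - B') 0 + slope X (dualVar X Y B' S) 0 (T - S) := by
    rw [← slope_add, add_zero, zero_add]
  rw [h2, slope_zero_left] at h1
  have h3 := hnoise.trace_nonneg hσ hlam hT
  have h4 := (abs_le.1 (hlip S hnoise.1 hS B B' hB hB' (T - S))).1
  have h5 : K' * ‖B' - B‖ * ‖T - S‖ ≤ K' * d * ‖T - S‖ := by gcongr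
  -- The tangent inequality at (B', S) is split into its two directions: the sweep bounds the one in
  -- `B`, the noise update at the older `B` together with `hlip` the one in `S`.
  rw [norm_sub_rev A B'] at hrows
  rw [norm_sub_rev T S] at h4 h5
  have h6 : 0 ≤ K' * d * ‖B' - A‖ := by positivity
  have h7 : 0 ≤ K * d * ‖S - T‖ := by positivity
  unfold objective
  have e : (K + K') * d * (‖B' - A‖ + ‖S - T‖) = K * d * ‖B' - A‖ + K * d * ‖S - T‖ +
    K' * d * ‖B' - A‖ + K' * d * ‖S - T‖ := by ring
  linarith

/-- Finite length of the sequence of coefficient matrices, and convergence of the values. -/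
theorem IsAlternateMinimization.summable (hn : 0 < n) (hq : 0 < q) (hr : 0 < r) {σ lam : ℝ}
    (hσ : 0 < σ) (hlam : 0 < lam) {X : Matrix (Fin n) (Fin p) ℝ}
    {Y : Fin r → Matrix (Fin n) (Fin q) ℝ} {freq : ℕ} (hfreq : 0 < freq)
    {B : ℕ → Matrix (Fin p) (Fin q) ℝ} {S : ℕ → Matrix (Fin n) (Fin n) ℝ}
    (h : IsAlternateMinimization X Y lam σ freq B S)
    {B₀ : Matrix (Fin p) (Fin q) ℝ} {S₀ : Matrix (Fin n) (Fin n) ℝ} (hS₀ : S₀ ∈ constraint n σ)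
    (hmin : ∀ z ∈ feasible n p q σ, objective X Y lam B₀ S₀ ≤ objective X Y lam z.1 z.2) :
    (∃ δ : ℕ → ℝ, Summable δ ∧ ∀ t, ‖B (t + 1) - B t‖ ≤ δ t) ∧
    (∃ M, ∀ t, ‖S (t + 1)‖ ≤ M) ∧
    Tendsto (fun t => objective X Y lam (B t) (S t)) atTop (𝓝 (objective X Y lam B₀ S₀)) := by
  have hS : ∀ t, S (t + 1) ∈ constraint n σ := fun t => (h.isNoiseUpdate t).1
  -- The level is taken after the first noise update, as `S 0` is arbitrary.
  obtain ⟨c₀, hc₀⟩ : ∃ c₀, c₀ = objective X Y lam (B 0) (S 1) := ⟨_, rfl⟩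
  obtain ⟨κ, hκ, K, hK, hsweep⟩ := exists_sweep_estimate hn hq hr hσ hlam X Y c₀
  have hstart : ∀ t, objective X Y lam (B t) (S (t + 1)) ≤ c₀ := fun t => by
    induction t with
    | zero => exact hc₀.ge
    | succ t ih =>
      obtain ⟨δ, -, -, hdec, -⟩ := hsweep _ (hS t) _ _ ih (h t).2.2
      have h1 := h.objective_noise_le t
      have : 0 ≤ κ * δ ^ 2 := by positivity
      linarith
  choose δ hδ0 hδ hdec hopt using fun t => hsweep _ (hS t) _ _ (hstart t) (h t).2.2
  obtain ⟨P, hP⟩ : ∃ P : ℕ → ℝ, ∀ t, P t = objective X Y lam (B (t + 1)) (S (t + 1)) :=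
    ⟨_, fun _ => rfl⟩
  have hPc : ∀ t, P t ≤ c₀ := fun t => by
    have : 0 ≤ κ * δ t ^ 2 := by positivity
    rw [hP]; linarith [hdec t, hstart t]
  have hPdec : ∀ t, κ * δ (t + 1) ^ 2 ≤ P t - P (t + 1) := fun t => by
    rw [hP, hP]
    have h1 := hdec (t + 1)
    have h2 := h.objective_noise_le t
    linarith
  obtain ⟨M, hM⟩ : ∃ M, M = |c₀ / lam| + |c₀ / traceWeight n| := ⟨_, rfl⟩
  have hM0 : 0 ≤ M := by rw [hM]; positivity
  have hBM : ∀ t, ‖B t‖ ≤ M := fun t => by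
    rw [hM]
    exact (norm_le_of_objective_le hn hσ hlam X Y (hS t) (hstart t)).1.trans
      ((le_abs_self _).trans (le_add_of_nonneg_right (abs_nonneg _)))
  have hSM : ∀ t, ‖S (t + 1)‖ ≤ M := fun t => by
    rw [hM]
    exact (norm_le_of_objective_le hn hσ hlam X Y (hS t) (hstart t)).2.trans
      ((le_abs_self _).trans (le_add_of_nonneg_left (abs_nonneg _)))
  obtain ⟨K', hK', hlip⟩ := exists_multiplier_lipschitz (r := r) (q := q) hσ X Y hM0
  obtain ⟨N, hN, C, hC, hgrowth⟩ := exists_growth hn hq hr hσ hlam X Y hS₀ hmin c₀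
  -- Epochs are grouped into blocks that start with a noise update: `a k` is the suboptimality at
  -- the end of block `k`, and `d k` the total movement within it.
  obtain ⟨m, rfl⟩ : ∃ m, freq = m + 1 := ⟨freq - 1, by omega⟩
  obtain ⟨a, ha⟩ : ∃ a : ℕ → ℝ, ∀ k, a k = P (k * (m + 1) + m) - objective X Y lam B₀ S₀ :=
    ⟨_, fun _ => rfl⟩
  obtain ⟨d, hd⟩ : ∃ d : ℕ → ℝ, ∀ k, d k = ∑ i ∈ Finset.range (m + 1), δ (k * (m + 1) + i) :=
    ⟨_, fun _ => rfl⟩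
  have ha0 : ∀ k, 0 ≤ a k := fun k => by
    rw [ha, hP]
    exact sub_nonneg.2 (hmin (_, _) (hS _))
  have hd0 : ∀ k, 0 ≤ d k := fun k => by
    rw [hd]; exact Finset.sum_nonneg fun i _ => hδ0 _
  have htel : ∀ s j, κ * ∑ i ∈ Finset.range j, δ (s + 1 + i) ^ 2 ≤ P s - P (s + j) := by
    intro s j
    induction j with
    | zero => simp
    | succ j ih =>
      rw [Finset.sum_range_succ, mul_add]
      have := hPdec (s + j)
      have e : s + 1 + j = s + j + 1 := by ring
      rw [e, ← add_assoc]
      linarith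
  have hdesc : ∀ k, κ / (m + 1) * d (k + 1) ^ 2 ≤ a k - a (k + 1) := fun k => by
    have h1 := htel (k * (m + 1) + m) (m + 1)
    have e1 : k * (m + 1) + m + 1 = (k + 1) * (m + 1) := by ring
    have e2 : k * (m + 1) + m + (m + 1) = (k + 1) * (m + 1) + m := by ring
    rw [e1, e2] at h1
    have h2 : d (k + 1) ^ 2 ≤
        (m + 1) * ∑ i ∈ Finset.range (m + 1), δ ((k + 1) * (m + 1) + i) ^ 2 := by
      have := sq_sum_le_card_mul_sum_sq (s := Finset.range (m + 1))
        (f := fun i => δ ((k + 1) * (m + 1) + i))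
      rw [Finset.card_range] at this
      rw [hd]
      exact_mod_cast this
    rw [ha, ha]
    calc κ / (m + 1) * d (k + 1) ^ 2 ≤ κ / (m + 1) *
          ((m + 1) * ∑ i ∈ Finset.range (m + 1), δ ((k + 1) * (m + 1) + i) ^ 2) := by gcongr
      _ = κ * ∑ i ∈ Finset.range (m + 1), δ ((k + 1) * (m + 1) + i) ^ 2 := by field_simp
      _ ≤ _ := by linarith
  -- At the end of a block, `S` is optimal for the `B` at its beginning, which is within `d k`; the
  -- last sweep moved by at most `d k` too. Growth supplies the nearby minimizer (A, T) to compare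
  -- with.
  have hloj : ∀ k, a k ^ (N - 1) ≤ (K + K') ^ N * C * d k ^ N := fun k => by
    obtain ⟨t, ht⟩ : ∃ t, t = k * (m + 1) + m := ⟨_, rfl⟩
    have hdiv : (m + 1) * (t / (m + 1)) = k * (m + 1) := by
      rw [ht, mul_comm k, Nat.mul_add_div (Nat.succ_pos m), Nat.div_eq_of_lt (Nat.lt_succ_self m),
        add_zero]
    have hnoise := h.isNoiseUpdate t
    rw [hdiv] at hnoise
    have hδd : δ t ≤ d k := by
      rw [hd, ht]
      exact Finset.single_le_sum (f := fun i => δ (k * (m + 1) + i)) (fun i _ => hδ0 _)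
        (Finset.mem_range.2 (Nat.lt_succ_self m))
    have hBd : ‖B (t + 1) - B (k * (m + 1))‖ ≤ d k := by
      rw [hd, ht]
      exact norm_sub_le_sum_range hδ (k * (m + 1)) (m + 1)
    have hak : a k = objective X Y lam (B (t + 1)) (S (t + 1)) - objective X Y lam B₀ S₀ := by
      rw [ha, ← ht, hP]
    obtain ⟨A, T, hT, hAT, hdist⟩ := hgrowth (B (t + 1)) (S (t + 1)) (hS t) (by
      rw [← hP]; exact hPc t)
    rw [← hak] at hdist
    have hrows : -(K * d k * ‖A - B (t + 1)‖) ≤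
        slope X (dualVar X Y (B (t + 1)) (S (t + 1))) (A - B (t + 1)) 0 +
          lam * (norm21 A - norm21 (B (t + 1))) := by
      refine le_trans ?_ (hopt t A)
      have : K * δ t * ‖A - B (t + 1)‖ ≤ K * d k * ‖A - B (t + 1)‖ := by gcongr
      linarith
    have hsub := suboptimality_le hσ hlam hK' hK hlip (hBM _) (hBM (t + 1)) (hSM t) hnoise
      (hd0 k) hBd hrows hT
    rw [hAT, ← hak] at hsub
    exact lojasiewicz_of_growth hN (ha0 k) (hd0 k) (by positivity) hC hsub hdist
  obtain ⟨⟨D, hD⟩, hlim⟩ := bounded_sum_of_descent hN (by positivity : 0 < κ / (m + 1))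
    (by positivity) ha0 hd0 hdesc hloj
  refine ⟨⟨δ, ?_, hδ⟩, ⟨M, hSM⟩, ?_⟩
  · refine summable_of_sum_range_le hδ0 (c := D) fun t => ?_
    calc ∑ i ∈ Finset.range t, δ i ≤ ∑ i ∈ Finset.range (t * (m + 1)), δ i :=
          Finset.sum_le_sum_of_subset_of_nonneg
            (Finset.range_mono (Nat.le_mul_of_pos_right t (Nat.succ_pos m))) fun i _ _ => hδ0 i
      _ = ∑ k ∈ Finset.range t, d k := by
          rw [sum_range_mul_eq]
          exact Finset.sum_congr rfl fun k _ => (hd k).symm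
      _ ≤ D := hD t
  -- So far the values converge along ends of blocks; monotonicity extends this to all epochs.
  · have hPanti : Antitone P := antitone_nat_of_succ_le fun t => by
      have := hPdec t
      have : 0 ≤ κ * δ (t + 1) ^ 2 := by positivity
      linarith
    have hsubseq : Tendsto (fun k => P (k * (m + 1) + m)) atTop (𝓝 (objective X Y lam B₀ S₀)) := by
      have h1 := hlim.add_const (objective X Y lam B₀ S₀)
      rw [zero_add] at h1
      refine h1.congr fun k => ?_
      rw [ha]; ring
    have hbdd : BddBelow (Set.range P) := ⟨objective X Y lam B₀ S₀, by
      rintro _ ⟨t, rfl⟩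
      rw [hP]
      exact hmin (_, _) (hS _)⟩
    have hPlim := tendsto_atTop_ciInf hPanti hbdd
    have hidx : Tendsto (fun k : ℕ => k * (m + 1) + m) atTop atTop :=
      tendsto_atTop_mono
        (fun k => (Nat.le_mul_of_pos_right k (Nat.succ_pos m)).trans (Nat.le_add_right _ _)) tendsto_id
    have heq := tendsto_nhds_unique (hPlim.comp hidx) hsubseq
    rw [heq] at hPlim
    refine (tendsto_add_atTop_iff_nat 1).1 (hPlim.congr fun t => hP t)

/-- Alternate minimization converges to a global minimizer. -/
theorem IsAlternateMinimization.exists_limit (hn : 0 < n) (hq : 0 < q) (hr : 0 < r) {σ lam : ℝ}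
    (hσ : 0 < σ) (hlam : 0 < lam) {X : Matrix (Fin n) (Fin p) ℝ}
    {Y : Fin r → Matrix (Fin n) (Fin q) ℝ} {freq : ℕ} (hfreq : 0 < freq)
    {B : ℕ → Matrix (Fin p) (Fin q) ℝ} {S : ℕ → Matrix (Fin n) (Fin n) ℝ}
    (h : IsAlternateMinimization X Y lam σ freq B S) :
    ∃ (B' : Matrix (Fin p) (Fin q) ℝ) (S' : Matrix (Fin n) (Fin n) ℝ),
      (B', S') ∈ feasible n p q σ ∧
      (∀ z ∈ feasible n p q σ, objective X Y lam B' S' ≤ objective X Y lam z.1 z.2) ∧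
      Tendsto B atTop (𝓝 B') ∧ Tendsto S atTop (𝓝 S') ∧
      Tendsto (fun t => objective X Y lam (B t) (S t)) atTop (𝓝 (objective X Y lam B' S')) := by
  obtain ⟨⟨B₀, S₀⟩, hS₀, hmin⟩ := exists_isMinOn_objective (Z := feasible n p q σ) hn hσ hlam X Y
    ((isClosed_constraint n σ).preimage continuous_snd)
    ⟨(0, σ • 1), smul_one_mem_constraint n σ⟩ subset_rfl
  obtain ⟨⟨δ, hδ, hBδ⟩, ⟨M, hM⟩, hval⟩ := h.summable hn hq hr hσ hlam hfreq hS₀ hmin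
  have hcauchy : CauchySeq B := cauchySeq_of_dist_le_of_summable δ (fun t => by
    rw [dist_comm, dist_eq_norm]; exact hBδ t) hδ
  have hcomplete : CompleteSpace (Matrix (Fin p) (Fin q) ℝ) := FiniteDimensional.complete ℝ _
  obtain ⟨B', hB'⟩ := cauchySeq_tendsto_of_complete hcauchy
  -- The candidate limit of `S` is the noise minimizer for the limit of `B`; continuity of the noise
  -- update makes it the actual limit.
  obtain ⟨S', hS'⟩ := exists_isNoiseUpdate hn hσ hlam X Y B'
  have hidx : Tendsto (fun t : ℕ => freq * (t / freq)) atTop atTop :=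
    (tendsto_id.const_mul_atTop' hfreq).comp (Nat.tendsto_div_const_atTop hfreq.ne')
  have hSlim : Tendsto S atTop (𝓝 S') := (tendsto_add_atTop_iff_nat 1).1
    (tendsto_isNoiseUpdate hn hq hr hσ hlam h.isNoiseUpdate hS' (hB'.comp hidx) hM)
  have hobj := (continuousAt_objective X Y lam (z := (B', S'))
    (isUnit_det_of_mem_constraint hσ hS'.1).ne_zero).tendsto.comp (hB'.prodMk_nhds hSlim)
  -- Global optimality of the limit is read off from the values and not from optimality in each
  -- block of variables.
  have heq : objective X Y lam B' S' = objective X Y lam B₀ S₀ := tendsto_nhds_unique hobj hval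
  exact ⟨B', S', hS'.1, fun z hz => heq ▸ hmin z hz, hB', hSlim, hobj⟩

end Convergence

end

end Clar
theorem mainTheorem3 {n p q r : ℕ} (hn : 0 < n) (hq : 0 < q) (hr : 0 < r)
    (X : Matrix (Fin n) (Fin p) ℝ) (Y : Fin r → Matrix (Fin n) (Fin q) ℝ)
    (lam σ : ℝ) (hlam : 0 < lam) (hσ : 0 < σ) :
    -- joint convexity of the objective on the (convex) feasible set
    ConvexOn ℝ (Clar.feasible n p q σ) (fun z => Clar.objective X Y lam z.1 z.2) ∧
    -- the data term is convex on the feasible set and smooth around each of its points,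
    -- and its gradient is Lipschitz on the bounded parts of the feasible set
    ConvexOn ℝ (Clar.feasible n p q σ) (fun z => Clar.dataFit X Y z.1 z.2) ∧
    (∀ x : Clar.PairSpace n p q, Clar.toPair x ∈ Clar.feasible n p q σ →
      ContDiffAt ℝ ∞ (Clar.dataFitPair X Y) x) ∧
    (∀ K : Set (Clar.PairSpace n p q), Bornology.IsBounded K →
      (∀ x ∈ K, Clar.toPair x ∈ Clar.feasible n p q σ) →
      ∃ L : ℝ≥0, LipschitzOnWith L (gradient (Clar.dataFitPair X Y)) K) ∧
    -- the penalty is convex, and separable in the rows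
    ConvexOn ℝ Set.univ (fun B : Matrix (Fin p) (Fin q) ℝ => Clar.norm21 B) ∧
    (∃ g : Fin p → (Fin q → ℝ) → ℝ, (∀ j, ConvexOn ℝ Set.univ (g j)) ∧
      ∀ B : Matrix (Fin p) (Fin q) ℝ, Clar.norm21 B = ∑ j, g j (B j)) ∧
    -- alternate minimization is well defined, and converges to a global minimum
    ∀ freq : ℕ, 0 < freq →
      (∀ (B₀ : Matrix (Fin p) (Fin q) ℝ) (S₀ : Matrix (Fin n) (Fin n) ℝ),
        ∃ (B : ℕ → Matrix (Fin p) (Fin q) ℝ) (S : ℕ → Matrix (Fin n) (Fin n) ℝ),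
          B 0 = B₀ ∧ S 0 = S₀ ∧ Clar.IsAlternateMinimization X Y lam σ freq B S) ∧
      ∀ (B : ℕ → Matrix (Fin p) (Fin q) ℝ) (S : ℕ → Matrix (Fin n) (Fin n) ℝ),
        Clar.IsAlternateMinimization X Y lam σ freq B S →
        ∃ (B' : Matrix (Fin p) (Fin q) ℝ) (S' : Matrix (Fin n) (Fin n) ℝ),
          (B', S') ∈ Clar.feasible n p q σ ∧
          (∀ z ∈ Clar.feasible n p q σ,
            Clar.objective X Y lam B' S' ≤ Clar.objective X Y lam z.1 z.2) ∧
          Tendsto B atTop (𝓝 B') ∧ Tendsto S atTop (𝓝 S') ∧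
          Tendsto (fun t => Clar.objective X Y lam (B t) (S t)) atTop
            (𝓝 (Clar.objective X Y lam B' S')) := by 
  refine ⟨Clar.convexOn_objective hσ hlam.le X Y, Clar.convexOn_dataFit hσ X Y,
    fun x hx => Clar.contDiffAt_dataFitPair X Y (Clar.isUnit_det_of_mem_constraint hσ hx).ne_zero,
    fun K hK hKF => Clar.exists_lipschitzOnWith_gradient hσ X Y hK hKF, Clar.convexOn_norm21 p q,
    ⟨fun _ v => ‖WithLp.toLp 2 v‖, fun _ => Clar.convexOn_norm_toLp q, fun _ => rfl⟩,
    fun freq hfreq => ⟨fun B₀ S₀ => Clar.exists_isAlternateMinimization hn hσ hlam X Y freq B₀ S₀,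
      fun B S h => h.exists_limit hn hq hr hσ hlam hfreq⟩⟩
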